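/- **Setting.** Write $x=(x_{\rm h},x_3)\in\mathbb R^3_+=\mathbb R^2\times(0,\infty)$, and let $\Delta_{\rm h},\nabla_{\rm h}$ be the Laplacian and gradient in $x_{\rm h}$. Fix a smooth radial, radially non-increasing $\chi:\mathbb R^2\to[0,1]$ supported in $B(0,4/3)$ with $\chi=1$ on $B(0,3/4)$; put $\varphi(\xi)=\chi(\xi/2)-\chi(\xi)$, $\Delta^{\rm h}_j=\varphi(2^{-j}D_{\rm h})$ and $S_j=\chi(2^{-j}D_{\rm h})$, $j\in\mathbb Z$. Let $\mathscr S'_h(\mathbb R^2)$ be the space of $f\in\mathscr S'(\mathbb R^2)$ with $S_jf\to0$ in $\mathscr S'$ as $j\to-\infty$. A field on $\mathbb R^3_+$ is a weakly locally integrable function of $x_3>0$ with values in $\mathscr S'_h(\mathbb R^2)$ (for a.e. $x_3$). For $1\le p,q,\sigma\le\infty$ let $$\|f\|_{\mathcal L^{p,q}_\sigma}=\Big\|\big(\|\Delta^{\rm h}_jf\|_{L^q_{x_3}(0,\infty;L^p(\mathbb R^2))}\big)_{j\in\mathbb Z}\Big\|_{\ell^\sigma(\mathbb Z)}\in[0,\infty],\qquad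 \mathcal L^p_\sigma=\mathcal L^{p,p}_\sigma .$$ Let $S=(S_{x_1},S_{x_2})=\nabla_{\rm h}(-\Delta_{\rm h})^{-1/2}$ be the vector of Riesz transforms on $\mathbb R^2$, $|\nabla_{\rm h}|=(-\Delta_{\rm h})^{1/2}$, and $$Uf(\cdot,x_3)=|\nabla_{\rm h}|\int_0^{x_3}e^{-(x_3-y_3)|\nabla_{\rm h}|}f(\cdot,y_3)\,dy_3 .$$ For $t>0$ and $u_0=(u_{0,\rm h},u_{0,3})$, the anisotropic Stokes semigroup $e^{-tA}$, that is the solution operator of $\partial_tu-\Delta_{\rm h}u+\nabla p=0$, $\operatorname{div}u=0$, $u|_{\partial\mathbb R^3_+}=0$, $u(0)=u_0$, is given by $$(e^{-tA}u_0)_3=Ue^{t\Delta_{\rm h}}(u_{0,3}-S\cdot u_{0,\rm h}),\qquad (e^{-tA}u_0)_{\rm h}=e^{t\Delta_{\rm h}}(u_{0,\rm h}+Su_{0,3})-SUe^{t\Delta_{\rm h}}(u_{0,3}-S\cdot u_{0,\rm h}),$$ where the identities are understood in $\mathscr S'_h(\mathbb R^2)$ for a.e. $x_3>0$ (equivalently,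 after applying every $\Delta^{\rm h}_j$). **Lemma 2.5.** For every $1\le q\le\infty$, every $t>0$ and every field $u_0\in\mathcal L^{1,q}_\infty(\mathbb R^3_+)$ with $\operatorname{div}u_0=0$, these formulas define a field $e^{-tA}u_0$. Moreover the following estimates hold (they are trivial where the right-hand side is infinite). 1. Let $1\le p,q\le\infty$ with $(p,q)\ne(1,1)$ and $1<r\le\infty$. There is a constant $C=C(p,q,r)>0$ such that for all $t>0$ and all fields $u_0$ with $\operatorname{div}u_0=0$ $$\|(e^{-tA}u_0)_{\rm h}\|_{\mathcal L^{r,q}_1}\le Ct^{-(1-\frac1r)}\|u_0\|_{\mathcal L^{1,q}_\infty}+Ct^{-(1-\frac1r)-\frac12(1-\frac1q)}\|u_0\|_{\mathcal L^1_\infty},$$ $$\|(e^{-tA}u_0)_3\|_{\mathcal L^{p,q}_1}\le Ct^{-(1-\frac1p)-\frac12(1-\frac1q)}\|u_0\|_{\mathcal L^1_\infty}.$$ 2. Let $1<q\le\infty$. There is a constant $C=C(q)>0$ such that for all $1\le\sigma\le\infty$, all $t>0$ and all fields $u_0$ with $\operatorname{div}u_0=0$ $$\|e^{-tA}u_0\|_{\mathcal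 L^{1,q}_\sigma}\le C\|u_0\|_{\mathcal L^{1,q}_\sigma}+Ct^{-\frac12(1-\frac1q)}\|u_0\|_{\mathcal L^1_\infty}.$$ 3. There is a constant $C>0$ such that for all $1\le\sigma\le\infty$, all $t>0$ and all fields $u_0$ with $\operatorname{div}u_0=0$ $$\|e^{-tA}u_0\|_{\mathcal L^1_\sigma}\le C\|u_0\|_{\mathcal L^1_\sigma}.$$ -/

import Mathlib

open MeasureTheory Set Filter Topology
open scoped SchwartzMap FourierTransform LineDeriv ENNReal ContDiff

noncomputable section

namespace AnisotropicStokes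

/-- The horizontal plane `ℝ²` with its Euclidean norm. -/
abbrev Plane : Type := EuclideanSpace ℝ (Fin 2)

/-- A scalar field on the half-space `ℝ³₊ = ℝ² × (0, ∞)`, regarded as a function of the vertical
variable `x₃` with values in the tempered distributions of the horizontal variable.
Only the values at `x₃ > 0` matter. -/
abbrev ScalarField : Type := ℝ → 𝓢'(Plane, ℂ)

/-- A field on the half-space with components indexed by `ι`. -/
abbrev VectorField (ι : Type) : Type := ι → ScalarField

/-! ### Horizontal Littlewood--Paley theory -/

/-- The low-frequency cut-off `χ` from which the dyadic partition of unity is made: smooth, radial,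
radially non-increasing, with values in `[0, 1]`, supported in `B(0, 4/3)` and equal to `1` on
`B(0, 3/4)`. (The usual properties of `φ(ξ) = χ(ξ/2) - χ(ξ)`, that is `0 ≤ φ ≤ 1`,
`supp φ ⊆ {3/4 ≤ |ξ| ≤ 8/3}` and `∑ⱼ φ(2⁻ʲ ξ) = 1` for `ξ ≠ 0`, are consequences.) -/
structure IsCutoff (χ : Plane → ℝ) : Prop where
  smooth : ContDiff ℝ ∞ χ
  radial_antitone : ∀ ξ η : Plane, ‖ξ‖ ≤ ‖η‖ → χ η ≤ χ ξ
  nonneg : ∀ ξ, 0 ≤ χ ξ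
  le_one : ∀ ξ, χ ξ ≤ 1
  support : tsupport χ ⊆ Metric.ball 0 (4 / 3)
  eq_one : ∀ ξ ∈ Metric.ball (0 : Plane) (3 / 4), χ ξ = 1

/-- The symbol `φ(2⁻ʲ ξ)` of `Δⱼʰ`, where `φ(ξ) = χ(ξ/2) - χ(ξ)`. -/
def dyadicSymbol (χ : Plane → ℝ) (j : ℤ) (ξ : Plane) : ℝ :=
  χ ((2 : ℝ)⁻¹ • ((2 : ℝ) ^ (-j) • ξ)) - χ ((2 : ℝ) ^ (-j) • ξ)

open scoped Classical in
/-- A smooth compactly supported function as a Schwartz function (`0` for any other function). -/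
def toSchwartz (g : Plane → ℂ) : 𝓢(Plane, ℂ) :=
  if h : HasCompactSupport g ∧ ContDiff ℝ ∞ g then h.1.toSchwartzMap h.2 else 0

/-- The smooth function `g(D) f` on `ℝ²`, for a smooth compactly supported symbol `g` and a tempered
distribution `f`:  `(g(D) f)(x) = ⟨f, k(x - ·)⟩` with
`k(z) = (2π)⁻² ∫ exp (i z·ξ) g(ξ) dξ = ∫ exp (2πi z·η) g(2πη) dη`. The frequency variable `ξ` is that
of the Fourier transform `∫ exp (-i x·ξ) f(x) dx`; Mathlib's `𝓕` uses `η = ξ / 2π`, and `k(x - ·)` is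
the Fourier transform `𝓕` of the function `η ↦ exp (2πi x·η) g(2πη)`. -/
def symbolFun (g : Plane → ℂ) (f : 𝓢'(Plane, ℂ)) (x : Plane) : ℂ :=
  f (𝓕 (toSchwartz fun η : Plane =>
    Complex.exp (2 * Real.pi * Complex.I * (inner ℝ x η : ℝ)) * g ((2 * Real.pi) • η)))

/-- `Δⱼʰ m(D) f` as a function on `ℝ²`, for a symbol `m` that is smooth away from `ξ = 0`. -/
def dyadicMul (χ : Plane → ℝ) (j : ℤ) (m : Plane → ℂ) (f : 𝓢'(Plane, ℂ)) : Plane → ℂ :=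
  symbolFun (fun ξ => (dyadicSymbol χ j ξ : ℂ) * m ξ) f

/-- The dyadic block `Δⱼʰ f` as a function on `ℝ²`. -/
def dyadicBlock (χ : Plane → ℝ) (j : ℤ) (f : 𝓢'(Plane, ℂ)) : Plane → ℂ :=
  dyadicMul χ j (fun _ => 1) f

/-- The low-frequency cut-off `Sⱼ f = χ(2⁻ʲ D) f`. -/
def lowFrequency (χ : Plane → ℝ) (j : ℤ) (f : 𝓢'(Plane, ℂ)) : 𝓢'(Plane, ℂ) :=
  TemperedDistribution.fourierMultiplierCLM ℂ
    (fun η : Plane => (χ ((2 : ℝ) ^ (-j) • ((2 * Real.pi) • η)) : ℂ)) f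

/-- The space `𝓢'_h(ℝ²)` of tempered distributions `f` with `Sⱼ f → 0` in `𝓢'` as `j → -∞`. -/
def IsHomogeneous (χ : Plane → ℝ) (f : 𝓢'(Plane, ℂ)) : Prop :=
  Tendsto (fun j : ℤ => lowFrequency χ j f) atBot (𝓝 0)

/-- A scalar field on the half-space with values in `𝓢'_h(ℝ²)` that is (weakly) locally integrable
in the vertical variable. -/
structure IsScalarField (χ : Plane → ℝ) (f : ScalarField) : Prop where
  locallyIntegrable : ∀ ψ : 𝓢(Plane, ℂ), LocallyIntegrableOn (fun x₃ => f x₃ ψ) (Ioi 0)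
  homogeneous : ∀ᵐ x₃ ∂(volume.restrict (Ioi (0 : ℝ))), IsHomogeneous χ (f x₃)

/-! ### Chemin--Lerner type norms -/

/-- The norm of `ℓ^σ(ℤ)`, with values in `[0, ∞]`. -/
def seqNorm (σ : ℝ≥0∞) (a : ℤ → ℝ≥0∞) : ℝ≥0∞ :=
  if σ = ⊤ then ⨆ j, a j else (∑' j, a j ^ σ.toReal) ^ (1 / σ.toReal)

/-- The norm of `L^q_{x₃}(0, ∞; L^p(ℝ²))`, with values in `[0, ∞]`. -/
def mixedNorm {V : Type} [NormedAddCommGroup V] (p q : ℝ≥0∞) (F : ℝ → Plane → V) : ℝ≥0∞ :=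
  eLpNorm (fun x₃ => eLpNorm (F x₃) p volume) q (volume.restrict (Ioi (0 : ℝ)))

/-- The norm of `𝓛^{p,q}_σ(ℝ³₊)`, with values in `[0, ∞]`: the `ℓ^σ(ℤ)` norm of the sequence
`j ↦ ‖Δⱼʰ u‖_{L^q_{x₃} L^p}`, the components of `u` being put together by the Euclidean norm. -/
def clNorm {ι : Type} [Fintype ι] (χ : Plane → ℝ) (p q σ : ℝ≥0∞) (u : VectorField ι) : ℝ≥0∞ :=
  seqNorm σ fun j =>
    mixedNorm p q fun x₃ x => WithLp.toLp 2 fun i => dyadicBlock χ j (u i x₃) x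

/-! ### The anisotropic Stokes semigroup -/

/-- The `k`-th horizontal direction. -/
def horizDir (k : Fin 2) : Plane := EuclideanSpace.single k 1

/-- The horizontal part of a three-component field. -/
def horizontal (u : VectorField (Fin 3)) : VectorField (Fin 2) := fun k => u k.castSucc

/-- The vertical (third) component of a three-component field. -/
def vertical (u : VectorField (Fin 3)) : VectorField (Fin 1) := fun _ => u 2

/-- `div u = 0` in the sense of distributions on the open half-space, tested with the products
`ψ(x_h) η(x₃)`, `ψ` a Schwartz function and `η ∈ C_c^∞((0, ∞))`. -/
def IsDivFree (u : VectorField (Fin 3)) : Prop :=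
  ∀ (ψ : 𝓢(Plane, ℂ)) (η : ℝ → ℝ), ContDiff ℝ ∞ η → HasCompactSupport η → tsupport η ⊆ Ioi 0 →
    ∫ x₃ in Ioi (0 : ℝ), ((η x₃ : ℂ) * ∑ k : Fin 2, horizontal u k x₃ (∂_{horizDir k} ψ)
      + ((deriv η x₃ : ℝ) : ℂ) * u 2 x₃ ψ) = 0

/-- The symbol `i ξ_k / |ξ|` of the Riesz transform `S_k = ∂_k (-Δ_h)^{-1/2}`. -/
def rieszSymbol (k : Fin 2) (ξ : Plane) : ℂ := Complex.I * (ξ k : ℂ) / (‖ξ‖ : ℂ)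

/-- The symbol `|ξ| exp (-s |ξ|) exp (-t |ξ|²)` of `|∇_h| e^{-s|∇_h|} e^{tΔ_h}`. -/
def poissonHeatSymbol (t s : ℝ) (ξ : Plane) : ℂ :=
  ((‖ξ‖ * Real.exp (-s * ‖ξ‖) * Real.exp (-t * ‖ξ‖ ^ 2) : ℝ) : ℂ)

/-- The symbol `exp (-t |ξ|²)` of `e^{tΔ_h}`. -/
def heatSymbol (t : ℝ) (ξ : Plane) : ℂ := (Real.exp (-t * ‖ξ‖ ^ 2) : ℂ)

/-- The function `Δⱼʰ m(D) U e^{tΔ_h} (u₀₃ - S · u₀ₕ)` at height `x₃`, where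
`U f(x₃) = |∇_h| ∫₀^{x₃} e^{-(x₃ - y₃)|∇_h|} f(y₃) dy₃`. -/
def dyadicU (χ : Plane → ℝ) (j : ℤ) (m : Plane → ℂ) (t : ℝ) (u₀ : VectorField (Fin 3)) (x₃ : ℝ)
    (x : Plane) : ℂ :=
  ∫ y₃ in (0 : ℝ)..x₃,
    (dyadicMul χ j (fun ξ => m ξ * poissonHeatSymbol t (x₃ - y₃) ξ) (u₀ 2 y₃) x
      - ∑ k : Fin 2, dyadicMul χ j
          (fun ξ => m ξ * poissonHeatSymbol t (x₃ - y₃) ξ * rieszSymbol k ξ)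
          (horizontal u₀ k y₃) x)

/-- `u = e^{-tA} u₀`, where `e^{-tA}` is the solution operator of the anisotropic Stokes system
`∂ₜu - Δ_h u + ∇p = 0`, `div u = 0`, `u|_{x₃ = 0} = 0`, `u(0) = u₀` on the half-space, given by
`u₃ = U e^{tΔ_h} (u₀₃ - S · u₀ₕ)` and
`uₕ = e^{tΔ_h} (u₀ₕ + S u₀₃) - S U e^{tΔ_h} (u₀₃ - S · u₀ₕ)`.
The symbols involved are singular at `ξ = 0` only, so these identities are understood in `𝓢'_h(ℝ²)`,
whose elements are determined by their dyadic blocks. -/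
structure IsStokesEvolution (χ : Plane → ℝ) (t : ℝ) (u₀ u : VectorField (Fin 3)) : Prop where
  isField : ∀ i, IsScalarField χ (u i)
  vertical_eq : ∀ᵐ x₃ ∂(volume.restrict (Ioi (0 : ℝ))), ∀ (j : ℤ) (x : Plane),
    dyadicBlock χ j (u 2 x₃) x = dyadicU χ j (fun _ => 1) t u₀ x₃ x
  horizontal_eq : ∀ᵐ x₃ ∂(volume.restrict (Ioi (0 : ℝ))), ∀ (k : Fin 2) (j : ℤ) (x : Plane),
    dyadicBlock χ j (horizontal u k x₃) x =
      dyadicMul χ j (heatSymbol t) (horizontal u₀ k x₃) x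
        + dyadicMul χ j (fun ξ => heatSymbol t ξ * rieszSymbol k ξ) (u₀ 2 x₃) x
        - dyadicU χ j (rieszSymbol k) t u₀ x₃ x

open scoped Classical in
/-- The field `e^{-tA} u₀`, unique up to a null set of heights `x₃`
(`0` if `u₀` is so irregular that there is none). -/
def stokesSemigroup (χ : Plane → ℝ) (t : ℝ) (u₀ : VectorField (Fin 3)) : VectorField (Fin 3) :=
  if h : ∃ u, IsStokesEvolution χ t u₀ u then h.choose else 0

end AnisotropicStokes

end

open MeasureTheory Set Filter Topology
open scoped SchwartzMap FourierTransform LineDeriv ENNReal ContDiff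

noncomputable section

namespace AnisotropicStokes
/-! ### Translation of Schwartz functions and tempered distributions -/

/-! On a frequency shell |ξ| ~ 2ʲ every operator in the formulas is convolution with a well-behaved
kernel. A wider cut-off (`fatSymbol`) equals 1 on the support of the symbol of Δⱼ, so Δⱼ m(D) f is
the function Δⱼ f convolved with the kernel of the fattened symbol times m
(`dyadicMul_eq_symbolAct`). After rescaling to |ξ| ~ 1, three derivatives of the symbol control the
kernel. For e^{tΔ_h}, possibly composed with a Riesz transform, the L¹ norm is ≲ e^{-ct4ʲ} and the
sup norm ≲ 4ʲ e^{-ct4ʲ}. The operator |∇_h| e^{-s|∇_h|} e^{tΔ_h} brings an extra factor 2ʲ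
e^{-cs2ʲ}. Riesz transforms cost nothing, being smooth and homogeneous of degree zero off the
origin.

Let N_j(y) be the L¹ norm of Δⱼu₀ at height y and k_j(s) = 2ʲ e^{-cs2ʲ} for s ≥ 0. The j-th block of
the vertical component then has L¹ norm ≲ e^{-ct4ʲ} (k_j * N_j)(x₃); the horizontal part has N_j(x₃)
in addition; sup norms obey the same bounds times 4ʲ (`exists_stokes_block_bounds`). Interpolation
turns this into L^p in x_h at the price 4^{j(1-1/p)}. As ∫k_j = 1/c and k_j ≤ 2ʲ, Young's inequality
in x₃ maps L^q to L^q uniformly in j, or L¹ to L^q at the price 2^{j(1-1/q)}.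

The gain from ℓ^∞ to ℓ¹ is the heat smoothing Σⱼ 2^{ja} e^{-ct4ʲ} ≲ t^{-a/2}, valid for a > 0
(`exists_dyadic_sum_le`). It is used with a = 2(1-1/r) for the horizontal part and a = 2(1-1/p) +
(1-1/q) for the vertical one. Without any change of exponents, each block is bounded by the same
block of u₀, which gives the 𝓛^{1,q}_σ bounds for every σ. Since U is treated by L¹ * L^q ⊆ L^q, the
first terms on the right already suffice in the horizontal bound and in the 𝓛^{1,q}_σ bound.

Existence is a separate matter: the prescribed blocks must come from a field. They satisfy the
compatibility relations of dyadic blocks (`IsBlockFamily`), and Σⱼ 4ʲ e^{-ct4ʲ} < ∞ makes their sum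
a bounded function of x_h for almost every x₃, whose low frequencies vanish in the limit
(`exists_isHomogeneous`, `exists_isScalarField`). The calculus h(D)(g(D)f) = (hg)(D)f for arbitrary
tempered f rests on passing a distribution under a convolution integral (`apply_convolution`). -/

lemma iteratedFDeriv_compSubConst (k : 𝓢(Plane, ℂ)) (a y : Plane) (l : ℕ) :
    iteratedFDeriv ℝ l (k.compSubConstCLM ℂ a) y = iteratedFDeriv ℝ l k (y - a) := by
  have : (⇑(k.compSubConstCLM ℂ a)) = fun y => k (y - a) := by ext y; simp
  rw [this, iteratedFDeriv_comp_sub]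

lemma pow_le_two_pow_mul {a b c : ℝ} (ha : 0 ≤ a) (hb : 0 ≤ b) (hc : 0 ≤ c) (h : a ≤ b + c)
    (k : ℕ) : a ^ k ≤ 2 ^ k * (b ^ k + c ^ k) := by
  rcases le_total b c with h' | h'
  · calc a ^ k ≤ (2 * c) ^ k := by gcongr; linarith
      _ = 2 ^ k * c ^ k := by rw [mul_pow]
      _ ≤ _ := by gcongr; linarith [pow_nonneg hb k]
  · calc a ^ k ≤ (2 * b) ^ k := by gcongr; linarith
      _ = 2 ^ k * b ^ k := by rw [mul_pow]
      _ ≤ _ := by gcongr; linarith [pow_nonneg hc k]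

lemma seminorm_compSubConst_le (k : 𝓢(Plane, ℂ)) (a : Plane) (n l : ℕ) :
    SchwartzMap.seminorm ℂ n l (k.compSubConstCLM ℂ a) ≤
      2 ^ n * (SchwartzMap.seminorm ℂ n l k + ‖a‖ ^ n * SchwartzMap.seminorm ℂ 0 l k) := by
  refine SchwartzMap.seminorm_le_bound ℂ n l _ (by positivity) fun y => ?_
  rw [iteratedFDeriv_compSubConst]
  have h1 := SchwartzMap.le_seminorm ℂ n l k (y - a)
  have h2 := SchwartzMap.le_seminorm ℂ 0 l k (y - a)
  have h3 : ‖y‖ ^ n ≤ 2 ^ n * (‖y - a‖ ^ n + ‖a‖ ^ n) :=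
    pow_le_two_pow_mul (norm_nonneg _) (norm_nonneg _) (norm_nonneg _)
      (by simpa using norm_add_le (y - a) a) n
  calc _ ≤ 2 ^ n * (‖y - a‖ ^ n + ‖a‖ ^ n) * ‖iteratedFDeriv ℝ l k (y - a)‖ := by gcongr
    _ = 2 ^ n * (‖y - a‖ ^ n * ‖iteratedFDeriv ℝ l k (y - a)‖
          + ‖a‖ ^ n * (‖y - a‖ ^ 0 * ‖iteratedFDeriv ℝ l k (y - a)‖)) := by ring
    _ ≤ _ := by gcongr

/-- Mean value inequality on the segment from y to y - a. The weight ‖y‖ⁿ is moved to the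
intermediate point w through ‖y‖ ≤ ‖w‖ + 1. -/
lemma seminorm_compSubConst_sub_le (k : 𝓢(Plane, ℂ)) {a : Plane} (ha : ‖a‖ ≤ 1) (n l : ℕ) :
    SchwartzMap.seminorm ℂ n l (k.compSubConstCLM ℂ a - k) ≤
      ‖a‖ * (2 ^ n * (SchwartzMap.seminorm ℂ n (l + 1) k + SchwartzMap.seminorm ℂ 0 (l + 1) k)) := by
  refine SchwartzMap.seminorm_le_bound ℂ n l _ (by positivity) fun y => ?_
  have hsub : iteratedFDeriv ℝ l (k.compSubConstCLM ℂ a - k) y =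
      iteratedFDeriv ℝ l k (y - a) - iteratedFDeriv ℝ l k y := by
    have : (⇑(k.compSubConstCLM ℂ a - k)) = (⇑(k.compSubConstCLM ℂ a)) - (⇑k) := by ext; simp
    rw [this, iteratedFDeriv_sub_apply ((SchwartzMap.smooth _ l).contDiffAt)
      ((SchwartzMap.smooth _ l).contDiffAt), iteratedFDeriv_compSubConst]
  rw [hsub]
  have hd : Differentiable ℝ (iteratedFDeriv ℝ l k) :=
    (k.smooth (l + 1)).differentiable_iteratedFDeriv (by exact_mod_cast Nat.lt_succ_self l)
  set M : ℝ := 2 ^ n * (SchwartzMap.seminorm ℂ n (l + 1) k + SchwartzMap.seminorm ℂ 0 (l + 1) k)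
    with hM
  rcases (pow_nonneg (norm_nonneg y) n).eq_or_lt with h0 | h0
  · rw [← h0, zero_mul]; positivity
  have hbound : ∀ w ∈ segment ℝ y (y - a), ‖fderiv ℝ (iteratedFDeriv ℝ l k) w‖ ≤
      M / ‖y‖ ^ n := by
    intro w hw
    rw [norm_fderiv_iteratedFDeriv, le_div_iff₀ h0, mul_comm]
    have hw' : ‖y‖ ≤ ‖w‖ + 1 := by
      have h1 : ‖y - w‖ ≤ ‖y - (y - a)‖ := by
        obtain ⟨θ, hθ, rfl⟩ := (segment_eq_image' ℝ y (y - a) ▸ hw)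
        have : y - (y + θ • (y - a - y)) = θ • a := by
          rw [show y - a - y = -a by abel, smul_neg]; abel
        simp only [this, norm_smul, sub_sub_cancel]
        rw [Real.norm_of_nonneg hθ.1]
        exact mul_le_of_le_one_left (norm_nonneg _) hθ.2
      have h2 := norm_sub_norm_le y w
      rw [sub_sub_cancel] at h1
      linarith
    have h1 := SchwartzMap.le_seminorm ℂ n (l + 1) k w
    have h2 := SchwartzMap.le_seminorm ℂ 0 (l + 1) k w
    have h3 := pow_le_two_pow_mul (norm_nonneg _) (norm_nonneg _) zero_le_one hw' n
    calc _ ≤ 2 ^ n * (‖w‖ ^ n + 1 ^ n) * ‖iteratedFDeriv ℝ (l + 1) k w‖ := by gcongr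
      _ = 2 ^ n * (‖w‖ ^ n * ‖iteratedFDeriv ℝ (l + 1) k w‖
          + ‖w‖ ^ 0 * ‖iteratedFDeriv ℝ (l + 1) k w‖) := by simp; ring
      _ ≤ _ := by rw [hM]; gcongr
  have := (convex_segment y (y - a)).norm_image_sub_le_of_norm_fderiv_le (𝕜 := ℝ)
    (fun w _ => hd w) hbound (left_mem_segment ℝ y (y - a)) (right_mem_segment ℝ y (y - a))
  rw [sub_sub_cancel_left, norm_neg, div_mul_eq_mul_div, le_div_iff₀ h0] at this
  linarith

lemma continuous_compSubConst (k : 𝓢(Plane, ℂ)) :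
    Continuous fun a : Plane => k.compSubConstCLM ℂ a := by
  rw [continuous_iff_continuousAt]
  intro a
  rw [ContinuousAt, (schwartz_withSeminorms ℂ Plane ℂ).tendsto_nhds]
  rintro ⟨n, l⟩ ε hε
  set M : ℝ := 2 ^ n * (SchwartzMap.seminorm ℂ n (l + 1) (k.compSubConstCLM ℂ a)
    + SchwartzMap.seminorm ℂ 0 (l + 1) (k.compSubConstCLM ℂ a)) with hM
  have hM0 : 0 ≤ M := by positivity
  filter_upwards [Metric.ball_mem_nhds a (show 0 < min 1 (ε / (M + 1)) by positivity)] with b hb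
  rw [Metric.mem_ball, dist_eq_norm, lt_min_iff] at hb
  have : k.compSubConstCLM ℂ b = (k.compSubConstCLM ℂ a).compSubConstCLM ℂ (b - a) := by simp
  rw [this, SchwartzMap.schwartzSeminormFamily_apply]
  refine (seminorm_compSubConst_sub_le _ hb.1.le n l).trans_lt ?_
  rw [← hM]
  calc _ ≤ ‖b - a‖ * (M + 1) := by gcongr; linarith
    _ < ε := by rw [← lt_div_iff₀ (by positivity)]; exact hb.2

/-! ### Factorization of tempered distributions through Banach spaces. -/

/-- Points of the plane together with `l` directions of norm at most one. -/
abbrev JetPoint (l : ℕ) : Type := Plane × (Fin l → Metric.closedBall (0 : Plane) 1)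

lemma norm_iteratedFDeriv_apply_le (ψ : 𝓢(Plane, ℂ)) (n l : ℕ) (p : JetPoint l) :
    ‖(‖p.1‖ ^ n : ℝ) * iteratedFDeriv ℝ l ψ p.1 (fun a => (p.2 a : Plane))‖ ≤
      SchwartzMap.seminorm ℂ n l ψ := by
  rw [norm_mul, Complex.norm_real, norm_pow, norm_norm]
  refine le_trans ?_ (SchwartzMap.le_seminorm ℂ n l ψ p.1)
  gcongr
  refine (ContinuousMultilinearMap.le_opNorm _ _).trans
    (mul_le_of_le_one_right (norm_nonneg _) (Finset.prod_le_one (fun _ _ => norm_nonneg _)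
      fun a _ => ?_))
  exact mem_closedBall_zero_iff.1 (p.2 a).2

/-- The map `ψ ↦ ‖y‖ⁿ D^l ψ(y)` from Schwartz functions to bounded continuous functions. -/
def weightedDeriv (i : ℕ × ℕ) :
    𝓢(Plane, ℂ) →L[ℂ] BoundedContinuousFunction (JetPoint i.2) ℂ :=
  SchwartzMap.mkCLMtoNormedSpace (fun ψ : 𝓢(Plane, ℂ) =>
    BoundedContinuousFunction.ofNormedAddCommGroup
      (fun p : JetPoint i.2 => (‖p.1‖ ^ i.1 : ℝ) *
        iteratedFDeriv ℝ i.2 ψ p.1 (fun a => (p.2 a : Plane)))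
      (by
        refine Continuous.mul (by fun_prop) ?_
        have h := ((ψ.smooth i.2).continuous_iteratedFDeriv le_rfl)
        exact (h.comp continuous_fst).eval (by fun_prop))
      (SchwartzMap.seminorm ℂ i.1 i.2 ψ)
      (norm_iteratedFDeriv_apply_le ψ i.1 i.2))
    (fun ψ φ => by
      ext1 y
      have : (⇑(ψ + φ)) = (⇑ψ) + (⇑φ) := by ext; simp
      simp [this, iteratedFDeriv_add_apply ((ψ.smooth i.2).contDiffAt)
        ((φ.smooth i.2).contDiffAt), mul_add])
    (fun c ψ => by
      ext1 y
      have : (⇑(c • ψ)) = c • (⇑ψ) := by ext; simp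
      simp [this, iteratedFDeriv_const_smul_apply ((ψ.smooth i.2).contDiffAt), mul_left_comm])
    ⟨{i}, 1, zero_le_one, fun ψ => by
      simp only [Finset.sup_singleton, one_mul]
      exact BoundedContinuousFunction.norm_ofNormedAddCommGroup_le _ (by positivity) _⟩

@[simp]
lemma weightedDeriv_apply (i : ℕ × ℕ) (ψ : 𝓢(Plane, ℂ)) (p : JetPoint i.2) :
    weightedDeriv i ψ p =
      (‖p.1‖ ^ i.1 : ℝ) * iteratedFDeriv ℝ i.2 ψ p.1 (fun a => (p.2 a : Plane)) := rfl

lemma norm_weightedDeriv_le (i : ℕ × ℕ) (ψ : 𝓢(Plane, ℂ)) :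
    ‖weightedDeriv i ψ‖ ≤ SchwartzMap.seminorm ℂ i.1 i.2 ψ :=
  (BoundedContinuousFunction.norm_le (by positivity)).2 (norm_iteratedFDeriv_apply_le ψ i.1 i.2)

/-- With `norm_weightedDeriv_le`, this makes each Schwartz seminorm the norm of a linear image in a
Banach space. Unit directions suffice because the derivative is multilinear. -/
lemma seminorm_le_norm_weightedDeriv (i : ℕ × ℕ) (ψ : 𝓢(Plane, ℂ)) :
    SchwartzMap.seminorm ℂ i.1 i.2 ψ ≤ ‖weightedDeriv i ψ‖ := by
  refine SchwartzMap.seminorm_le_bound ℂ _ _ _ (norm_nonneg (weightedDeriv i ψ)) fun y => ?_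
  rcases (pow_nonneg (norm_nonneg y) i.1).eq_or_lt with h0 | h0
  · rw [← h0, zero_mul]; exact norm_nonneg (weightedDeriv i ψ)
  rw [mul_comm, ← le_div_iff₀ h0]
  refine ContinuousMultilinearMap.opNorm_le_bound
    (div_nonneg (norm_nonneg (weightedDeriv i ψ)) h0.le) fun m => ?_
  let u : Fin i.2 → Metric.closedBall (0 : Plane) 1 := fun a =>
    ⟨‖m a‖⁻¹ • m a, by
      rw [mem_closedBall_zero_iff, norm_smul, norm_inv, norm_norm]
      exact inv_mul_le_one⟩
  have hm : m = fun a => ‖m a‖ • (u a : Plane) := by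
    funext a
    rcases eq_or_ne (m a) 0 with h | h
    · simp [h]
    · simp [u, smul_smul, mul_inv_cancel₀ (norm_ne_zero_iff.2 h)]
  have h1 := (weightedDeriv i ψ).norm_coe_le_norm (y, u)
  rw [weightedDeriv_apply, norm_mul, Complex.norm_real, norm_pow, norm_norm] at h1
  have h2 : iteratedFDeriv ℝ i.2 ψ y m =
      (∏ a, ‖m a‖) • iteratedFDeriv ℝ i.2 ψ y (fun a => (u a : Plane)) := by
    conv_lhs => rw [hm]
    exact ContinuousMultilinearMap.map_smul_univ _ _ _
  rw [h2, norm_smul, Real.norm_of_nonneg (Finset.prod_nonneg fun _ _ => norm_nonneg _), mul_comm]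
  gcongr
  rwa [le_div_iff₀ h0, mul_comm]

/-- The bound forces f to vanish on the kernel of T, so f descends to a bounded functional on the
range of T; Hahn–Banach extends it to B. -/
lemma exists_factorization_of_norm_le {E B : Type*} [AddCommGroup E] [Module ℂ E]
    [NormedAddCommGroup B] [NormedSpace ℂ B] (f : E →ₗ[ℂ] ℂ) (T : E →ₗ[ℂ] B) (C : ℝ)
    (hT : ∀ ψ, ‖f ψ‖ ≤ C * ‖T ψ‖) : ∃ L : B →L[ℂ] ℂ, ∀ ψ, f ψ = L (T ψ) := by
  have hker : f ∈ T.ker.dualAnnihilator := by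
    rw [Submodule.mem_dualAnnihilator]
    intro ψ hψ
    have h1 := hT ψ
    rw [LinearMap.mem_ker.1 hψ, norm_zero, mul_zero] at h1
    exact norm_le_zero_iff.1 h1
  rw [← LinearMap.range_dualMap_eq_dualAnnihilator_ker] at hker
  obtain ⟨L₀, hL₀⟩ := hker
  have hL₀' : ∀ ψ, L₀ (T ψ) = f ψ := fun ψ => congrArg (fun g : E →ₗ[ℂ] ℂ => g ψ) hL₀
  let L₁ : LinearMap.range T →L[ℂ] ℂ :=
    (L₀.comp (LinearMap.range T).subtype).mkContinuous C (by
      rintro ⟨_, ψ, rfl⟩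
      simpa [hL₀'] using hT ψ)
  obtain ⟨L, hL, -⟩ := exists_extension_norm_eq (LinearMap.range T) L₁
  refine ⟨L, fun ψ => ?_⟩
  rw [← hL₀' ψ]
  exact (hL ⟨T ψ, ψ, rfl⟩).symm

/-- A tempered distribution factors through a Banach space of weighted derivatives. -/
lemma exists_factorization (f : 𝓢'(Plane, ℂ)) :
    ∃ (s : Finset (ℕ × ℕ)) (L : (∀ i : s, BoundedContinuousFunction (JetPoint i.1.2) ℂ) →L[ℂ] ℂ),
      ∀ ψ : 𝓢(Plane, ℂ), f ψ = L (fun i => weightedDeriv i.1 ψ) := by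
  have hf : Continuous f := ContinuousLinearMap.continuous f
  let q : Seminorm ℂ 𝓢(Plane, ℂ) := (normSeminorm ℂ ℂ).comp (f : 𝓢(Plane, ℂ) →ₗ[ℂ] ℂ)
  have hq : Continuous q := continuous_norm.comp hf
  obtain ⟨s, C, -, hC⟩ := Seminorm.bound_of_continuous (schwartz_withSeminorms ℂ Plane ℂ) q hq
  refine ⟨s, ?_⟩
  refine exists_factorization_of_norm_le (B := ∀ i : s, BoundedContinuousFunction (JetPoint i.1.2) ℂ) (f : 𝓢(Plane, ℂ) →ₗ[ℂ] ℂ)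
    { toFun := fun ψ i => weightedDeriv i.1 ψ
      map_add' := fun ψ φ => by funext i; exact map_add (weightedDeriv i.1) ψ φ
      map_smul' := fun c ψ => by funext i; exact map_smul (weightedDeriv i.1) c ψ } C
    fun ψ => ?_
  refine (hC ψ).trans ?_
  rw [smul_apply, NNReal.smul_def, smul_eq_mul]
  gcongr
  refine Seminorm.finset_sup_apply_le (norm_nonneg _) fun i hi => ?_
  rw [SchwartzMap.schwartzSeminormFamily_apply]
  refine (seminorm_le_norm_weightedDeriv i ψ).trans ?_
  exact norm_le_pi_norm (fun i : s => weightedDeriv i.1 ψ) ⟨i, hi⟩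

/-! ### Tempered distributions and convolution of Schwartz functions. -/

lemma fourier_mul_convolution (φ k : 𝓢(Plane, ℂ)) (x : Plane) :
    𝓕 (SchwartzMap.convolution (ContinuousLinearMap.mul ℂ ℂ) φ k) x = 𝓕 φ x * 𝓕 k x := by
  rw [SchwartzMap.fourier_convolution]; simp

lemma lineDerivOp_convolution (φ k : 𝓢(Plane, ℂ)) (m : Plane) :
    ∂_{m} (SchwartzMap.convolution (ContinuousLinearMap.mul ℂ ℂ) φ k) =
      SchwartzMap.convolution (ContinuousLinearMap.mul ℂ ℂ) φ (∂_{m} k) := by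
  apply (FourierTransform.fourierEquiv ℂ 𝓢(Plane, ℂ)).injective
  ext x
  have hg : (fun x : Plane => inner ℝ x m).HasTemperateGrowth := by fun_prop
  simp only [FourierTransform.fourierEquiv_apply, SchwartzMap.fourier_lineDerivOp_eq,
    fourier_mul_convolution, smul_apply, SchwartzMap.smulLeftCLM_apply_apply hg]
  simp only [smul_eq_mul, Complex.real_smul]
  ring

lemma iteratedLineDerivOp_convolution (φ k : 𝓢(Plane, ℂ)) {n : ℕ} (m : Fin n → Plane) :
    ∂^{m} (SchwartzMap.convolution (ContinuousLinearMap.mul ℂ ℂ) φ k) =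
      SchwartzMap.convolution (ContinuousLinearMap.mul ℂ ℂ) φ (∂^{m} k) := by
  induction n with
  | zero => rfl
  | succ n ih => 
    rw [LineDeriv.iteratedLineDerivOp_succ_left, LineDeriv.iteratedLineDerivOp_succ_left, ih,
      lineDerivOp_convolution]

lemma convolution_apply_eq_integral (φ k : 𝓢(Plane, ℂ)) (y : Plane) :
    SchwartzMap.convolution (ContinuousLinearMap.mul ℂ ℂ) φ k y = ∫ z, φ z * k (y - z) := by
  rw [SchwartzMap.convolution_apply]; rfl

/-- The seminorms of a translate by z grow only polynomially in z, and φ decays rapidly. -/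
lemma integrable_smul_weightedDeriv (φ k : 𝓢(Plane, ℂ)) (i : ℕ × ℕ) :
    Integrable fun z : Plane => φ z • weightedDeriv i (k.compSubConstCLM ℂ z) := by
  have hcont : Continuous fun z : Plane => φ z • weightedDeriv i (k.compSubConstCLM ℂ z) :=
    φ.continuous.smul ((weightedDeriv i).continuous.comp (continuous_compSubConst k))
  set a := SchwartzMap.seminorm ℂ i.1 i.2 k
  set b := SchwartzMap.seminorm ℂ 0 i.2 k
  have h1 : Integrable fun z : Plane => ‖φ z‖ * (2 ^ i.1 * a) +
      (‖z‖ ^ i.1 * ‖φ z‖) * (2 ^ i.1 * b) :=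
    (φ.integrable.norm.mul_const _).add ((φ.integrable_pow_mul volume i.1).mul_const _)
  refine h1.mono' hcont.aestronglyMeasurable (Eventually.of_forall fun z => ?_)
  rw [norm_smul]
  refine (mul_le_mul_of_nonneg_left (norm_weightedDeriv_le _ _) (norm_nonneg _)).trans ?_
  calc _ ≤ ‖φ z‖ * (2 ^ i.1 * (a + ‖z‖ ^ i.1 * b)) := by
        gcongr; exact seminorm_compSubConst_le k z i.1 i.2
    _ = _ := by ring

lemma integrable_mul_apply_compSubConst (f : 𝓢'(Plane, ℂ)) (φ k : 𝓢(Plane, ℂ)) :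
    Integrable fun z => φ z * f (k.compSubConstCLM ℂ z) := by
  obtain ⟨s, L, hL⟩ := exists_factorization f
  have hint : Integrable fun z : Plane =>
      (fun i : s => φ z • weightedDeriv i.1 (k.compSubConstCLM ℂ z)) :=
    Integrable.of_eval fun i => integrable_smul_weightedDeriv φ k i.1
  refine (L.integrable_comp hint).congr (Eventually.of_forall fun z => ?_)
  dsimp only
  rw [hL, ← smul_eq_mul, ← map_smul]
  rfl

/-- Integration in the translation variable commutes with a tempered distribution. -/
lemma apply_convolution (f : 𝓢'(Plane, ℂ)) (φ k : 𝓢(Plane, ℂ)) :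
    f (SchwartzMap.convolution (ContinuousLinearMap.mul ℂ ℂ) φ k) =
      ∫ z, φ z * f (k.compSubConstCLM ℂ z) := by
  obtain ⟨s, L, hL⟩ := exists_factorization f
  have hint1 := integrable_smul_weightedDeriv φ k
  have hint : Integrable fun z : Plane =>
      (fun i : s => φ z • weightedDeriv i.1 (k.compSubConstCLM ℂ z)) :=
    Integrable.of_eval fun i => hint1 i.1
  -- The Banach-valued integral is identified by evaluating at each jet point, where derivatives of
  -- the convolution fall on k.
  have hcomp : ∀ i : ℕ × ℕ, ∫ z, φ z • weightedDeriv i (k.compSubConstCLM ℂ z) =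
      weightedDeriv i (SchwartzMap.convolution (ContinuousLinearMap.mul ℂ ℂ) φ k) := by
    intro i
    ext p
    have e1 := ((BoundedContinuousFunction.evalCLM ℂ p :
      BoundedContinuousFunction (JetPoint i.2) ℂ →L[ℂ] ℂ).integral_comp_comm (hint1 i))
    refine e1.symm.trans ?_
    rw [weightedDeriv_apply,
      ← SchwartzMap.iteratedLineDerivOp_eq_iteratedFDeriv, iteratedLineDerivOp_convolution,
      convolution_apply_eq_integral, ← integral_const_mul]
    congr 1
    ext z
    rw [SchwartzMap.iteratedLineDerivOp_eq_iteratedFDeriv, ← iteratedFDeriv_compSubConst]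
    simp [weightedDeriv_apply]
    ring
  have h2 := L.integral_comp_comm hint
  rw [hL]
  have h3 : (fun i : s => weightedDeriv i.1
      (SchwartzMap.convolution (ContinuousLinearMap.mul ℂ ℂ) φ k)) =
      ∫ z, (fun i : s => φ z • weightedDeriv i.1 (k.compSubConstCLM ℂ z)) := by
    funext i
    rw [← hcomp]
    exact (eval_integral (fun j => hint1 j.1) i).symm
  rw [h3, ← h2]
  congr 1
  ext z
  rw [hL, ← smul_eq_mul, ← map_smul]
  rfl

/-! ### Multipliers with smooth compactly supported symbols -/

/-- A smooth compactly supported symbol. -/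
structure IsTestSymbol (g : Plane → ℂ) : Prop where
  smooth : ContDiff ℝ ∞ g
  compact : HasCompactSupport g

lemma IsTestSymbol.mul_smooth {g m : Plane → ℂ} (hg : IsTestSymbol g) (hm : ContDiff ℝ ∞ m) :
    IsTestSymbol fun ξ => g ξ * m ξ :=
  ⟨hg.smooth.mul hm, hg.compact.mul_right⟩

lemma IsTestSymbol.add {g h : Plane → ℂ} (hg : IsTestSymbol g) (hh : IsTestSymbol h) :
    IsTestSymbol fun ξ => g ξ + h ξ :=
  ⟨hg.smooth.add hh.smooth, hg.compact.add hh.compact⟩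

lemma IsTestSymbol.comp_smul {g : Plane → ℂ} (hg : IsTestSymbol g) {c : ℝ} (hc : c ≠ 0) :
    IsTestSymbol fun η => g (c • η) :=
  ⟨hg.smooth.comp (contDiff_const_smul c), hg.compact.comp_smul hc⟩

lemma two_pi_ne_zero' : (2 * Real.pi) ≠ 0 := by positivity

lemma toSchwartz_apply {g : Plane → ℂ} (hg : IsTestSymbol g) (η : Plane) :
    toSchwartz g η = g η := by
  rw [toSchwartz, dif_pos ⟨hg.compact, hg.smooth⟩]
  exact HasCompactSupport.toSchwartzMap_toFun ..

/-- The reflected convolution kernel of `g(D)`. -/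
def symbolKernel (g : Plane → ℂ) : 𝓢(Plane, ℂ) :=
  𝓕 (toSchwartz fun η : Plane => g ((2 * Real.pi) • η))

lemma fourier_toSchwartz_apply {g : Plane → ℂ} (hg : IsTestSymbol g) (y : Plane) :
    𝓕 (toSchwartz g) y =
      ∫ η : Plane, Complex.exp (((-2 * Real.pi * inner ℝ η y : ℝ) : ℂ) * Complex.I) * g η := by
  rw [SchwartzMap.fourier_coe, Real.fourier_eq']
  simp only [toSchwartz_apply hg, smul_eq_mul]

lemma symbolKernel_apply {g : Plane → ℂ} (hg : IsTestSymbol g) (y : Plane) :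
    symbolKernel g y = ∫ η : Plane,
      Complex.exp (((-2 * Real.pi * inner ℝ η y : ℝ) : ℂ) * Complex.I) *
        g ((2 * Real.pi) • η) :=
  fourier_toSchwartz_apply (hg.comp_smul two_pi_ne_zero') y

/-- Modulating the symbol by exp(2πi x·η) translates its Fourier transform by x. So g(D)f(x) is f
tested against one fixed kernel, translated. -/
lemma symbolFun_eq {g : Plane → ℂ} (hg : IsTestSymbol g) (f : 𝓢'(Plane, ℂ)) (x : Plane) :
    symbolFun g f x = f ((symbolKernel g).compSubConstCLM ℂ x) := by
  rw [symbolFun]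
  congr 1
  ext y
  have h : IsTestSymbol fun η : Plane =>
      Complex.exp (2 * Real.pi * Complex.I * (inner ℝ x η : ℝ)) * g ((2 * Real.pi) • η) := by
    have h1 := (hg.comp_smul two_pi_ne_zero').mul_smooth
      (m := fun η => Complex.exp (2 * Real.pi * Complex.I * (inner ℝ x η : ℝ))) (by
        refine ContDiff.cexp (contDiff_const.mul ?_)
        exact Complex.ofRealCLM.contDiff.comp (contDiff_const.inner ℝ contDiff_id))
    simpa only [mul_comm] using h1
  rw [fourier_toSchwartz_apply h, SchwartzMap.compSubConstCLM_apply, symbolKernel_apply hg]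
  congr 1
  ext η
  rw [← mul_assoc, ← Complex.exp_add]
  congr 2
  rw [inner_sub_right, real_inner_comm x η]
  push_cast
  ring

lemma continuous_symbolFun {g : Plane → ℂ} (hg : IsTestSymbol g) (f : 𝓢'(Plane, ℂ)) :
    Continuous (symbolFun g f) := by
  have : symbolFun g f = fun x => f ((symbolKernel g).compSubConstCLM ℂ x) :=
    funext (symbolFun_eq hg f)
  rw [this]
  exact (ContinuousLinearMap.continuous f).comp (continuous_compSubConst _)

lemma fourier_fourier_apply (ψ : 𝓢(Plane, ℂ)) (x : Plane) : 𝓕 (𝓕 ψ) x = ψ (-x) := by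
  have h : 𝓕⁻ (𝓕 ψ) (-x) = ψ (-x) := by rw [FourierTransform.fourierInv_fourier_eq]
  rw [← h, SchwartzMap.fourierInv_apply_eq]
  simp

/-- Both sides have the Fourier transform x ↦ h(-2πx) g(-2πx). -/
lemma convolution_symbolKernel {g h : Plane → ℂ} (hg : IsTestSymbol g) (hh : IsTestSymbol h) :
    SchwartzMap.convolution (ContinuousLinearMap.mul ℂ ℂ) (symbolKernel h) (symbolKernel g) =
      symbolKernel fun ξ => h ξ * g ξ := by
  apply (FourierTransform.fourierEquiv ℂ 𝓢(Plane, ℂ)).injective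
  ext x
  simp only [FourierTransform.fourierEquiv_apply]
  rw [fourier_mul_convolution]
  simp only [symbolKernel, fourier_fourier_apply]
  rw [toSchwartz_apply (hh.comp_smul two_pi_ne_zero'),
    toSchwartz_apply (hg.comp_smul two_pi_ne_zero'),
    toSchwartz_apply ((hh.mul_smooth hg.smooth).comp_smul two_pi_ne_zero')]

/-- The action of `h(D)` on functions, by convolution. -/
def symbolAct (h : Plane → ℂ) (G : Plane → ℂ) (x : Plane) : ℂ :=
  ∫ z, symbolKernel h (z - x) * G z

/-- The composition rule h(D)(g(D)f) = (hg)(D)f: the kernel of the product is a convolution, and f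
commutes with the convolution integral. All later identities between multipliers reduce to it. -/
lemma symbolFun_mul {g h : Plane → ℂ} (hg : IsTestSymbol g) (hh : IsTestSymbol h)
    (f : 𝓢'(Plane, ℂ)) (x : Plane) :
    symbolFun (fun ξ => h ξ * g ξ) f x = symbolAct h (symbolFun g f) x := by
  rw [symbolFun_eq (hh.mul_smooth hg.smooth), symbolAct, ← convolution_symbolKernel hg hh]
  have h1 : (SchwartzMap.convolution (ContinuousLinearMap.mul ℂ ℂ) (symbolKernel h)
      (symbolKernel g)).compSubConstCLM ℂ x =
      SchwartzMap.convolution (ContinuousLinearMap.mul ℂ ℂ)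
        ((symbolKernel h).compSubConstCLM ℂ x) (symbolKernel g) := by
    ext y
    rw [SchwartzMap.compSubConstCLM_apply, convolution_apply_eq_integral,
      convolution_apply_eq_integral, ← integral_sub_right_eq_self _ x]
    simp
  rw [h1, apply_convolution]
  simp only [symbolFun_eq hg, SchwartzMap.compSubConstCLM_apply]

lemma integrable_symbolKernel_mul_symbolFun {g : Plane → ℂ} (hg : IsTestSymbol g)
    (h : Plane → ℂ) (f : 𝓢'(Plane, ℂ)) (x : Plane) :
    Integrable fun z => symbolKernel h (z - x) * symbolFun g f z := by
  simpa only [symbolFun_eq hg, SchwartzMap.compSubConstCLM_apply] using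
    integrable_mul_apply_compSubConst f ((symbolKernel h).compSubConstCLM ℂ x) (symbolKernel g)

lemma symbolKernel_add {g h : Plane → ℂ} (hg : IsTestSymbol g) (hh : IsTestSymbol h) :
    symbolKernel (fun ξ => g ξ + h ξ) = symbolKernel g + symbolKernel h := by
  rw [symbolKernel, symbolKernel, symbolKernel, ← FourierTransform.fourier_add]
  congr 1
  ext η
  rw [toSchwartz_apply ((hg.add hh).comp_smul two_pi_ne_zero'), add_apply,
    toSchwartz_apply (hg.comp_smul two_pi_ne_zero'),
    toSchwartz_apply (hh.comp_smul two_pi_ne_zero')]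

lemma isTestSymbol_zero : IsTestSymbol fun _ => 0 := ⟨contDiff_const, HasCompactSupport.zero⟩

lemma symbolKernel_zero : symbolKernel (fun _ => 0) = 0 := by
  ext y
  rw [symbolKernel_apply isTestSymbol_zero]
  simp

lemma symbolFun_zero (f : 𝓢'(Plane, ℂ)) (x : Plane) : symbolFun (fun _ => 0) f x = 0 := by
  rw [symbolFun_eq isTestSymbol_zero, symbolKernel_zero, map_zero, map_zero]

/-! ### Symbols supported away from the origin -/

/-- A smooth compactly supported symbol that vanishes near the origin. -/
structure IsAnnular (g : Plane → ℂ) : Prop extends IsTestSymbol g where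
  zero_notMem : (0 : Plane) ∉ tsupport g

/-- The singularity of m at the origin is invisible because g vanishes in a neighbourhood of it. -/
lemma IsAnnular.mul {g m : Plane → ℂ} (hg : IsAnnular g) (hm : ContDiffOn ℝ ∞ m {0}ᶜ) :
    IsAnnular fun ξ => g ξ * m ξ where
  smooth := by
    rw [contDiff_iff_contDiffAt]
    intro ξ
    by_cases h : ξ = 0
    · have h1 : g =ᶠ[𝓝 ξ] 0 := by
        rw [h]; exact notMem_tsupport_iff_eventuallyEq.1 hg.zero_notMem
      have h2 : (fun ξ => g ξ * m ξ) =ᶠ[𝓝 ξ] fun _ => 0 := h1.mono fun η hη => by simp [hη]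
      exact contDiffAt_const.congr_of_eventuallyEq h2
    · exact hg.smooth.contDiffAt.mul
        ((hm ξ h).contDiffAt (isOpen_compl_singleton.mem_nhds h))
  compact := hg.compact.mul_right
  zero_notMem := fun h => hg.zero_notMem (tsupport_mul_subset_left h)

lemma IsAnnular.add {g h : Plane → ℂ} (hg : IsAnnular g) (hh : IsAnnular h) :
    IsAnnular fun ξ => g ξ + h ξ where
  toIsTestSymbol := hg.toIsTestSymbol.add hh.toIsTestSymbol
  zero_notMem := fun h0 => by
    have := tsupport_add (f := g) (g := h) h0
    exact this.elim hg.zero_notMem hh.zero_notMem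

lemma contDiffOn_norm_compl : ContDiffOn ℝ ∞ (fun ξ : Plane => ‖ξ‖) {0}ᶜ :=
  contDiffOn_id.norm ℝ fun _ h => h

lemma contDiffOn_rieszSymbol (k : Fin 2) : ContDiffOn ℝ ∞ (rieszSymbol k) {0}ᶜ := by
  have h : rieszSymbol k = fun ξ => Complex.I * ((ξ k / ‖ξ‖ : ℝ) : ℂ) := by
    ext ξ; simp [rieszSymbol, mul_div_assoc]
  rw [h]
  refine contDiffOn_const.mul (Complex.ofRealCLM.contDiff.comp_contDiffOn ?_)
  exact ((EuclideanSpace.proj k : Plane →L[ℝ] ℝ).contDiff.contDiffOn).div contDiffOn_norm_compl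
    fun ξ hξ => by simpa using hξ

lemma contDiff_heatSymbol (t : ℝ) : ContDiff ℝ ∞ (heatSymbol t) := by
  unfold heatSymbol
  exact Complex.ofRealCLM.contDiff.comp
    (Real.contDiff_exp.comp (contDiff_const.mul (contDiff_norm_sq ℝ)))

lemma contDiffOn_poissonHeatSymbol (t s : ℝ) :
    ContDiffOn ℝ ∞ (poissonHeatSymbol t s) {0}ᶜ := by
  unfold poissonHeatSymbol
  refine Complex.ofRealCLM.contDiff.comp_contDiffOn ?_
  refine (contDiffOn_norm_compl.mul (Real.contDiff_exp.comp_contDiffOn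
    (contDiffOn_const.mul contDiffOn_norm_compl))).mul ?_
  exact (Real.contDiff_exp.comp (contDiff_const.mul (contDiff_norm_sq ℝ))).contDiffOn

/-! ### Dyadic symbols -/

variable {χ : Plane → ℝ}

lemma IsCutoff.eq_zero (hχ : IsCutoff χ) {ξ : Plane} (h : 4 / 3 ≤ ‖ξ‖) : χ ξ = 0 := by
  by_contra h0
  have := hχ.support (subset_tsupport χ h0)
  rw [mem_ball_zero_iff] at this
  linarith

lemma IsCutoff.eq_one' (hχ : IsCutoff χ) {ξ : Plane} (h : ‖ξ‖ < 3 / 4) : χ ξ = 1 :=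
  hχ.eq_one ξ (mem_ball_zero_iff.2 h)

lemma dyadicSymbol_eq (χ : Plane → ℝ) (j : ℤ) (ξ : Plane) :
    dyadicSymbol χ j ξ = dyadicSymbol χ 0 ((2 : ℝ) ^ (-j) • ξ) := by
  simp [dyadicSymbol]

/-- The symbol `φ(2ξ) + φ(ξ) + φ(ξ/2)` at scale `2ʲ`, equal to `1` on the support of
`φ(2⁻ʲ ξ)`. -/
def fatSymbol (χ : Plane → ℝ) (j : ℤ) (ξ : Plane) : ℝ :=
  dyadicSymbol χ (j - 1) ξ + dyadicSymbol χ j ξ + dyadicSymbol χ (j + 1) ξ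

lemma fatSymbol_eq (χ : Plane → ℝ) (j : ℤ) (ξ : Plane) :
    fatSymbol χ j ξ = fatSymbol χ 0 ((2 : ℝ) ^ (-j) • ξ) := by
  simp only [fatSymbol, dyadicSymbol, smul_smul, ← zpow_add₀ (two_ne_zero' ℝ)]
  ring_nf

lemma dyadicSymbol_eq_zero_of_le (hχ : IsCutoff χ) {j : ℤ} {ξ : Plane}
    (h : 8 / 3 ≤ (2 : ℝ) ^ (-j) * ‖ξ‖) : dyadicSymbol χ j ξ = 0 := by
  have h2 : ‖(2 : ℝ) ^ (-j) • ξ‖ = (2 : ℝ) ^ (-j) * ‖ξ‖ := by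
    rw [norm_smul, Real.norm_of_nonneg (by positivity)]
  rw [dyadicSymbol, hχ.eq_zero, hχ.eq_zero, sub_zero]
  · rw [h2]; linarith
  · rw [norm_smul, h2, Real.norm_of_nonneg (by norm_num)]; linarith

lemma dyadicSymbol_eq_zero_of_lt (hχ : IsCutoff χ) {j : ℤ} {ξ : Plane}
    (h : (2 : ℝ) ^ (-j) * ‖ξ‖ < 3 / 4) : dyadicSymbol χ j ξ = 0 := by
  have h2 : ‖(2 : ℝ) ^ (-j) • ξ‖ = (2 : ℝ) ^ (-j) * ‖ξ‖ := by
    rw [norm_smul, Real.norm_of_nonneg (by positivity)]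
  have h3 : 0 ≤ (2 : ℝ) ^ (-j) * ‖ξ‖ := by positivity
  rw [dyadicSymbol, hχ.eq_one', hχ.eq_one', sub_self]
  · rw [h2]; linarith
  · rw [norm_smul, h2, Real.norm_of_nonneg (by norm_num)]; linarith

lemma fatSymbol_mul_dyadicSymbol (hχ : IsCutoff χ) (j : ℤ) (ξ : Plane) :
    fatSymbol χ j ξ * dyadicSymbol χ j ξ = dyadicSymbol χ j ξ := by
  rw [fatSymbol_eq, dyadicSymbol_eq χ j]
  set η := (2 : ℝ) ^ (-j) • ξ
  rcases lt_or_ge ‖η‖ (3 / 4) with h | h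
  · rw [dyadicSymbol_eq_zero_of_lt hχ (by simpa using h), mul_zero]
  rcases le_or_gt (8 / 3) ‖η‖ with h' | h'
  · rw [dyadicSymbol_eq_zero_of_le hχ (by simpa using h'), mul_zero]
  -- The three dyadic symbols telescope. On 3/4 ≤ |η| < 8/3 one has |η/4| < 3/4 and |2η| ≥ 4/3, so
  -- the difference is 1 - 0.
  have : fatSymbol χ 0 η = χ ((4 : ℝ)⁻¹ • η) - χ ((2 : ℝ) • η) := by
    simp only [fatSymbol, dyadicSymbol, smul_smul]
    norm_num
  rw [this, hχ.eq_one', hχ.eq_zero, sub_zero, one_mul]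
  · rw [norm_smul]; norm_num; linarith
  · rw [norm_smul]; norm_num; linarith

/-- The shells are disjoint: 2⁻ᵏ|ξ| ≥ 3/4 gives 2⁻ʲ|ξ| ≥ 4 · 3/4 > 8/3. -/
lemma dyadicSymbol_mul_dyadicSymbol (hχ : IsCutoff χ) {j k : ℤ} (h : j + 2 ≤ k) (ξ : Plane) :
    dyadicSymbol χ j ξ * dyadicSymbol χ k ξ = 0 := by
  rcases lt_or_ge ((2 : ℝ) ^ (-k) * ‖ξ‖) (3 / 4) with h1 | h1
  · rw [dyadicSymbol_eq_zero_of_lt hχ h1, mul_zero]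
  · rw [dyadicSymbol_eq_zero_of_le hχ, zero_mul]
    have h2 : (2 : ℝ) ^ (-j) = 2 ^ (k - j) * 2 ^ (-k) := by
      rw [← zpow_add₀ (two_ne_zero' ℝ)]; ring_nf
    have h3 : (2 : ℝ) ^ (2 : ℤ) ≤ 2 ^ (k - j) := zpow_le_zpow_right₀ (by norm_num) (by omega)
    rw [h2, mul_assoc]
    calc (8 / 3 : ℝ) ≤ 2 ^ (2 : ℤ) * (3 / 4) := by norm_num
      _ ≤ _ := by gcongr

lemma hasCompactSupport_of_norm {g : Plane → ℂ} (R : ℝ) (h : ∀ ξ, R ≤ ‖ξ‖ → g ξ = 0) :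
    HasCompactSupport g :=
  HasCompactSupport.intro (isCompact_closedBall (0 : Plane) R) fun ξ hξ => h ξ (by
    rw [mem_closedBall_zero_iff, not_le] at hξ; exact hξ.le)

lemma isAnnular_dyadicSymbol (hχ : IsCutoff χ) (j : ℤ) :
    IsAnnular fun ξ => (dyadicSymbol χ j ξ : ℂ) where
  smooth := by
    refine Complex.ofRealCLM.contDiff.comp ?_
    change ContDiff ℝ ∞ fun ξ => χ ((2 : ℝ)⁻¹ • ((2 : ℝ) ^ (-j) • ξ)) - χ ((2 : ℝ) ^ (-j) • ξ)
    exact (hχ.smooth.comp ((contDiff_const_smul _).comp (contDiff_const_smul _))).sub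
      (hχ.smooth.comp (contDiff_const_smul _))
  compact := by
    refine hasCompactSupport_of_norm (2 ^ j * (8 / 3)) fun ξ hξ => ?_
    rw [dyadicSymbol_eq_zero_of_le hχ, Complex.ofReal_zero]
    rw [zpow_neg, le_inv_mul_iff₀ (by positivity)]
    exact hξ
  zero_notMem := by
    rw [notMem_tsupport_iff_eventuallyEq]
    filter_upwards [Metric.ball_mem_nhds (0 : Plane) (show 0 < 2 ^ j * (3 / 4 : ℝ) by positivity)]
      with ξ hξ
    rw [mem_ball_zero_iff] at hξ
    rw [dyadicSymbol_eq_zero_of_lt hχ]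
    · simp
    · rw [zpow_neg, inv_mul_lt_iff₀ (by positivity)]
      exact hξ

lemma isAnnular_fatSymbol (hχ : IsCutoff χ) (j : ℤ) :
    IsAnnular fun ξ => (fatSymbol χ j ξ : ℂ) := by
  simpa only [fatSymbol, Complex.ofReal_add] using
    ((isAnnular_dyadicSymbol hχ (j - 1)).add (isAnnular_dyadicSymbol hχ j)).add
      (isAnnular_dyadicSymbol hχ (j + 1))

/-- Reduces every multiplier on a distribution to a convolution acting on the function Δⱼ f; this is
how norms of blocks enter all estimates. -/
lemma dyadicMul_eq_symbolAct (hχ : IsCutoff χ) (j : ℤ) {m : Plane → ℂ}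
    (hm : ContDiffOn ℝ ∞ m {0}ᶜ) (f : 𝓢'(Plane, ℂ)) (x : Plane) :
    dyadicMul χ j m f x =
      symbolAct (fun ξ => fatSymbol χ j ξ * m ξ) (dyadicBlock χ j f) x := by
  have h : dyadicBlock χ j f = symbolFun (fun ξ => (dyadicSymbol χ j ξ : ℂ)) f := by
    simp only [dyadicBlock, dyadicMul, mul_one]
  rw [h, ← symbolFun_mul (isAnnular_dyadicSymbol hχ j).toIsTestSymbol
    ((isAnnular_fatSymbol hχ j).mul hm).toIsTestSymbol, dyadicMul]
  congr 1
  ext ξ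
  rw [mul_right_comm, ← Complex.ofReal_mul, fatSymbol_mul_dyadicSymbol hχ]

/-! ### Kernel estimates -/

/-- The function `exp (-a |ξ|) exp (-τ |ξ|²)`. -/
def expWeight (a τ : ℝ) (ξ : Plane) : ℝ := Real.exp (-a * ‖ξ‖) * Real.exp (-τ * ‖ξ‖ ^ 2)

lemma expWeight_eq (a τ : ℝ) :
    expWeight a τ = Real.exp ∘ ((a • fun ξ : Plane => -‖ξ‖) + τ • fun ξ : Plane => -‖ξ‖ ^ 2) := by
  ext ξ
  simp only [expWeight, ← Real.exp_add, Function.comp, Pi.add_apply, Pi.smul_apply, smul_eq_mul]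
  congr 1; ring

lemma contDiffOn_expWeight (a τ : ℝ) : ContDiffOn ℝ ∞ (expWeight a τ) {0}ᶜ :=
  (Real.contDiff_exp.comp_contDiffOn (contDiffOn_const.mul contDiffOn_norm_compl)).mul
    (Real.contDiff_exp.comp (contDiff_const.mul (contDiff_norm_sq ℝ))).contDiffOn

/-- Half of the exponential absorbs the polynomial, leaving the other half as decay. -/
lemma exists_pow_mul_exp_le (n : ℕ) {c : ℝ} (hc : 0 < c) :
    ∃ M : ℝ, 0 ≤ M ∧ ∀ s : ℝ, 0 ≤ s → (1 + s) ^ n * Real.exp (-c * s) ≤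
      M * Real.exp (-(c / 2) * s) := by
  refine ⟨n.factorial * (2 / c) ^ n * Real.exp (c / 2), by positivity, fun s hs => ?_⟩
  have h := Real.pow_div_factorial_le_exp (c / 2 * (1 + s)) (by positivity) n
  rw [div_le_iff₀ (by positivity), mul_pow] at h
  have h1 : (1 + s) ^ n ≤ n.factorial * (2 / c) ^ n * Real.exp (c / 2 * (1 + s)) := by
    calc (1 + s) ^ n = (2 / c) ^ n * ((c / 2) ^ n * (1 + s) ^ n) := by
          rw [← mul_assoc, ← mul_pow]; field_simp; simp
      _ ≤ (2 / c) ^ n * (Real.exp (c / 2 * (1 + s)) * n.factorial) := by gcongr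
      _ = _ := by ring
  calc _ ≤ n.factorial * (2 / c) ^ n * Real.exp (c / 2 * (1 + s)) * Real.exp (-c * s) := by gcongr
    _ = n.factorial * (2 / c) ^ n * (Real.exp (c / 2 * (1 + s)) * Real.exp (-c * s)) := by ring
    _ = n.factorial * (2 / c) ^ n * (Real.exp (c / 2) * Real.exp (-(c / 2) * s)) := by
        rw [← Real.exp_add, ← Real.exp_add]; congr 2; ring
    _ = _ := by ring

lemma exists_bound_iteratedFDerivWithin {F : Type*} [NormedAddCommGroup F] [NormedSpace ℝ F]
    {K : Set Plane} (hK : IsCompact K) (hK0 : K ⊆ {0}ᶜ)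
    {w : Plane → F} (hw : ContDiffOn ℝ ∞ w {0}ᶜ) (n : ℕ) :
    ∃ D : ℝ, 0 ≤ D ∧ ∀ i ≤ n, ∀ ξ ∈ K, ‖iteratedFDerivWithin ℝ i w {0}ᶜ ξ‖ ≤ D := by
  have h : ∀ i : ℕ, ∃ B : ℝ, ∀ ξ ∈ K, ‖iteratedFDerivWithin ℝ i w {0}ᶜ ξ‖ ≤ B := fun i =>
    hK.exists_bound_of_continuousOn
      ((hw.continuousOn_iteratedFDerivWithin (by exact_mod_cast le_top)
        isOpen_compl_singleton.uniqueDiffOn).mono hK0)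
  choose B hB using h
  refine ⟨∑ i ∈ Finset.range (n + 1), |B i|, Finset.sum_nonneg fun _ _ => abs_nonneg _,
    fun i hi ξ hξ => ((hB i ξ hξ).trans (le_abs_self _)).trans ?_⟩
  exact Finset.single_le_sum (f := fun i => |B i|) (fun _ _ => abs_nonneg _)
    (Finset.mem_range.2 (by omega))

/-- Faà di Bruno: i derivatives of exp(-a|ξ| - τ|ξ|²) cost a polynomial in a + τ, which the
exponential absorbs since |ξ| is bounded below on K. -/
lemma exists_bound_expWeight {K : Set Plane} (hK : IsCompact K) (hK0 : K ⊆ {0}ᶜ) (n : ℕ) :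
    ∃ M c : ℝ, 0 ≤ M ∧ 0 < c ∧ ∀ a τ : ℝ, 0 ≤ a → 0 ≤ τ → ∀ i ≤ n, ∀ ξ ∈ K,
      ‖iteratedFDerivWithin ℝ i (expWeight a τ) {0}ᶜ ξ‖ ≤ M * Real.exp (-c * (a + τ)) := by
  have hu : UniqueDiffOn ℝ ({0}ᶜ : Set Plane) := isOpen_compl_singleton.uniqueDiffOn
  have hw1 : ContDiffOn ℝ ∞ (fun ξ : Plane => -‖ξ‖) {0}ᶜ := contDiffOn_norm_compl.neg
  have hw2 : ContDiffOn ℝ ∞ (fun ξ : Plane => -‖ξ‖ ^ 2) {0}ᶜ :=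
    (contDiff_norm_sq ℝ).neg.contDiffOn
  obtain ⟨D1, hD1, h1⟩ := exists_bound_iteratedFDerivWithin hK hK0 hw1 n
  obtain ⟨D2, hD2, h2⟩ := exists_bound_iteratedFDerivWithin hK hK0 hw2 n
  obtain ⟨r, hr, hrK⟩ : ∃ r : ℝ, 0 < r ∧ ∀ ξ ∈ K, r ≤ ‖ξ‖ := by
    obtain ⟨r, hr, h⟩ := Metric.isOpen_iff.1 hK.isClosed.isOpen_compl 0
      (fun h0 => hK0 h0 rfl)
    refine ⟨r, hr, fun ξ hξ => ?_⟩
    by_contra! hlt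
    exact h (mem_ball_zero_iff.2 hlt) hξ
  -- On K both |ξ| and |ξ|² are at least c, so the weight is at most exp(-c(a + τ)).
  set c := min r (r ^ 2) with hc
  have hc0 : 0 < c := by positivity
  obtain ⟨M, hM, hMs⟩ := exists_pow_mul_exp_le n hc0
  set D0 := 1 + D1 + D2
  have hD0 : 1 ≤ D0 := by simp only [D0]; linarith
  refine ⟨n.factorial * D0 ^ n * M, c / 2, by positivity, by positivity,
    fun a τ ha hτ i hi ξ hξ => ?_⟩
  set f : Plane → ℝ := (a • fun ξ : Plane => -‖ξ‖) + τ • fun ξ : Plane => -‖ξ‖ ^ 2 with hf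
  have hfs : ContDiffOn ℝ ∞ f {0}ᶜ := (hw1.const_smul a).add (hw2.const_smul τ)
  -- Derivatives of the phase are at most linear in a + τ; as D ≥ 1, they fit the form D ^ k
  -- required by the composition estimate.
  set D := D0 * (1 + (a + τ)) with hD
  have hD1' : 1 ≤ D := by nlinarith
  have hξ0 := hK0 hξ
  have hder : ∀ k, 1 ≤ k → k ≤ i → ‖iteratedFDerivWithin ℝ k f {0}ᶜ ξ‖ ≤ D ^ k := by
    intro k hk hki
    have hk' : ((k : ℕ) : WithTop ℕ∞) ≤ (∞ : WithTop ℕ∞) := by exact_mod_cast le_top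
    have e1 := (hw1 ξ hξ0).of_le hk'
    have e2 := (hw2 ξ hξ0).of_le hk'
    have e1' : ContDiffWithinAt ℝ k (a • fun ξ : Plane => -‖ξ‖) {0}ᶜ ξ := e1.const_smul a
    have e2' : ContDiffWithinAt ℝ k (τ • fun ξ : Plane => -‖ξ‖ ^ 2) {0}ᶜ ξ := e2.const_smul τ
    rw [hf, iteratedFDerivWithin_add_apply e1' e2' hu hξ0,
      iteratedFDerivWithin_const_smul_apply e1 hu hξ0,
      iteratedFDerivWithin_const_smul_apply e2 hu hξ0]
    refine (norm_add_le _ _).trans ?_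
    rw [norm_smul, norm_smul, Real.norm_of_nonneg ha, Real.norm_of_nonneg hτ]
    calc _ ≤ a * D1 + τ * D2 := by
          gcongr
          · exact h1 k (hki.trans hi) ξ hξ
          · exact h2 k (hki.trans hi) ξ hξ
      _ ≤ D := by simp only [D, D0]; nlinarith [mul_nonneg ha hD2, mul_nonneg hτ hD1]
      _ ≤ D ^ k := le_self_pow₀ hD1' (by omega)
  have hexp : ∀ k, k ≤ i → ‖iteratedFDerivWithin ℝ k Real.exp univ (f ξ)‖ ≤
      Real.exp (-c * (a + τ)) := by
    intro k _
    rw [iteratedFDerivWithin_univ, norm_iteratedFDeriv_eq_norm_iteratedDeriv,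
      iteratedDeriv_eq_iterate, Real.iter_deriv_exp, Real.norm_of_nonneg (Real.exp_pos _).le]
    gcongr
    have hr1 : c ≤ ‖ξ‖ := (min_le_left _ _).trans (hrK ξ hξ)
    have hr2 : c ≤ ‖ξ‖ ^ 2 := (min_le_right _ _).trans (by gcongr; exact hrK ξ hξ)
    simp only [hf, Pi.add_apply, Pi.smul_apply, smul_eq_mul]
    nlinarith [mul_le_mul_of_nonneg_left hr1 ha, mul_le_mul_of_nonneg_left hr2 hτ]
  have key := norm_iteratedFDerivWithin_comp_le (N := ∞) Real.contDiff_exp.contDiffOn hfs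
    (by exact_mod_cast le_top) uniqueDiffOn_univ hu (mapsTo_univ _ _) hξ0 hexp hder
  rw [expWeight_eq]
  refine key.trans ?_
  calc _ ≤ (n.factorial : ℝ) * Real.exp (-c * (a + τ)) * D ^ n := by
        gcongr
    _ = n.factorial * D0 ^ n * ((1 + (a + τ)) ^ n * Real.exp (-c * (a + τ))) := by
        rw [hD, mul_pow]; ring
    _ ≤ n.factorial * D0 ^ n * (M * Real.exp (-(c / 2) * (a + τ))) := by
        exact mul_le_mul_of_nonneg_left (hMs (a + τ) (by positivity)) (by positivity)
    _ = _ := by ring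

lemma exists_bound_iteratedFDeriv_mul_expWeight {A : Plane → ℂ} (hA : IsAnnular A) (n : ℕ) :
    ∃ M c : ℝ, 0 ≤ M ∧ 0 < c ∧ ∀ a τ : ℝ, 0 ≤ a → 0 ≤ τ → ∀ i ≤ n, ∀ ξ,
      ‖iteratedFDeriv ℝ i (fun ξ => A ξ * expWeight a τ ξ) ξ‖ ≤ M * Real.exp (-c * (a + τ)) := by
  have hu : UniqueDiffOn ℝ ({0}ᶜ : Set Plane) := isOpen_compl_singleton.uniqueDiffOn
  have hK0 : tsupport A ⊆ {0}ᶜ := fun ξ hξ h => hA.zero_notMem (by rwa [← show ξ = 0 from h])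
  obtain ⟨M, c, hM, hc, h⟩ := exists_bound_expWeight hA.compact hK0 n
  obtain ⟨D, hD, hDA⟩ := exists_bound_iteratedFDerivWithin hA.compact hK0
    hA.smooth.contDiffOn n
  refine ⟨2 ^ n * (M * D), c, by positivity, hc, fun a τ ha hτ i hi ξ => ?_⟩
  have heq : (fun ξ => A ξ * expWeight a τ ξ) = fun ξ => expWeight a τ ξ • A ξ := by
    ext ξ; rw [Complex.real_smul, mul_comm]
  by_cases hξ : ξ ∈ tsupport A
  · have hξ0 := hK0 hξ
    rw [heq, ← iteratedFDerivWithin_of_isOpen i isOpen_compl_singleton hξ0]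
    refine (norm_iteratedFDerivWithin_smul_le (N := ∞) (contDiffOn_expWeight a τ)
      hA.smooth.contDiffOn hu hξ0 (by exact_mod_cast le_top)).trans ?_
    calc _ ≤ ∑ k ∈ Finset.range (i + 1), (i.choose k : ℝ) *
          (M * Real.exp (-c * (a + τ))) * D := by
          gcongr with k hk
          · exact h a τ ha hτ k (by rw [Finset.mem_range] at hk; omega) ξ hξ
          · exact hDA _ (by omega) ξ hξ
      _ = 2 ^ i * (M * Real.exp (-c * (a + τ)) * D) := by
          rw [← Finset.sum_mul, ← Finset.sum_mul, ← Nat.cast_sum, Nat.sum_range_choose]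
          push_cast; ring
      _ ≤ 2 ^ n * (M * Real.exp (-c * (a + τ)) * D) := by gcongr; norm_num
      _ = _ := by ring
  · have : iteratedFDeriv ℝ i (fun ξ => A ξ * expWeight a τ ξ) ξ = 0 := by
      by_contra h0
      exact hξ (tsupport_mul_subset_left (support_iteratedFDeriv_subset i h0))
    rw [this, norm_zero]; positivity

lemma integral_norm_iteratedFDeriv_le {f : Plane → ℂ} {R b : ℝ}
    (hR : tsupport f ⊆ Metric.closedBall 0 R) {q : ℕ}
    (hb : ∀ ξ, ‖iteratedFDeriv ℝ q f ξ‖ ≤ b) :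
    ∫ v, ‖iteratedFDeriv ℝ q f v‖ ≤ b * volume.real (Metric.closedBall (0 : Plane) R) := by
  rw [← setIntegral_eq_integral_of_forall_compl_eq_zero (s := Metric.closedBall (0 : Plane) R)]
  · refine (le_abs_self _).trans ?_
    rw [← Real.norm_eq_abs]
    refine norm_setIntegral_le_of_norm_le_const measure_closedBall_lt_top fun ξ _ => ?_
    rw [norm_norm]; exact hb ξ
  · intro ξ hξ
    rw [norm_eq_zero]
    by_contra h0
    exact hξ (hR (support_iteratedFDeriv_subset q h0))

lemma pow_mul_norm_fourier_le {f : Plane → ℂ} (hf : IsTestSymbol f) {R b : ℝ}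
    (hR : tsupport f ⊆ Metric.closedBall 0 R) {n : ℕ}
    (hb : ∀ i ≤ n, ∀ ξ, ‖iteratedFDeriv ℝ i f ξ‖ ≤ b) (y : Plane) :
    ‖y‖ ^ n * ‖𝓕 f y‖ ≤
      2 ^ n * ((n + 1) * (b * volume.real (Metric.closedBall (0 : Plane) R))) := by
  have h := Real.pow_mul_norm_iteratedFDeriv_fourier_le (K := 0) (N := ⊤) (k := 0) (n := n)
    hf.smooth (fun k n _ _ => by
      refine Continuous.integrable_of_hasCompactSupport ?_ ?_
      · exact (continuous_norm.pow k).mul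
          ((hf.smooth.continuous_iteratedFDeriv (by exact_mod_cast le_top)).norm)
      · exact ((hf.compact.iteratedFDeriv n).norm).mul_left) le_rfl le_top y
  rw [norm_iteratedFDeriv_zero] at h
  refine h.trans ?_
  simp only [pow_zero, Nat.cast_zero, mul_zero, zero_add, one_mul]
  gcongr
  calc _ ≤ ∑ p ∈ Finset.range 1 ×ˢ Finset.range (n + 1),
        b * volume.real (Metric.closedBall (0 : Plane) R) := by
        refine Finset.sum_le_sum fun p hp => ?_
        rw [Finset.mem_product, Finset.mem_range, Finset.mem_range] at hp
        rw [show p.1 = 0 by omega]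
        simp only [pow_zero, one_mul]
        exact integral_norm_iteratedFDeriv_le hR (hb p.2 (by omega))
    _ = _ := by simp

/-- Decay of order three is integrable in dimension two. The constant is 264 = 2³(1 + 2³ · 4),
combining the bounds of orders 0 and 3. -/
lemma one_add_pow_mul_norm_fourier_le {f : Plane → ℂ} (hf : IsTestSymbol f) {R b : ℝ}
    (hR : tsupport f ⊆ Metric.closedBall 0 R)
    (hb : ∀ i ≤ 3, ∀ ξ, ‖iteratedFDeriv ℝ i f ξ‖ ≤ b) (y : Plane) :
    ‖𝓕 f y‖ ≤ 264 * volume.real (Metric.closedBall (0 : Plane) R) * b *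
      (1 + ‖y‖) ^ (-3 : ℝ) := by
  have h0 := pow_mul_norm_fourier_le hf hR (n := 0) (fun i hi => hb i (by omega)) y
  have h3 := pow_mul_norm_fourier_le hf hR (n := 3) hb y
  have h4 : (1 + ‖y‖) ^ 3 ≤ 2 ^ 3 * (1 ^ 3 + ‖y‖ ^ 3) :=
    pow_le_two_pow_mul (by positivity) zero_le_one (norm_nonneg _) le_rfl 3
  rw [Real.rpow_neg (by positivity), ← div_eq_mul_inv, le_div_iff₀ (by positivity)]
  norm_num at h0 h3
  have h5 : (1 + ‖y‖) ^ (3 : ℝ) = (1 + ‖y‖) ^ 3 := by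
    rw [← Real.rpow_natCast]; norm_num
  rw [h5]
  have := mul_le_mul_of_nonneg_left h4 (norm_nonneg (𝓕 f y))
  nlinarith

/-! ### Simultaneous L¹ and sup bounds for rescaled kernels. -/

/-- The function `f` has `L¹` norm at most `a` and sup norm at most `a μ`. -/
structure L1SupBound {V : Type*} [NormedAddCommGroup V] (f : Plane → V) (a μ : ℝ≥0∞) : Prop where
  lintegral_le : ∫⁻ x, ‖f x‖ₑ ≤ a
  enorm_le : ∀ x, ‖f x‖ₑ ≤ a * μ

lemma L1SupBound.mono {V : Type*} [NormedAddCommGroup V] {f : Plane → V} {a b μ : ℝ≥0∞} (h : L1SupBound f a μ) (hab : a ≤ b) :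
    L1SupBound f b μ :=
  ⟨h.lintegral_le.trans hab, fun x => (h.enorm_le x).trans (by gcongr)⟩

/-- Scaling of the Fourier transform in the plane; the 2π converts between the two frequency
normalizations. -/
lemma symbolKernel_comp_smul {H : Plane → ℂ} (hH : IsTestSymbol H) {r : ℝ} (hr : 0 < r)
    (y : Plane) : symbolKernel (fun ξ => H (r⁻¹ • ξ)) y =
      ((r / (2 * Real.pi)) ^ 2 : ℝ) • 𝓕 H ((r / (2 * Real.pi)) • y) := by
  set l := r / (2 * Real.pi) with hl
  have hl0 : 0 < l := by positivity
  rw [symbolKernel_apply (hH.comp_smul (inv_ne_zero hr.ne')), Real.fourier_eq']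
  have h := Measure.integral_comp_smul (volume : Measure Plane) (fun v =>
    Complex.exp (((-2 * Real.pi * inner ℝ v (l • y) : ℝ) : ℂ) * Complex.I) • H v) l⁻¹
  have h2 : |((l⁻¹ ^ Module.finrank ℝ Plane)⁻¹)| = l ^ 2 := by
    rw [finrank_euclideanSpace_fin, inv_pow, inv_inv, abs_of_nonneg (by positivity)]
  rw [h2] at h
  rw [← h]
  congr 1
  ext η
  rw [smul_smul, smul_eq_mul]
  congr 4
  · rw [inner_smul_left, inner_smul_right]
    simp only [map_inv₀, conj_trivial]
    field_simp
  · rw [hl, inv_div, div_eq_inv_mul]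

/-- The dilation y ↦ l² K(ly) with l = 2ʲ/(2π) preserves the L¹ norm and multiplies the sup norm by
l² ≤ 4ʲ. The constant depends on H only through its support radius and three derivatives. -/
lemma exists_l1SupBound_symbolKernel (R : ℝ) :
    ∃ C : ℝ, 0 ≤ C ∧ ∀ (H : Plane → ℂ) (b : ℝ), IsTestSymbol H →
      tsupport H ⊆ Metric.closedBall 0 R → (∀ i ≤ 3, ∀ ξ, ‖iteratedFDeriv ℝ i H ξ‖ ≤ b) →
      ∀ j : ℤ, L1SupBound (symbolKernel fun ξ => H ((2 : ℝ) ^ (-j) • ξ)) (ENNReal.ofReal (C * b))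
        (ENNReal.ofReal (4 ^ j)) := by
  set V := volume.real (Metric.closedBall (0 : Plane) R)
  have hint : Integrable fun y : Plane => (1 + ‖y‖) ^ (-3 : ℝ) :=
    integrable_one_add_norm (by rw [finrank_euclideanSpace_fin]; norm_num)
  set I := ∫ y : Plane, (1 + ‖y‖) ^ (-3 : ℝ) with hI
  have hI0 : 0 ≤ I := integral_nonneg fun y => by positivity
  refine ⟨264 * V * (1 + I), by positivity, fun H b hH hR hb j => ?_⟩
  have hb0 : 0 ≤ b := (norm_nonneg _).trans (hb 0 (by norm_num) 0)
  set l : ℝ := 2 ^ j / (2 * Real.pi) with hl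
  have hl0 : 0 < l := by positivity
  have hpt : ∀ y, ‖symbolKernel (fun ξ => H ((2 : ℝ) ^ (-j) • ξ)) y‖ ≤
      264 * V * b * (l ^ 2 * (1 + ‖l • y‖) ^ (-3 : ℝ)) := fun y => by
    rw [zpow_neg, symbolKernel_comp_smul hH (by positivity : (0 : ℝ) < 2 ^ j), norm_smul,
      Real.norm_of_nonneg (by positivity)]
    have := one_add_pow_mul_norm_fourier_le hH hR hb (l • y)
    calc _ ≤ l ^ 2 * (264 * V * b * (1 + ‖l • y‖) ^ (-3 : ℝ)) := by gcongr
      _ = _ := by ring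
  refine ⟨?_, fun y => ?_⟩
  · have hint' : Integrable fun y : Plane =>
        264 * V * b * (l ^ 2 * (1 + ‖l • y‖) ^ (-3 : ℝ)) :=
      ((hint.comp_smul hl0.ne').const_mul _).const_mul _
    calc _ ≤ ∫⁻ y : Plane, ENNReal.ofReal (264 * V * b * (l ^ 2 * (1 + ‖l • y‖) ^ (-3 : ℝ))) := by
          refine lintegral_mono fun y => ?_
          rw [← ofReal_norm]
          exact ENNReal.ofReal_le_ofReal (hpt y)
      _ = ENNReal.ofReal (264 * V * b * I) := by
          rw [← ofReal_integral_eq_lintegral_ofReal hint'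
            (Eventually.of_forall fun y => by positivity), integral_const_mul, integral_const_mul,
            Measure.integral_comp_smul_of_nonneg (volume : Measure Plane)
              (fun y => (1 + ‖y‖) ^ (-3 : ℝ)) l (hR := hl0.le), finrank_euclideanSpace_fin, ← hI,
            smul_eq_mul, mul_inv_cancel_left₀ (by positivity)]
      _ ≤ _ := by
          refine ENNReal.ofReal_le_ofReal ?_
          nlinarith [mul_nonneg (mul_nonneg (by norm_num : (0 : ℝ) ≤ 264)
            (measureReal_nonneg : 0 ≤ V)) hb0]
  · rw [← ENNReal.ofReal_mul (by positivity), ← ofReal_norm]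
    refine ENNReal.ofReal_le_ofReal ((hpt y).trans ?_)
    have h1 : (1 + ‖l • y‖) ^ (-3 : ℝ) ≤ 1 :=
      Real.rpow_le_one_of_one_le_of_nonpos (by linarith [norm_nonneg (l • y)]) (by norm_num)
    have h2 : l ^ 2 ≤ 4 ^ j := by
      have h4 : (4 : ℝ) ^ j = (2 ^ j) ^ 2 := by
        rw [← zpow_natCast, ← zpow_mul, mul_comm, zpow_mul]; norm_num
      rw [h4]
      gcongr
      rw [hl]
      exact div_le_self (by positivity) (by linarith [Real.pi_gt_three])
    have hV : 0 ≤ 264 * V * b := by positivity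
    calc _ ≤ 264 * V * b * (4 ^ j * 1) := by gcongr
      _ ≤ 264 * V * b * (4 ^ j * (1 + I)) := by gcongr; linarith
      _ = _ := by ring

/-- A symbol that is smooth away from the origin and homogeneous of degree zero. -/
structure IsHomogeneousSymbol (m : Plane → ℂ) : Prop where
  smooth : ContDiffOn ℝ ∞ m {0}ᶜ
  smul_eq : ∀ r : ℝ, 0 < r → ∀ ξ, m (r • ξ) = m ξ

lemma isHomogeneousSymbol_one : IsHomogeneousSymbol fun _ => 1 :=
  ⟨contDiffOn_const, fun _ _ _ => rfl⟩

lemma isHomogeneousSymbol_rieszSymbol (k : Fin 2) : IsHomogeneousSymbol (rieszSymbol k) :=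
  ⟨contDiffOn_rieszSymbol k, fun r hr ξ => by
    simp only [rieszSymbol, PiLp.smul_apply, smul_eq_mul, norm_smul, Real.norm_of_nonneg hr.le]
    push_cast
    have : (r : ℂ) ≠ 0 := by exact_mod_cast hr.ne'
    rw [mul_left_comm, mul_div_mul_left _ _ this]⟩

lemma IsHomogeneousSymbol.mul {m n : Plane → ℂ} (hm : IsHomogeneousSymbol m)
    (hn : IsHomogeneousSymbol n) : IsHomogeneousSymbol fun ξ => m ξ * n ξ :=
  ⟨hm.smooth.mul hn.smooth, fun r hr ξ => by rw [hm.smul_eq r hr, hn.smul_eq r hr]⟩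

lemma exists_l1SupBound_mul_expWeight {A : Plane → ℂ} (hA : IsAnnular A) :
    ∃ C c : ℝ, 0 < C ∧ 0 < c ∧ ∀ a τ : ℝ, 0 ≤ a → 0 ≤ τ → ∀ j : ℤ,
      L1SupBound (symbolKernel fun ξ => A ((2 : ℝ) ^ (-j) • ξ) *
        expWeight a τ ((2 : ℝ) ^ (-j) • ξ)) (ENNReal.ofReal (C * Real.exp (-c * (a + τ))))
        (ENNReal.ofReal (4 ^ j)) := by
  obtain ⟨M, c, hM, hc, h⟩ := exists_bound_iteratedFDeriv_mul_expWeight hA 3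
  obtain ⟨R, hR⟩ := hA.compact.isBounded.subset_closedBall (0 : Plane)
  obtain ⟨C, hC, hK⟩ := exists_l1SupBound_symbolKernel R
  -- The added 1 makes the constant strictly positive, since C and M may vanish.
  refine ⟨C * M + 1, c, by positivity, hc, fun a τ ha hτ j => ?_⟩
  have hAe := hA.mul (Complex.ofRealCLM.contDiff.comp_contDiffOn (contDiffOn_expWeight a τ))
  refine (hK _ _ hAe.toIsTestSymbol (tsupport_mul_subset_left.trans hR) (h a τ ha hτ) j).mono ?_
  refine ENNReal.ofReal_le_ofReal ?_
  nlinarith [Real.exp_pos (-c * (a + τ))]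

/-- Since t|ξ|² = (t4ʲ)|2⁻ʲξ|², this is the rescaled kernel with a = 0 and τ = t4ʲ. -/
lemma exists_l1SupBound_heat {χ : Plane → ℝ} (hχ : IsCutoff χ) {m : Plane → ℂ}
    (hm : IsHomogeneousSymbol m) :
    ∃ C c : ℝ, 0 < C ∧ 0 < c ∧ ∀ t : ℝ, 0 ≤ t → ∀ j : ℤ,
      L1SupBound (symbolKernel fun ξ => fatSymbol χ j ξ * (heatSymbol t ξ * m ξ))
        (ENNReal.ofReal (C * Real.exp (-c * (t * 4 ^ j)))) (ENNReal.ofReal (4 ^ j)) := by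
  obtain ⟨C, c, hC, hc, h⟩ := exists_l1SupBound_mul_expWeight
    ((isAnnular_fatSymbol hχ 0).mul hm.smooth)
  refine ⟨C, c, hC, hc, fun t ht j => ?_⟩
  have := h 0 (t * 4 ^ j) le_rfl (by positivity) j
  rw [zero_add] at this
  convert this using 3
  ext ξ
  rw [← fatSymbol_eq, hm.smul_eq _ (by positivity), mul_assoc, mul_comm (m ξ)]
  congr 2
  simp only [heatSymbol, expWeight, norm_smul, zero_mul, neg_zero, Real.exp_zero, one_mul]
  congr 2
  have h4 : (4 : ℝ) ^ j = (2 ^ j) ^ 2 := by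
    rw [← zpow_natCast, ← zpow_mul, mul_comm, zpow_mul]; norm_num
  rw [Real.norm_of_nonneg (by positivity), h4, zpow_neg]
  field_simp

lemma symbolKernel_const_mul (c : ℂ) {g : Plane → ℂ} (hg : IsTestSymbol g) (y : Plane) :
    symbolKernel (fun ξ => c * g ξ) y = c * symbolKernel g y := by
  have h : IsTestSymbol fun ξ => c * g ξ :=
    ⟨contDiff_const.mul hg.smooth, hg.compact.mul_left⟩
  rw [symbolKernel_apply h, symbolKernel_apply hg, ← integral_const_mul]
  congr 1
  ext η
  ring

lemma L1SupBound.const_mul {f : Plane → ℂ} {a μ : ℝ≥0∞} (h : L1SupBound f a μ) (c : ℂ) :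
    L1SupBound (fun x => c * f x) (‖c‖ₑ * a) μ := by
  refine ⟨?_, fun x => ?_⟩
  · simp only [enorm_mul]
    rw [lintegral_const_mul' _ _ enorm_ne_top]
    gcongr
    exact h.lintegral_le
  · rw [enorm_mul, mul_assoc]
    gcongr
    exact h.enorm_le x

/-- Rescaling gives a = s2ʲ and τ = t4ʲ, and the factor |ξ| = 2ʲ|2⁻ʲξ| yields the prefactor 2ʲ. This
prefactor keeps the s-integral of the bound uniform in j. -/
lemma exists_l1SupBound_poissonHeat {χ : Plane → ℝ} (hχ : IsCutoff χ) {m : Plane → ℂ}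
    (hm : IsHomogeneousSymbol m) :
    ∃ C c : ℝ, 0 < C ∧ 0 < c ∧ ∀ t s : ℝ, 0 ≤ t → 0 ≤ s → ∀ j : ℤ,
      L1SupBound (symbolKernel fun ξ => fatSymbol χ j ξ * (m ξ * poissonHeatSymbol t s ξ))
        (ENNReal.ofReal (C * 2 ^ j * Real.exp (-c * (s * 2 ^ j)) *
          Real.exp (-c * (t * 4 ^ j)))) (ENNReal.ofReal (4 ^ j)) := by
  have hA : IsAnnular fun ξ => (fatSymbol χ 0 ξ * m ξ) * (‖ξ‖ : ℂ) :=
    ((isAnnular_fatSymbol hχ 0).mul hm.smooth).mul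
      (Complex.ofRealCLM.contDiff.comp_contDiffOn contDiffOn_norm_compl)
  obtain ⟨C, c, hC, hc, h⟩ := exists_l1SupBound_mul_expWeight hA
  refine ⟨C, c, hC, hc, fun t s ht hs j => ?_⟩
  have h1 := (h (s * 2 ^ j) (t * 4 ^ j) (by positivity) (by positivity) j).const_mul
    (((2 : ℝ) ^ j : ℝ) : ℂ)
  have hAe := (hA.mul (Complex.ofRealCLM.contDiff.comp_contDiffOn (contDiffOn_expWeight
    (s * 2 ^ j) (t * 4 ^ j)))).toIsTestSymbol.comp_smul
    (zpow_ne_zero (-j) (two_ne_zero' ℝ))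
  have h2 : (⇑(symbolKernel fun ξ => fatSymbol χ j ξ * (m ξ * poissonHeatSymbol t s ξ))) =
      fun x => (((2 : ℝ) ^ j : ℝ) : ℂ) * symbolKernel (fun ξ =>
        (fatSymbol χ 0 ((2 : ℝ) ^ (-j) • ξ) * m ((2 : ℝ) ^ (-j) • ξ)) *
          (‖(2 : ℝ) ^ (-j) • ξ‖ : ℂ) * expWeight (s * 2 ^ j) (t * 4 ^ j) ((2 : ℝ) ^ (-j) • ξ)) x := by
    ext x
    refine Eq.trans ?_ (symbolKernel_const_mul _ hAe x)
    congr 2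
    ext ξ
    rw [← fatSymbol_eq, hm.smul_eq _ (by positivity)]
    have h4 : (4 : ℝ) ^ j = (2 ^ j) ^ 2 := by
      rw [← zpow_natCast, ← zpow_mul, mul_comm, zpow_mul]; norm_num
    have hn : ‖(2 : ℝ) ^ (-j) • ξ‖ = (2 ^ j)⁻¹ * ‖ξ‖ := by
      rw [norm_smul, Real.norm_of_nonneg (by positivity), zpow_neg]
    have he : expWeight (s * 2 ^ j) (t * 4 ^ j) ((2 : ℝ) ^ (-j) • ξ) = expWeight s t ξ := by
      simp only [expWeight, hn, h4]
      congr 2 <;> field_simp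
    have hp : poissonHeatSymbol t s ξ = ((2 ^ j : ℝ) : ℂ) *
        (‖(2 : ℝ) ^ (-j) • ξ‖ : ℂ) * (expWeight s t ξ : ℂ) := by
      rw [poissonHeatSymbol, hn, ← Complex.ofReal_mul, ← Complex.ofReal_mul, expWeight,
        mul_inv_cancel_left₀ (by positivity), mul_assoc]
    simp only [Function.comp, Complex.ofRealCLM_apply]
    rw [he, hp]
    ring
  rw [h2]
  refine h1.mono (le_of_eq ?_)
  rw [← ofReal_norm, Complex.norm_real, Real.norm_of_nonneg (by positivity),
    ← ENNReal.ofReal_mul (by positivity)]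
  congr 1
  rw [mul_add, Real.exp_add]
  ring

/-! ### Interpolation and convolution inequalities -/

/-- Interpolation from |f|^p ≤ (aμ)^{p-1}|f|. With μ = 4ʲ it acts as Bernstein's inequality in the
plane; with μ = 2ʲ it gives the loss in x₃. -/
lemma eLpNorm_le_of_lintegral_le_of_enorm_le {α V : Type*} {mα : MeasurableSpace α} {ν : Measure α}
    [TopologicalSpace V] [ContinuousENorm V] {f : α → V} (hf : AEMeasurable (fun x => ‖f x‖ₑ) ν)
    {a μ : ℝ≥0∞} (h1 : ∫⁻ x, ‖f x‖ₑ ∂ν ≤ a) (h2 : ∀ᵐ x ∂ν, ‖f x‖ₑ ≤ a * μ) {p : ℝ≥0∞}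
    (hp : 1 ≤ p) : eLpNorm f p ν ≤ a * μ ^ (1 - (p⁻¹).toReal) := by
  rcases eq_or_ne p ⊤ with rfl | hpt
  · rw [eLpNorm_exponent_top]
    simpa using eLpNormEssSup_le_of_ae_enorm_bound h2
  have hp0 : p ≠ 0 := (zero_lt_one.trans_le hp).ne'
  have hr : 1 ≤ p.toReal := by
    rw [← ENNReal.toReal_one]; exact ENNReal.toReal_mono hpt hp
  set r := p.toReal with hrdef
  have hr0 : 0 < r := by linarith
  rw [eLpNorm_eq_lintegral_rpow_enorm_toReal hp0 hpt, ← hrdef, ENNReal.toReal_inv, ← hrdef]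
  have h3 : ∫⁻ x, ‖f x‖ₑ ^ r ∂ν ≤ (a * μ) ^ (r - 1) * a := by
    calc ∫⁻ x, ‖f x‖ₑ ^ r ∂ν ≤ ∫⁻ x, (a * μ) ^ (r - 1) * ‖f x‖ₑ ∂ν := by
          refine lintegral_mono_ae (h2.mono fun x hx => ?_)
          conv_lhs => rw [show r = (r - 1) + 1 by ring]
          rw [ENNReal.rpow_add_of_nonneg _ _ (by linarith) zero_le_one, ENNReal.rpow_one]
          gcongr
      _ = (a * μ) ^ (r - 1) * ∫⁻ x, ‖f x‖ₑ ∂ν := lintegral_const_mul'' _ hf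
      _ ≤ _ := by gcongr
  calc _ ≤ ((a * μ) ^ (r - 1) * a) ^ (1 / r) := by gcongr
    _ = a ^ (1 - r⁻¹) * a ^ (r⁻¹) * μ ^ (1 - r⁻¹) := by
        have e : (r - 1) * (1 / r) = 1 - r⁻¹ := by field_simp
        have e2 : 0 ≤ 1 - r⁻¹ := by rw [sub_nonneg]; exact inv_le_one_of_one_le₀ hr
        rw [ENNReal.mul_rpow_of_nonneg _ _ (by positivity), ← ENNReal.rpow_mul, e,
          ENNReal.mul_rpow_of_nonneg _ _ e2, one_div]
        ring
    _ = _ := by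
        have e2 : 0 ≤ 1 - r⁻¹ := by rw [sub_nonneg]; exact inv_le_one_of_one_le₀ hr
        rw [← ENNReal.rpow_add_of_nonneg _ _ e2 (by positivity)]
        simp

lemma L1SupBound.eLpNorm_le {V : Type*} [NormedAddCommGroup V] {f : Plane → V} {a μ : ℝ≥0∞}
    (h : L1SupBound f a μ) (hf : AEStronglyMeasurable f volume) {p : ℝ≥0∞} (hp : 1 ≤ p) :
    eLpNorm f p volume ≤ a * μ ^ (1 - (p⁻¹).toReal) :=
  eLpNorm_le_of_lintegral_le_of_enorm_le hf.enorm h.lintegral_le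
    (Eventually.of_forall h.enorm_le) hp

lemma L1SupBound.add {V : Type*} [NormedAddCommGroup V] {f g : Plane → V} {a b μ : ℝ≥0∞}
    (hf : L1SupBound f a μ) (hg : L1SupBound g b μ) (hfm : AEStronglyMeasurable f volume) :
    L1SupBound (fun x => f x + g x) (a + b) μ := by
  refine ⟨?_, fun x => ?_⟩
  · calc _ ≤ ∫⁻ x, (‖f x‖ₑ + ‖g x‖ₑ) := lintegral_mono fun x => enorm_add_le _ _
      _ = (∫⁻ x, ‖f x‖ₑ) + ∫⁻ x, ‖g x‖ₑ := lintegral_add_left' hfm.enorm _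
      _ ≤ _ := add_le_add hf.lintegral_le hg.lintegral_le
  · rw [add_mul]
    exact (enorm_add_le _ _).trans (add_le_add (hf.enorm_le x) (hg.enorm_le x))

lemma L1SupBound.neg {V : Type*} [NormedAddCommGroup V] {f : Plane → V} {a μ : ℝ≥0∞}
    (hf : L1SupBound f a μ) : L1SupBound (fun x => -f x) a μ :=
  ⟨by simpa only [enorm_neg] using hf.lintegral_le, by simpa only [enorm_neg] using hf.enorm_le⟩

lemma L1SupBound.finset_sum {V ι : Type*} [NormedAddCommGroup V] {s : Finset ι}
    {f : ι → Plane → V} {a : ι → ℝ≥0∞} {μ : ℝ≥0∞} (hf : ∀ i ∈ s, L1SupBound (f i) (a i) μ)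
    (hfm : ∀ i ∈ s, AEStronglyMeasurable (f i) volume) :
    L1SupBound (fun x => ∑ i ∈ s, f i x) (∑ i ∈ s, a i) μ := by
  refine ⟨?_, fun x => ?_⟩
  · calc _ ≤ ∫⁻ x, ∑ i ∈ s, ‖f i x‖ₑ := lintegral_mono fun x => enorm_sum_le _ _
      _ = ∑ i ∈ s, ∫⁻ x, ‖f i x‖ₑ := lintegral_finsetSum' s fun i hi => (hfm i hi).enorm
      _ ≤ _ := Finset.sum_le_sum fun i hi => (hf i hi).lintegral_le
  · rw [Finset.sum_mul]
    exact (enorm_sum_le _ _).trans (Finset.sum_le_sum fun i hi => (hf i hi).enorm_le x)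

lemma enorm_toLp_le {ι : Type*} [Fintype ι] (v : ι → ℂ) :
    ‖WithLp.toLp 2 v‖ₑ ≤ ∑ i, ‖v i‖ₑ := by
  classical
  have h : WithLp.toLp 2 v = ∑ i, EuclideanSpace.single i (v i) := by
    ext k
    simp [Finset.sum_apply, Pi.single_apply]
  rw [h]
  refine (enorm_sum_le _ _).trans (Finset.sum_le_sum fun i _ => ?_)
  rw [← ofReal_norm, PiLp.norm_single, ofReal_norm]

lemma enorm_le_enorm_toLp {ι : Type*} [Fintype ι] (v : ι → ℂ) (i : ι) :
    ‖v i‖ₑ ≤ ‖WithLp.toLp 2 v‖ₑ := by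
  rw [← ofReal_norm, ← ofReal_norm]
  exact ENNReal.ofReal_le_ofReal (PiLp.norm_apply_le (WithLp.toLp 2 v) i)

lemma L1SupBound.toLp {ι : Type*} [Fintype ι] {f : ι → Plane → ℂ} {a : ι → ℝ≥0∞} {μ : ℝ≥0∞}
    (hf : ∀ i, L1SupBound (f i) (a i) μ) (hfm : ∀ i, AEStronglyMeasurable (f i) volume) :
    L1SupBound (fun x => WithLp.toLp 2 fun i => f i x) (∑ i, a i) μ := by
  refine ⟨?_, fun x => ?_⟩
  · calc _ ≤ ∫⁻ x, ∑ i, ‖f i x‖ₑ := lintegral_mono fun x => enorm_toLp_le _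
      _ = ∑ i, ∫⁻ x, ‖f i x‖ₑ := lintegral_finsetSum' _ fun i _ => (hfm i).enorm
      _ ≤ _ := Finset.sum_le_sum fun i _ => (hf i).lintegral_le
  · rw [Finset.sum_mul]
    exact (enorm_toLp_le _).trans (Finset.sum_le_sum fun i _ => (hf i).enorm_le x)

/-- Young's inequality at both endpoints, L¹ * L¹ ⊆ L¹ and L^∞ * L¹ ⊆ L^∞: an L¹ bound on a block
suffices for both bounds on its image. -/
lemma L1SupBound.symbolAct {h G : Plane → ℂ} {a μ : ℝ≥0∞} (hh : L1SupBound (symbolKernel h) a μ)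
    (hG : StronglyMeasurable G) :
    L1SupBound (symbolAct h G) (a * ∫⁻ x, ‖G x‖ₑ) μ := by
  have hle : ∀ x, ‖AnisotropicStokes.symbolAct h G x‖ₑ ≤
      ∫⁻ z, ‖symbolKernel h (z - x)‖ₑ * ‖G z‖ₑ := fun x => by
    refine (enorm_integral_le_lintegral_enorm _).trans (le_of_eq ?_)
    simp only [enorm_mul]
  have hk : Measurable fun y => ‖symbolKernel h y‖ₑ :=
    (symbolKernel h).continuous.enorm.measurable
  refine ⟨?_, fun x => ?_⟩
  · calc _ ≤ ∫⁻ x, ∫⁻ z, ‖symbolKernel h (z - x)‖ₑ * ‖G z‖ₑ := lintegral_mono hle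
      _ = ∫⁻ z, ∫⁻ x, ‖symbolKernel h (z - x)‖ₑ * ‖G z‖ₑ := by
          refine lintegral_lintegral_swap (Measurable.aemeasurable ?_)
          exact (hk.comp (measurable_snd.sub measurable_fst)).mul
            (hG.enorm.comp measurable_snd)
      _ = ∫⁻ z, (∫⁻ y, ‖symbolKernel h y‖ₑ) * ‖G z‖ₑ := by
          refine lintegral_congr fun z => ?_
          rw [lintegral_mul_const' _ _ enorm_ne_top]
          congr 1
          exact lintegral_sub_left_eq_self (fun y => ‖symbolKernel h y‖ₑ) z
      _ = (∫⁻ y, ‖symbolKernel h y‖ₑ) * ∫⁻ z, ‖G z‖ₑ := lintegral_const_mul _ hG.enorm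
      _ ≤ _ := by gcongr; exact hh.lintegral_le
  · calc _ ≤ ∫⁻ z, (a * μ) * ‖G z‖ₑ := (hle x).trans
          (lintegral_mono fun z => by gcongr; exact hh.enorm_le _)
      _ = a * μ * ∫⁻ z, ‖G z‖ₑ := lintegral_const_mul _ hG.enorm
      _ = _ := by ring

lemma L1SupBound.integral {S : ℝ → Plane → ℂ} {ν : Measure ℝ} [SFinite ν] {a : ℝ → ℝ≥0∞}
    {μ : ℝ≥0∞} (hμ : μ ≠ ⊤) (hS : ∀ᵐ y ∂ν, L1SupBound (S y) (a y) μ)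
    (hm : StronglyMeasurable (Function.uncurry S)) :
    L1SupBound (fun x => ∫ y, S y x ∂ν) (∫⁻ y, a y ∂ν) μ := by
  refine ⟨?_, fun x => ?_⟩
  · calc _ ≤ ∫⁻ x, ∫⁻ y, ‖S y x‖ₑ ∂ν := lintegral_mono fun _ =>
          enorm_integral_le_lintegral_enorm _
      _ = ∫⁻ y, (∫⁻ x, ‖S y x‖ₑ) ∂ν := by
          refine lintegral_lintegral_swap (Measurable.aemeasurable ?_)
          exact hm.enorm.comp measurable_swap
      _ ≤ _ := lintegral_mono_ae (hS.mono fun y hy => hy.lintegral_le)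
  · rw [← lintegral_mul_const' _ _ hμ]
    exact (enorm_integral_le_lintegral_enorm _).trans
      (lintegral_mono_ae (hS.mono fun y hy => hy.enorm_le x))

/-! ### Young's inequalities on the half-line. -/

/-- Convolution on the half-line. -/
def halfLineConv (k F : ℝ → ℝ≥0∞) (x : ℝ) : ℝ≥0∞ := ∫⁻ y in Ioi (0 : ℝ), k (x - y) * F y

lemma measurable_halfLineConv {k F : ℝ → ℝ≥0∞} (hk : Measurable k) (hF : Measurable F) :
    Measurable (halfLineConv k F) := by
  unfold halfLineConv
  refine Measurable.lintegral_prod_right' (f := fun p : ℝ × ℝ => k (p.1 - p.2) * F p.2) ?_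
  exact (hk.comp (measurable_fst.sub measurable_snd)).mul (hF.comp measurable_snd)

lemma lintegral_halfLineConv_le {k F : ℝ → ℝ≥0∞} (hk : Measurable k) (hF : Measurable F) :
    ∫⁻ x in Ioi (0 : ℝ), halfLineConv k F x ≤ (∫⁻ s, k s) * ∫⁻ y in Ioi (0 : ℝ), F y := by
  unfold halfLineConv
  rw [lintegral_lintegral_swap (((hk.comp (measurable_fst.sub measurable_snd)).mul
    (hF.comp measurable_snd)).aemeasurable), ← lintegral_const_mul _ hF]
  refine lintegral_mono fun y => ?_
  have : Measurable fun x => k (x - y) := hk.comp (measurable_id.sub_const y)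
  rw [lintegral_mul_const _ this]
  refine mul_le_mul' ?_ le_rfl
  exact (setLIntegral_le_lintegral _ _).trans (lintegral_sub_right_eq_self (μ := volume) k y).le

/-- Jensen's inequality for the measure k(x - y) dy on the half-line, of total mass at most ∫k. -/
lemma halfLineConv_rpow_le {k F : ℝ → ℝ≥0∞} (hk : Measurable k) (hF : Measurable F) {r : ℝ}
    (hr : 1 ≤ r) (x : ℝ) : halfLineConv k F x ^ r ≤
      (∫⁻ s, k s) ^ (r - 1) * halfLineConv k (fun y => F y ^ r) x := by
  have hr0 : 0 < r := by linarith
  have hkx : Measurable fun y => k (x - y) := hk.comp (measurable_const.sub measurable_id)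
  set ρ := (volume.restrict (Ioi (0 : ℝ))).withDensity fun y => k (x - y) with hρ
  have h := eLpNorm'_le_eLpNorm'_mul_rpow_measure_univ (μ := ρ) (f := F) zero_lt_one hr
    hF.aestronglyMeasurable
  have huniv : ρ univ ≤ ∫⁻ s, k s := by
    rw [hρ, withDensity_apply _ MeasurableSet.univ, Measure.restrict_univ]
    exact (setLIntegral_le_lintegral _ _).trans (lintegral_sub_left_eq_self (μ := volume) k x).le
  simp only [eLpNorm', enorm_eq_self, ENNReal.rpow_one, one_div, inv_one] at h
  have e1 : ∫⁻ y, F y ∂ρ = halfLineConv k F x := by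
    rw [hρ, lintegral_withDensity_eq_lintegral_mul _ hkx hF]; rfl
  have e2 : ∫⁻ y, F y ^ r ∂ρ = halfLineConv k (fun y => F y ^ r) x := by
    rw [hρ, lintegral_withDensity_eq_lintegral_mul _ hkx (hF.pow_const r)]; rfl
  rw [e1, e2] at h
  calc _ ≤ (halfLineConv k (fun y => F y ^ r) x ^ r⁻¹ * ρ univ ^ (1 - r⁻¹)) ^ r := by gcongr
    _ = ρ univ ^ (r - 1) * halfLineConv k (fun y => F y ^ r) x := by
        rw [ENNReal.mul_rpow_of_nonneg _ _ hr0.le, ← ENNReal.rpow_mul, ← ENNReal.rpow_mul,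
          inv_mul_cancel₀ hr0.ne', ENNReal.rpow_one, mul_comm]
        congr 2
        field_simp
    _ ≤ _ := by
        gcongr

/-- Young's inequality `L¹ * L^q ⊆ L^q` on the half-line. -/
lemma eLpNorm_halfLineConv_le {k F : ℝ → ℝ≥0∞} (hk : Measurable k) (hF : Measurable F)
    {q : ℝ≥0∞} (hq : 1 ≤ q) :
    eLpNorm (halfLineConv k F) q (volume.restrict (Ioi (0 : ℝ))) ≤
      (∫⁻ s, k s) * eLpNorm F q (volume.restrict (Ioi (0 : ℝ))) := by
  rcases eq_or_ne q ⊤ with rfl | hqt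
  · rw [eLpNorm_exponent_top, eLpNorm_exponent_top]
    refine eLpNormEssSup_le_of_ae_enorm_bound (Eventually.of_forall fun x => ?_)
    rw [enorm_eq_self]
    have hkx : Measurable fun y => k (x - y) := hk.comp (measurable_const.sub measurable_id)
    calc halfLineConv k F x ≤ ∫⁻ y in Ioi (0 : ℝ), k (x - y) *
          eLpNormEssSup F (volume.restrict (Ioi (0 : ℝ))) := by
          refine lintegral_mono_ae ?_
          filter_upwards [ae_le_eLpNormEssSup (f := F) (μ := volume.restrict (Ioi (0 : ℝ)))]
            with y hy
          rw [enorm_eq_self] at hy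
          gcongr
      _ ≤ _ := by
          rw [lintegral_mul_const _ hkx]
          refine mul_le_mul' ?_ le_rfl
          exact (setLIntegral_le_lintegral _ _).trans (lintegral_sub_left_eq_self (μ := volume) k x).le
  have hq0 : q ≠ 0 := (zero_lt_one.trans_le hq).ne'
  have hr : 1 ≤ q.toReal := by
    rw [← ENNReal.toReal_one]; exact ENNReal.toReal_mono hqt hq
  set r := q.toReal with hrdef
  have hr0 : 0 < r := by linarith
  rw [eLpNorm_eq_lintegral_rpow_enorm_toReal hq0 hqt, eLpNorm_eq_lintegral_rpow_enorm_toReal hq0 hqt,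
    ← hrdef]
  simp only [enorm_eq_self]
  set A := ∫⁻ s, k s
  have hFr : Measurable fun y => F y ^ r := hF.pow_const r
  have h1 : ∫⁻ x in Ioi (0 : ℝ), halfLineConv k F x ^ r ≤
      A ^ r * ∫⁻ y in Ioi (0 : ℝ), F y ^ r := by
    calc _ ≤ ∫⁻ x in Ioi (0 : ℝ), A ^ (r - 1) * halfLineConv k (fun y => F y ^ r) x :=
          lintegral_mono fun x => halfLineConv_rpow_le hk hF hr x
      _ = A ^ (r - 1) * ∫⁻ x in Ioi (0 : ℝ), halfLineConv k (fun y => F y ^ r) x :=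
          lintegral_const_mul _ (measurable_halfLineConv hk hFr)
      _ ≤ A ^ (r - 1) * (A * ∫⁻ y in Ioi (0 : ℝ), F y ^ r) := by
          gcongr; exact lintegral_halfLineConv_le hk hFr
      _ = _ := by
          rw [← mul_assoc]
          congr 1
          conv_rhs => rw [show r = (r - 1) + 1 by ring]
          rw [ENNReal.rpow_add_of_nonneg _ _ (by linarith) zero_le_one, ENNReal.rpow_one]
  calc _ ≤ (A ^ r * ∫⁻ y in Ioi (0 : ℝ), F y ^ r) ^ (1 / r) := by gcongr
    _ = _ := by
        rw [ENNReal.mul_rpow_of_nonneg _ _ (by positivity), ← ENNReal.rpow_mul,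
          mul_one_div_cancel hr0.ne', ENNReal.rpow_one]

/-- The estimate `L¹ * L¹ ⊆ L^q` on the half-line for a bounded integrable kernel. -/
lemma eLpNorm_halfLineConv_le_lintegral {k F : ℝ → ℝ≥0∞} (hk : Measurable k) (hF : Measurable F)
    {A μ : ℝ≥0∞} (hA : ∫⁻ s, k s ≤ A) (hsup : ∀ s, k s ≤ A * μ) {q : ℝ≥0∞} (hq : 1 ≤ q) :
    eLpNorm (halfLineConv k F) q (volume.restrict (Ioi (0 : ℝ))) ≤
      A * (∫⁻ y in Ioi (0 : ℝ), F y) * μ ^ (1 - (q⁻¹).toReal) := by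
  refine eLpNorm_le_of_lintegral_le_of_enorm_le ?_ ?_ (Eventually.of_forall fun x => ?_) hq
  · simpa only [enorm_eq_self] using (measurable_halfLineConv hk hF).aemeasurable
  · simp only [enorm_eq_self]
    exact (lintegral_halfLineConv_le hk hF).trans (by gcongr)
  · rw [enorm_eq_self, halfLineConv]
    calc _ ≤ ∫⁻ y in Ioi (0 : ℝ), (A * μ) * F y := lintegral_mono fun y => by gcongr; exact hsup _
      _ = A * μ * ∫⁻ y in Ioi (0 : ℝ), F y := lintegral_const_mul _ hF
      _ = _ := by ring

/-! ### Sequence norms and dyadic sums -/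

lemma seqNorm_mono {σ : ℝ≥0∞} {a b : ℤ → ℝ≥0∞} (h : ∀ j, a j ≤ b j) :
    seqNorm σ a ≤ seqNorm σ b := by
  unfold seqNorm
  split_ifs
  · exact iSup_mono h
  · gcongr with j
    exact h j

lemma seqNorm_const_mul {σ : ℝ≥0∞} (hσ : 1 ≤ σ) (C : ℝ≥0∞) (a : ℤ → ℝ≥0∞) :
    seqNorm σ (fun j => C * a j) = C * seqNorm σ a := by
  unfold seqNorm
  split_ifs with h
  · rw [ENNReal.mul_iSup]
  · have hr : 0 < σ.toReal := ENNReal.toReal_pos (zero_lt_one.trans_le hσ).ne' h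
    simp only [ENNReal.mul_rpow_of_nonneg _ _ hr.le]
    rw [ENNReal.tsum_mul_left, ENNReal.mul_rpow_of_nonneg _ _ (by positivity),
      ← ENNReal.rpow_mul, mul_one_div_cancel hr.ne', ENNReal.rpow_one]

lemma seqNorm_one (a : ℤ → ℝ≥0∞) : seqNorm 1 a = ∑' j, a j := by
  simp [seqNorm]

lemma le_seqNorm_top (a : ℤ → ℝ≥0∞) (j : ℤ) : a j ≤ seqNorm ⊤ a := by
  simp only [seqNorm, if_true]
  exact le_iSup a j

lemma summable_dyadic_exp {a c : ℝ} (ha : 0 < a) (hc : 0 < c) :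
    Summable fun j : ℤ => ((2 : ℝ) ^ j) ^ a * Real.exp (-c * 4 ^ j) := by
  have h4 : ∀ j : ℤ, (4 : ℝ) ^ j = ((2 : ℝ) ^ j) ^ 2 := fun j => by
    rw [← zpow_natCast, ← zpow_mul, mul_comm, zpow_mul]; norm_num
  refine Summable.of_nat_of_neg ?_ ?_
  -- High frequencies: the exponential absorbs 2^{n(a+1)}, one power of 2ⁿ more than needed, and
  -- leaves the geometric majorant M 2⁻ⁿ. Low frequencies below converge because a > 0.
  · obtain ⟨M, hM, h⟩ := exists_pow_mul_exp_le ⌈a + 1⌉₊ hc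
    refine Summable.of_nonneg_of_le (fun n => by positivity) (fun n => ?_)
      ((summable_geometric_of_lt_one (by norm_num : (0 : ℝ) ≤ 2⁻¹) (by norm_num)).mul_left M)
    rw [h4, zpow_natCast]
    set x : ℝ := 2 ^ n with hx
    have hx1 : 1 ≤ x := one_le_pow₀ (by norm_num)
    have h1 : x ^ a * x ≤ (1 + x ^ 2) ^ ⌈a + 1⌉₊ := by
      calc x ^ a * x = x ^ (a + 1) := by rw [Real.rpow_add (by positivity), Real.rpow_one]
        _ ≤ x ^ ((⌈a + 1⌉₊ : ℕ) : ℝ) := Real.rpow_le_rpow_of_exponent_le hx1 (Nat.le_ceil _)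
        _ = x ^ ⌈a + 1⌉₊ := Real.rpow_natCast _ _
        _ ≤ _ := by gcongr; nlinarith
    have h2 : Real.exp (-(c / 2) * x ^ 2) ≤ 1 := Real.exp_le_one_iff.2 (by nlinarith [sq_nonneg x])
    rw [inv_pow, ← hx, ← div_eq_mul_inv, le_div_iff₀ (by positivity)]
    calc x ^ a * Real.exp (-c * x ^ 2) * x = x ^ a * x * Real.exp (-c * x ^ 2) := by ring
      _ ≤ (1 + x ^ 2) ^ ⌈a + 1⌉₊ * Real.exp (-c * x ^ 2) := by gcongr
      _ ≤ M * Real.exp (-(c / 2) * x ^ 2) := h _ (sq_nonneg x)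
      _ ≤ M * 1 := by gcongr
      _ = M := mul_one M
  · refine Summable.of_nonneg_of_le (fun n => by positivity) (fun n => ?_)
      (summable_geometric_of_lt_one (r := (2⁻¹ : ℝ) ^ a) (by positivity)
        (Real.rpow_lt_one (by norm_num) (by norm_num) ha))
    have h1 : Real.exp (-c * 4 ^ (-(n : ℤ))) ≤ 1 :=
      Real.exp_le_one_iff.2 (by nlinarith [zpow_pos (by norm_num : (0 : ℝ) < 4) (-(n : ℤ))])
    calc _ ≤ ((2 : ℝ) ^ (-(n : ℤ))) ^ a * 1 := by gcongr
      _ = _ := by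
        rw [mul_one, zpow_neg, zpow_natCast, ← inv_pow, ← Real.rpow_natCast, ← Real.rpow_natCast,
          ← Real.rpow_mul (by norm_num), ← Real.rpow_mul (by norm_num), mul_comm]

/-- The sum is essentially invariant under t ↦ 4t with a shift of j, so comparing t with a power of
4 reduces it to t = 1. -/
lemma exists_dyadic_sum_le {a c : ℝ} (ha : 0 < a) (hc : 0 < c) :
    ∃ C : ℝ, 0 < C ∧ ∀ t : ℝ, 0 < t →
      ∑' j : ℤ, ENNReal.ofReal (((2 : ℝ) ^ j) ^ a * Real.exp (-c * (t * 4 ^ j))) ≤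
        ENNReal.ofReal (C * t ^ (-(a / 2))) := by
  have hs := summable_dyadic_exp ha hc
  set T := ∑' j : ℤ, ((2 : ℝ) ^ j) ^ a * Real.exp (-c * 4 ^ j) with hT
  have hT0 : 0 ≤ T := tsum_nonneg fun j => by positivity
  refine ⟨2 ^ a * T + 1, by positivity, fun t ht => ?_⟩
  -- Here 2ⁿ ≤ √t < 2ⁿ⁺¹. The lower bound allows t to be replaced by 4ⁿ, and the upper one costs the
  -- factor 2^a.
  obtain ⟨n, hn1, hn2⟩ := exists_mem_Ico_zpow (Real.sqrt_pos.2 ht) (one_lt_two (α := ℝ))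
  have h4 : ∀ j : ℤ, (4 : ℝ) ^ j = ((2 : ℝ) ^ j) ^ 2 := fun j => by
    rw [← zpow_natCast, ← zpow_mul, mul_comm, zpow_mul]; norm_num
  have ht4 : (4 : ℝ) ^ n ≤ t := by
    rw [h4, ← Real.sq_sqrt ht.le]; gcongr
  calc _ ≤ ∑' j : ℤ, ENNReal.ofReal (((2 : ℝ) ^ j) ^ a * Real.exp (-c * 4 ^ (j + n))) := by
        refine ENNReal.tsum_le_tsum fun j => ENNReal.ofReal_le_ofReal ?_
        gcongr ?_ * Real.exp ?_
        rw [zpow_add₀ (by norm_num), mul_comm ((4 : ℝ) ^ j)]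
        have : (4 : ℝ) ^ n * 4 ^ j ≤ t * 4 ^ j := by gcongr
        nlinarith
    _ = ∑' j : ℤ, ENNReal.ofReal (((2 : ℝ) ^ (j - n)) ^ a * Real.exp (-c * 4 ^ j)) := by
        rw [← (Equiv.addRight n).tsum_eq fun j : ℤ =>
          ENNReal.ofReal (((2 : ℝ) ^ (j - n)) ^ a * Real.exp (-c * 4 ^ j))]
        simp
    _ = ∑' j : ℤ, ENNReal.ofReal (((2 : ℝ) ^ n) ^ (-a)) *
          ENNReal.ofReal (((2 : ℝ) ^ j) ^ a * Real.exp (-c * 4 ^ j)) := by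
        refine tsum_congr fun j => ?_
        rw [← ENNReal.ofReal_mul (by positivity), zpow_sub₀ (by norm_num),
          Real.div_rpow (by positivity) (by positivity), Real.rpow_neg (by positivity)]
        congr 1
        ring
    _ = ENNReal.ofReal (((2 : ℝ) ^ n) ^ (-a) * T) := by
        rw [ENNReal.tsum_mul_left, ← ENNReal.ofReal_tsum_of_nonneg (fun j => by positivity) hs,
          ENNReal.ofReal_mul (by positivity)]
    _ ≤ _ := by
        refine ENNReal.ofReal_le_ofReal ?_
        have h1 : ((2 : ℝ) ^ n) ^ (-a) ≤ 2 ^ a * t ^ (-(a / 2)) := by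
          have e1 : t ^ (-(a / 2)) = (Real.sqrt t) ^ (-a) := by
            rw [Real.sqrt_eq_rpow, ← Real.rpow_mul ht.le]; congr 1; ring
          have e2 : (2 : ℝ) ^ a * (Real.sqrt t) ^ (-a) = (Real.sqrt t / 2) ^ (-a) := by
            rw [Real.div_rpow (by positivity) (by norm_num), Real.rpow_neg (by norm_num : (0:ℝ) ≤ 2)]
            field_simp
          rw [e1, e2]
          refine Real.rpow_le_rpow_of_nonpos (by positivity) ?_ (by linarith)
          rw [zpow_add_one₀ (by norm_num)] at hn2
          linarith
        have h2 : 0 ≤ t ^ (-(a / 2)) := by positivity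
        calc _ ≤ 2 ^ a * t ^ (-(a / 2)) * T := by gcongr
          _ ≤ _ := by nlinarith

/-! ### Measurability of dyadic blocks -/

/-- All dyadic blocks are jointly measurable in the vertical and horizontal variables. -/
def BlockMeasurable {ι : Type} (χ : Plane → ℝ) (u : VectorField ι) : Prop :=
  ∀ i j, StronglyMeasurable fun p : ℝ × Plane => dyadicBlock χ j (u i p.1) p.2

lemma dyadicBlock_eq (χ : Plane → ℝ) (j : ℤ) (f : 𝓢'(Plane, ℂ)) :
    dyadicBlock χ j f = symbolFun (fun ξ => (dyadicSymbol χ j ξ : ℂ)) f := by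
  simp only [dyadicBlock, dyadicMul, mul_one]

lemma continuous_dyadicBlock (hχ : IsCutoff χ) (j : ℤ) (f : 𝓢'(Plane, ℂ)) :
    Continuous (dyadicBlock χ j f) := by
  rw [dyadicBlock_eq]
  exact continuous_symbolFun (isAnnular_dyadicSymbol hχ j).toIsTestSymbol f

lemma dyadicBlock_zero (hχ : IsCutoff χ) (j : ℤ) (x : Plane) :
    dyadicBlock χ j (0 : 𝓢'(Plane, ℂ)) x = 0 := by
  rw [dyadicBlock_eq, symbolFun_eq (isAnnular_dyadicSymbol hχ j).toIsTestSymbol]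
  rfl

/-- A field is only weakly measurable in x₃. Altering it on a null set makes its blocks measurable
in x₃ at every point of a countable dense set; continuity in x_h then gives joint measurability,
needed for Fubini. -/
lemma exists_blockMeasurable {ι : Type} [Fintype ι] (hχ : IsCutoff χ) {u : VectorField ι}
    (hu : ∀ i, IsScalarField χ (u i)) :
    ∃ v : VectorField ι, (∀ᵐ y ∂(volume.restrict (Ioi (0 : ℝ))), ∀ i, v i y = u i y) ∧
      BlockMeasurable χ v := by
  classical
  have hm : ∀ (i : ι) (j : ℤ) (n : ℕ), AEStronglyMeasurable
      (fun y => dyadicBlock χ j (u i y) (TopologicalSpace.denseSeq Plane n))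
      (volume.restrict (Ioi (0 : ℝ))) := fun i j n => by
    simp only [dyadicBlock_eq, symbolFun_eq (isAnnular_dyadicSymbol hχ j).toIsTestSymbol]
    exact ((hu i).locallyIntegrable _).aestronglyMeasurable
  have hae : ∀ᵐ y ∂(volume.restrict (Ioi (0 : ℝ))), ∀ i j n,
      dyadicBlock χ j (u i y) (TopologicalSpace.denseSeq Plane n) = (hm i j n).mk _ y := by
    rw [ae_all_iff]; intro i
    rw [ae_all_iff]; intro j
    rw [ae_all_iff]; intro n
    exact (hm i j n).ae_eq_mk
  -- On a measurable set s of full measure all countably many values agree with measurable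
  -- representatives; off s the field is set to 0.
  obtain ⟨s, hs, hsm, hse⟩ := hae.exists_measurable_mem
  refine ⟨fun i y => if y ∈ s then u i y else 0, ?_, fun i j => ?_⟩
  · filter_upwards [hs] with y hy i
    rw [if_pos hy]
  have hz : ∀ z : Plane, StronglyMeasurable fun y =>
      dyadicBlock χ j (if y ∈ s then u i y else 0) z := by
    have h1 : ∀ n, StronglyMeasurable fun y => dyadicBlock χ j (if y ∈ s then u i y else 0)
        (TopologicalSpace.denseSeq Plane n) := fun n => by
      have : (fun y => dyadicBlock χ j (if y ∈ s then u i y else 0)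
          (TopologicalSpace.denseSeq Plane n)) = s.indicator ((hm i j n).mk _) := by
        ext y
        by_cases hy : y ∈ s
        · rw [if_pos hy, indicator_of_mem hy, hse y hy]
        · rw [if_neg hy, indicator_of_notMem hy, dyadicBlock_zero hχ]
      rw [this]
      exact (hm i j n).stronglyMeasurable_mk.indicator hsm
    intro z
    obtain ⟨w, hw, hwz⟩ := mem_closure_iff_seq_limit.1
      ((TopologicalSpace.denseRange_denseSeq Plane) z)
    choose n hn using hw
    refine stronglyMeasurable_of_tendsto atTop (fun k => h1 (n k)) ?_
    rw [tendsto_pi_nhds]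
    intro y
    simp only [hn]
    exact ((continuous_dyadicBlock hχ j _).tendsto z).comp hwz
  have := stronglyMeasurable_uncurry_of_continuous_of_stronglyMeasurable
    (u := fun (z : Plane) (y : ℝ) => dyadicBlock χ j (if y ∈ s then u i y else 0) z)
    (fun y => continuous_dyadicBlock hχ j _) hz
  exact this.comp_measurable measurable_swap

/-- The `L¹` norm of the `j`-th dyadic block at height `y`. -/
def blockL1 {ι : Type} [Fintype ι] (χ : Plane → ℝ) (j : ℤ) (u : VectorField ι) (y : ℝ) : ℝ≥0∞ :=
  ∫⁻ x, ‖WithLp.toLp 2 fun i => dyadicBlock χ j (u i y) x‖ₑ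

lemma measurable_blockL1 {ι : Type} [Fintype ι] {u : VectorField ι} (hu : BlockMeasurable χ u)
    (j : ℤ) : Measurable (blockL1 χ j u) := by
  unfold blockL1
  refine Measurable.lintegral_prod_right' (f := fun p : ℝ × Plane =>
    ‖WithLp.toLp 2 fun i => dyadicBlock χ j (u i p.1) p.2‖ₑ) ?_
  have h : Measurable fun p : ℝ × Plane => fun i => dyadicBlock χ j (u i p.1) p.2 :=
    measurable_pi_lambda _ fun i => (hu i j).measurable
  exact ((PiLp.continuous_toLp 2 fun _ : ι => ℂ).enorm.measurable).comp h

lemma lintegral_dyadicBlock_le {ι : Type} [Fintype ι] (χ : Plane → ℝ) (j : ℤ) (u : VectorField ι)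
    (i : ι) (y : ℝ) : ∫⁻ x, ‖dyadicBlock χ j (u i y) x‖ₑ ≤ blockL1 χ j u y :=
  lintegral_mono fun x => enorm_le_enorm_toLp (fun i => dyadicBlock χ j (u i y) x) i

lemma mixedNorm_one_eq {ι : Type} [Fintype ι] (χ : Plane → ℝ) (j : ℤ) (u : VectorField ι)
    (q : ℝ≥0∞) :
    mixedNorm 1 q (fun x₃ x => WithLp.toLp 2 fun i => dyadicBlock χ j (u i x₃) x) =
      eLpNorm (blockL1 χ j u) q (volume.restrict (Ioi (0 : ℝ))) := by
  simp only [mixedNorm, eLpNorm_one_eq_lintegral_enorm]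
  rfl

lemma stronglyMeasurable_symbolAct {g : ℝ → Plane → ℂ} (hg : ∀ s, IsTestSymbol (g s))
    (hgc : Continuous (Function.uncurry g)) {G : ℝ × Plane → ℂ} (hG : StronglyMeasurable G) :
    StronglyMeasurable fun p : ℝ × ℝ × Plane =>
      symbolAct (g p.1) (fun z => G (p.2.1, z)) p.2.2 := by
  have hk : StronglyMeasurable fun p : ℝ × Plane => symbolKernel (g p.1) p.2 := by
    simp only [fun p : ℝ × Plane => symbolKernel_apply (hg p.1) p.2]
    refine StronglyMeasurable.integral_prod_right' (f := fun q : (ℝ × Plane) × Plane =>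
      Complex.exp (((-2 * Real.pi * inner ℝ q.2 q.1.2 : ℝ) : ℂ) * Complex.I) *
        g q.1.1 ((2 * Real.pi) • q.2)) (Continuous.stronglyMeasurable ?_)
    refine Continuous.mul (by fun_prop) ?_
    exact hgc.comp (by fun_prop : Continuous fun q : (ℝ × Plane) × Plane =>
      (q.1.1, (2 * Real.pi) • q.2))
  unfold symbolAct
  refine StronglyMeasurable.integral_prod_right' (f := fun q : (ℝ × ℝ × Plane) × Plane =>
    symbolKernel (g q.1.1) (q.2 - q.1.2.2) * G (q.1.2.1, q.2)) ?_
  exact (hk.comp_measurable (by fun_prop : Measurable fun q : (ℝ × ℝ × Plane) × Plane =>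
    (q.1.1, q.2 - q.1.2.2))).mul (hG.comp_measurable (by fun_prop :
      Measurable fun q : (ℝ × ℝ × Plane) × Plane => (q.1.2.1, q.2)))

/-! ### The integrand of the operator `U` -/

/-- The integrand of `g(D) m(D) U e^{tΔ_h} (u₃ - S · u_h)`, at distance `s` from `y`. -/
def uIntegrand (g m : Plane → ℂ) (t : ℝ) (u : VectorField (Fin 3)) (s y : ℝ) (x : Plane) : ℂ :=
  symbolFun (fun ξ => g ξ * (m ξ * poissonHeatSymbol t s ξ)) (u 2 y) x
    - ∑ k : Fin 2, symbolFun (fun ξ => g ξ * (m ξ * poissonHeatSymbol t s ξ * rieszSymbol k ξ))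
        (horizontal u k y) x

lemma dyadicU_eq (χ : Plane → ℝ) (j : ℤ) (m : Plane → ℂ) (t : ℝ) (u : VectorField (Fin 3))
    (x₃ : ℝ) (x : Plane) : dyadicU χ j m t u x₃ x =
      ∫ y in (0 : ℝ)..x₃, uIntegrand (fun ξ => dyadicSymbol χ j ξ) m t u (x₃ - y) y x := rfl

/-- The symbol g is kept as a parameter so that applying h(D) only replaces g by hg; this yields the
block relations for U after Fubini. -/
lemma uIntegrand_mul {g h m : Plane → ℂ} (hg : IsAnnular g) (hh : IsTestSymbol h)
    (hm : IsHomogeneousSymbol m) (t : ℝ) (u : VectorField (Fin 3)) (s y : ℝ) (x : Plane) :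
    uIntegrand (fun ξ => h ξ * g ξ) m t u s y x = symbolAct h (uIntegrand g m t u s y) x := by
  have h0 : IsTestSymbol fun ξ => g ξ * (m ξ * poissonHeatSymbol t s ξ) :=
    (hg.mul (hm.smooth.mul (contDiffOn_poissonHeatSymbol t s))).toIsTestSymbol
  have h1 : ∀ k, IsTestSymbol fun ξ => g ξ * (m ξ * poissonHeatSymbol t s ξ * rieszSymbol k ξ) :=
    fun k => (hg.mul ((hm.smooth.mul (contDiffOn_poissonHeatSymbol t s)).mul
      (contDiffOn_rieszSymbol k))).toIsTestSymbol
  simp only [uIntegrand, mul_assoc (h _) (g _)]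
  rw [symbolFun_mul h0 hh]
  simp only [fun k => symbolFun_mul (h1 k) hh, symbolAct]
  rw [← integral_finsetSum _ fun k _ => integrable_symbolKernel_mul_symbolFun (h1 k) h _ x,
    ← integral_sub (integrable_symbolKernel_mul_symbolFun h0 h _ x)
    (integrable_finsetSum _ fun k _ => integrable_symbolKernel_mul_symbolFun (h1 k) h _ x)]
  simp only [uIntegrand, mul_sub, Finset.mul_sum]

lemma continuous_fatSymbol_mul_poissonHeat (hχ : IsCutoff χ) (j : ℤ) {m : Plane → ℂ}
    (hm : IsHomogeneousSymbol m) (t : ℝ) : Continuous (Function.uncurry fun (s : ℝ) (ξ : Plane) =>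
      (fatSymbol χ j ξ : ℂ) * (m ξ * poissonHeatSymbol t s ξ)) := by
  have h1 : Continuous fun ξ => (fatSymbol χ j ξ : ℂ) * m ξ :=
    ((isAnnular_fatSymbol hχ j).mul hm.smooth).smooth.continuous
  have h2 : Continuous fun p : ℝ × Plane => poissonHeatSymbol t p.1 p.2 := by
    unfold poissonHeatSymbol
    fun_prop
  simp only [Function.uncurry_def, ← mul_assoc]
  exact (h1.comp continuous_snd).mul h2

lemma uIntegrand_dyadic_eq (hχ : IsCutoff χ) (j : ℤ) {m : Plane → ℂ}
    (hm : IsHomogeneousSymbol m) (t : ℝ) (u : VectorField (Fin 3)) (s y : ℝ) (x : Plane) :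
    uIntegrand (fun ξ => dyadicSymbol χ j ξ) m t u s y x =
      symbolAct (fun ξ => fatSymbol χ j ξ * (m ξ * poissonHeatSymbol t s ξ))
        (dyadicBlock χ j (u 2 y)) x -
      ∑ k : Fin 2, symbolAct (fun ξ => fatSymbol χ j ξ *
        ((m ξ * rieszSymbol k ξ) * poissonHeatSymbol t s ξ))
        (dyadicBlock χ j (u k.castSucc y)) x := by
  have h1 := dyadicMul_eq_symbolAct hχ j (hm.smooth.mul (contDiffOn_poissonHeatSymbol t s))
    (u 2 y) x
  have h2 := fun k : Fin 2 => dyadicMul_eq_symbolAct hχ j ((hm.smooth.mul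
    (contDiffOn_rieszSymbol k)).mul (contDiffOn_poissonHeatSymbol t s)) (u k.castSucc y) x
  rw [← h1]
  simp only [← h2]
  simp only [uIntegrand, dyadicMul, horizontal, mul_right_comm (m _) (poissonHeatSymbol _ _ _)]

lemma stronglyMeasurable_uIntegrand (hχ : IsCutoff χ) (j : ℤ) {m : Plane → ℂ}
    (hm : IsHomogeneousSymbol m) (t : ℝ) {u : VectorField (Fin 3)} (hu : BlockMeasurable χ u) :
    StronglyMeasurable fun p : ℝ × ℝ × Plane =>
      uIntegrand (fun ξ => dyadicSymbol χ j ξ) m t u p.1 p.2.1 p.2.2 := by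
  simp only [uIntegrand_dyadic_eq hχ j hm]
  have key : ∀ {m : Plane → ℂ} (i : Fin 3), IsHomogeneousSymbol m →
      StronglyMeasurable fun p : ℝ × ℝ × Plane =>
        symbolAct (fun ξ => fatSymbol χ j ξ * (m ξ * poissonHeatSymbol t p.1 ξ))
          (dyadicBlock χ j (u i p.2.1)) p.2.2 := fun i hm =>
    stronglyMeasurable_symbolAct (fun s => ((isAnnular_fatSymbol hχ j).mul
      (hm.smooth.mul (contDiffOn_poissonHeatSymbol t s))).toIsTestSymbol)
      (continuous_fatSymbol_mul_poissonHeat hχ j hm t) (hu i j)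
  refine (key 2 hm).sub ?_
  exact Finset.stronglyMeasurable_fun_sum _ fun k _ =>
    key k.castSucc (hm.mul (isHomogeneousSymbol_rieszSymbol k))

lemma stronglyMeasurable_dyadicU (hχ : IsCutoff χ) (j : ℤ) {m : Plane → ℂ}
    (hm : IsHomogeneousSymbol m) (t : ℝ) {u : VectorField (Fin 3)} (hu : BlockMeasurable χ u) :
    StronglyMeasurable fun p : ℝ × Plane => dyadicU χ j m t u p.1 p.2 := by
  have h := (stronglyMeasurable_uIntegrand hχ j hm t hu).comp_measurable
    (by fun_prop : Measurable fun q : (ℝ × Plane) × ℝ => (q.1.1 - q.2, q.2, q.1.2))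
  -- The domain of integration depends on p. It is treated as a section of a measurable set, whose
  -- indicator is absorbed into the integrand.
  have key : ∀ s : Set ((ℝ × Plane) × ℝ), MeasurableSet s → StronglyMeasurable
      fun p : ℝ × Plane => ∫ y in {y | (p, y) ∈ s},
        uIntegrand (fun ξ => dyadicSymbol χ j ξ) m t u (p.1 - y) y p.2 := fun s hs => by
    have h2 := (h.indicator hs).integral_prod_right' (ν := volume)
    convert h2 using 2 with p
    have hs' : MeasurableSet {y | (p, y) ∈ s} := measurable_prodMk_left hs
    rw [← integral_indicator hs']
    rfl
  have h1 : MeasurableSet {q : (ℝ × Plane) × ℝ | 0 < q.2 ∧ q.2 ≤ q.1.1} :=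
    (measurableSet_lt measurable_const measurable_snd).inter
      (measurableSet_le measurable_snd measurable_fst.fst)
  have h2 : MeasurableSet {q : (ℝ × Plane) × ℝ | q.1.1 < q.2 ∧ q.2 ≤ 0} :=
    (measurableSet_lt measurable_fst.fst measurable_snd).inter
      (measurableSet_le measurable_snd measurable_const)
  exact (key _ h1).sub (key _ h2)

/-! ### Bounds for the blocks of the semigroup -/

/-- The Poisson-type kernel `2ʲ exp (-c 2ʲ s)` on the half-line. -/
def poissonKernel (c : ℝ) (j : ℤ) : ℝ → ℝ≥0∞ :=
  (Ici 0).indicator fun s => ENNReal.ofReal (2 ^ j * Real.exp (-c * (s * 2 ^ j)))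

lemma measurable_poissonKernel (c : ℝ) (j : ℤ) : Measurable (poissonKernel c j) :=
  Measurable.indicator (by fun_prop) measurableSet_Ici

lemma lintegral_poissonKernel {c : ℝ} (hc : 0 < c) (j : ℤ) :
    ∫⁻ s, poissonKernel c j s = ENNReal.ofReal c⁻¹ := by
  unfold poissonKernel
  have hb : -(c * 2 ^ j) < 0 := neg_lt_zero.2 (by positivity)
  rw [lintegral_indicator measurableSet_Ici, setLIntegral_congr Ioi_ae_eq_Ici.symm,
    ← ofReal_integral_eq_lintegral_ofReal]
  · congr 1
    have h := integral_exp_mul_Ioi hb 0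
    rw [integral_const_mul]
    have h2 : ∀ s : ℝ, -c * (s * 2 ^ j) = -(c * 2 ^ j) * s := fun s => by ring
    simp only [h2]
    rw [h, mul_zero, Real.exp_zero]
    field_simp
  · have h := (integrableOn_exp_mul_Ioi hb 0).const_mul (2 ^ j)
    refine h.congr (Eventually.of_forall fun s => ?_)
    simp only
    congr 2
    ring
  · exact Eventually.of_forall fun s => by positivity

lemma poissonKernel_le {c : ℝ} (hc : 0 < c) (j : ℤ) (s : ℝ) :
    poissonKernel c j s ≤ ENNReal.ofReal (2 ^ j) := by
  refine indicator_apply_le' (fun hs => ENNReal.ofReal_le_ofReal ?_) fun _ => zero_le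
  have hs' : 0 ≤ s := hs
  refine mul_le_of_le_one_right (by positivity) (Real.exp_le_one_iff.2 ?_)
  have : 0 ≤ c * (s * 2 ^ j) := by positivity
  linarith

lemma poissonKernel_anti {c d : ℝ} (h : c ≤ d) (j : ℤ) (s : ℝ) :
    poissonKernel d j s ≤ poissonKernel c j s := by
  refine indicator_le_indicator' fun hs => ENNReal.ofReal_le_ofReal ?_
  have hs' : 0 ≤ s := hs
  gcongr

lemma halfLineConv_mono {k l : ℝ → ℝ≥0∞} (h : ∀ s, k s ≤ l s) (F : ℝ → ℝ≥0∞) (x : ℝ) :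
    halfLineConv k F x ≤ halfLineConv l F x :=
  lintegral_mono fun y => by gcongr; exact h _

lemma exists_l1SupBound_uIntegrand (hχ : IsCutoff χ) {m : Plane → ℂ}
    (hm : IsHomogeneousSymbol m) :
    ∃ C c : ℝ, 0 < C ∧ 0 < c ∧ ∀ t s : ℝ, 0 ≤ t → 0 ≤ s → ∀ (j : ℤ) (u : VectorField (Fin 3))
      (y : ℝ), L1SupBound (uIntegrand (fun ξ => dyadicSymbol χ j ξ) m t u s y)
        (ENNReal.ofReal (C * 2 ^ j * Real.exp (-c * (s * 2 ^ j)) * Real.exp (-c * (t * 4 ^ j))) *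
          blockL1 χ j u y) (ENNReal.ofReal (4 ^ j)) := by
  obtain ⟨C0, c0, hC0, hc0, h0⟩ := exists_l1SupBound_poissonHeat hχ hm
  choose C1 c1 hC1 hc1 h1 using fun k => exists_l1SupBound_poissonHeat hχ
    (hm.mul (isHomogeneousSymbol_rieszSymbol k))
  set c := min c0 (min (c1 0) (c1 1)) with hc
  have hcc : ∀ k, c ≤ c1 k := fun k => by
    fin_cases k
    · exact (min_le_right _ _).trans (min_le_left _ _)
    · exact (min_le_right _ _).trans (min_le_right _ _)
  refine ⟨C0 + ∑ k, C1 k, c, add_pos_of_pos_of_nonneg hC0 (Finset.sum_nonneg fun k _ => (hC1 k).le),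
    lt_min hc0 (lt_min (hc1 0) (hc1 1)), fun t s ht hs j u y => ?_⟩
  have hmono : ∀ (i : Fin 3) {C' c' : ℝ} {h : Plane → ℂ}, 0 < C' → c ≤ c' →
      L1SupBound (symbolKernel h) (ENNReal.ofReal (C' * 2 ^ j * Real.exp (-c' * (s * 2 ^ j)) *
          Real.exp (-c' * (t * 4 ^ j)))) (ENNReal.ofReal (4 ^ j)) →
      L1SupBound (symbolAct h (dyadicBlock χ j (u i y)))
        (ENNReal.ofReal (C' * (2 ^ j * Real.exp (-c * (s * 2 ^ j)) *
          Real.exp (-c * (t * 4 ^ j)))) * blockL1 χ j u y) (ENNReal.ofReal (4 ^ j)) := by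
    intro i C' c' h hC' hc' hb
    refine (hb.symbolAct (continuous_dyadicBlock hχ j _).stronglyMeasurable).mono ?_
    refine mul_le_mul' (ENNReal.ofReal_le_ofReal ?_) (lintegral_dyadicBlock_le χ j u i y)
    have hs1 : Real.exp (-c' * (s * 2 ^ j)) ≤ Real.exp (-c * (s * 2 ^ j)) := by gcongr
    have ht1 : Real.exp (-c' * (t * 4 ^ j)) ≤ Real.exp (-c * (t * 4 ^ j)) := by gcongr
    rw [mul_assoc, mul_assoc, mul_assoc]
    gcongr
  have e1 := hmono 2 hC0 (min_le_left _ _) (h0 t s ht hs j)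
  have e2 := fun k => (hmono k.castSucc (hC1 k) (hcc k) (h1 k t s ht hs j))
  have hcont : ∀ (i : Fin 3) {m' : Plane → ℂ}, ContDiffOn ℝ ∞ m' {0}ᶜ →
      AEStronglyMeasurable (symbolAct (fun ξ => fatSymbol χ j ξ * m' ξ)
        (dyadicBlock χ j (u i y))) volume := fun i m' hm' => by
    have : symbolAct (fun ξ => fatSymbol χ j ξ * m' ξ) (dyadicBlock χ j (u i y)) =
        dyadicMul χ j m' (u i y) := funext fun x => (dyadicMul_eq_symbolAct hχ j hm' _ x).symm
    rw [this]
    exact (continuous_symbolFun ((isAnnular_dyadicSymbol hχ j).mul hm').toIsTestSymbol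
      _).aestronglyMeasurable
  have e3 := (e1.add ((L1SupBound.finset_sum (s := Finset.univ) (fun k _ => e2 k)
    (fun k _ => hcont k.castSucc ((hm.mul (isHomogeneousSymbol_rieszSymbol k)).smooth.mul
      (contDiffOn_poissonHeatSymbol t s)))).neg)
    (hcont 2 (hm.smooth.mul (contDiffOn_poissonHeatSymbol t s))))
  have e4 : uIntegrand (fun ξ => dyadicSymbol χ j ξ) m t u s y = _ :=
    funext fun x => (uIntegrand_dyadic_eq hχ j hm t u s y x).trans (sub_eq_add_neg _ _)
  rw [e4]
  refine e3.mono (le_of_eq ?_)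
  rw [← Finset.sum_mul, ← add_mul, ← ENNReal.ofReal_sum_of_nonneg
    (fun k _ => by have := hC1 k; positivity), ← Finset.sum_mul, ← ENNReal.ofReal_add
    (by positivity) (mul_nonneg (Finset.sum_nonneg fun k _ => (hC1 k).le) (by positivity)), ← add_mul]
  congr 2
  ring

/-- Minkowski's inequality in y₃ turns the integral defining U into a half-line convolution with a
kernel of mass independent of j; the heat factor comes out of the integral. -/
lemma exists_l1SupBound_dyadicU (hχ : IsCutoff χ) {m : Plane → ℂ}
    (hm : IsHomogeneousSymbol m) :
    ∃ C c : ℝ, 0 < C ∧ 0 < c ∧ ∀ t : ℝ, 0 ≤ t → ∀ (j : ℤ) (u : VectorField (Fin 3)),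
      BlockMeasurable χ u → ∀ x₃ : ℝ, 0 < x₃ → L1SupBound (dyadicU χ j m t u x₃)
        (ENNReal.ofReal (C * Real.exp (-c * (t * 4 ^ j))) *
          halfLineConv (poissonKernel c j) (blockL1 χ j u) x₃) (ENNReal.ofReal (4 ^ j)) := by
  obtain ⟨C, c, hC, hc, h⟩ := exists_l1SupBound_uIntegrand hχ hm
  refine ⟨C, c, hC, hc, fun t ht j u hu x₃ hx₃ => ?_⟩
  have hmeas : StronglyMeasurable fun q : ℝ × Plane =>
      uIntegrand (fun ξ => dyadicSymbol χ j ξ) m t u (x₃ - q.1) q.1 q.2 := by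
    have h0 := (stronglyMeasurable_uIntegrand hχ j hm t hu).comp_measurable
      (by fun_prop : Measurable fun q : ℝ × Plane => (x₃ - q.1, q.1, q.2))
    exact h0
  have hae : ∀ᵐ y ∂(volume.restrict (Ioc 0 x₃)), L1SupBound
      (uIntegrand (fun ξ => dyadicSymbol χ j ξ) m t u (x₃ - y) y)
        (ENNReal.ofReal (C * 2 ^ j * Real.exp (-c * ((x₃ - y) * 2 ^ j)) *
          Real.exp (-c * (t * 4 ^ j))) * blockL1 χ j u y) (ENNReal.ofReal (4 ^ j)) :=
    (ae_restrict_iff' measurableSet_Ioc).2 (Eventually.of_forall fun y hy =>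
      h t (x₃ - y) ht (by linarith [hy.2]) j u y)
  have h1 := L1SupBound.integral (S := fun y => uIntegrand (fun ξ => dyadicSymbol χ j ξ) m t u
    (x₃ - y) y) ENNReal.ofReal_ne_top hae hmeas
  have h2 : dyadicU χ j m t u x₃ = fun x => ∫ y in Ioc 0 x₃,
      uIntegrand (fun ξ => dyadicSymbol χ j ξ) m t u (x₃ - y) y x := by
    ext x
    rw [dyadicU_eq, intervalIntegral.integral_of_le hx₃.le]
  rw [h2]
  refine h1.mono ?_
  rw [halfLineConv, ← lintegral_const_mul' _ _ ENNReal.ofReal_ne_top]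
  refine (setLIntegral_mono' measurableSet_Ioc fun y hy => ?_).trans
    (lintegral_mono_set (Ioc_subset_Ioi_self))
  rw [poissonKernel, indicator_of_mem (by rw [mem_Ici]; linarith [hy.2]),
    ← mul_assoc (ENNReal.ofReal _), ← ENNReal.ofReal_mul (by positivity)]
  refine mul_le_mul' (ENNReal.ofReal_le_ofReal (le_of_eq ?_)) le_rfl
  ring

lemma exists_l1SupBound_dyadicMul_heat (hχ : IsCutoff χ) {m : Plane → ℂ}
    (hm : IsHomogeneousSymbol m) :
    ∃ C c : ℝ, 0 < C ∧ 0 < c ∧ ∀ t : ℝ, 0 ≤ t → ∀ (j : ℤ) (u : VectorField (Fin 3)) (i : Fin 3)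
      (y : ℝ), L1SupBound (dyadicMul χ j (fun ξ => heatSymbol t ξ * m ξ) (u i y))
        (ENNReal.ofReal (C * Real.exp (-c * (t * 4 ^ j))) * blockL1 χ j u y)
        (ENNReal.ofReal (4 ^ j)) := by
  obtain ⟨C, c, hC, hc, h⟩ := exists_l1SupBound_heat hχ hm
  refine ⟨C, c, hC, hc, fun t ht j u i y => ?_⟩
  have h1 : dyadicMul χ j (fun ξ => heatSymbol t ξ * m ξ) (u i y) = _ := funext fun x =>
    dyadicMul_eq_symbolAct hχ j ((contDiff_heatSymbol t).contDiffOn.mul hm.smooth) (u i y) x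
  rw [h1]
  refine ((h t ht j).symbolAct (continuous_dyadicBlock hχ j _).stronglyMeasurable).mono ?_
  gcongr
  exact lintegral_dyadicBlock_le χ j u i y

/-- The `j`-th dyadic block of `(e^{-tA} u)_h`, in the `k`-th direction. -/
def stokesHorizontalBlock (χ : Plane → ℝ) (t : ℝ) (u : VectorField (Fin 3)) (k : Fin 2) (j : ℤ)
    (x₃ : ℝ) (x : Plane) : ℂ :=
  dyadicMul χ j (heatSymbol t) (horizontal u k x₃) x
    + dyadicMul χ j (fun ξ => heatSymbol t ξ * rieszSymbol k ξ) (u 2 x₃) x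
    - dyadicU χ j (rieszSymbol k) t u x₃ x

lemma exists_l1SupBound_stokesHorizontalBlock (hχ : IsCutoff χ) (k : Fin 2) :
    ∃ C c : ℝ, 0 < C ∧ 0 < c ∧ ∀ t : ℝ, 0 ≤ t → ∀ (j : ℤ) (u : VectorField (Fin 3)),
      BlockMeasurable χ u → ∀ x₃ : ℝ, 0 < x₃ → L1SupBound (stokesHorizontalBlock χ t u k j x₃)
        (ENNReal.ofReal (C * Real.exp (-c * (t * 4 ^ j))) * (blockL1 χ j u x₃ +
          halfLineConv (poissonKernel c j) (blockL1 χ j u) x₃)) (ENNReal.ofReal (4 ^ j)) := by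
  obtain ⟨C1, c1, hC1, hc1, h1⟩ := exists_l1SupBound_dyadicMul_heat hχ isHomogeneousSymbol_one
  obtain ⟨C2, c2, hC2, hc2, h2⟩ := exists_l1SupBound_dyadicMul_heat hχ
    (isHomogeneousSymbol_rieszSymbol k)
  obtain ⟨C3, c3, hC3, hc3, h3⟩ := exists_l1SupBound_dyadicU hχ (isHomogeneousSymbol_rieszSymbol k)
  simp only [mul_one] at h1
  set c := min c1 (min c2 c3) with hc
  have hca : c ≤ c1 := min_le_left _ _
  have hcb : c ≤ c2 := (min_le_right _ _).trans (min_le_left _ _)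
  have hcd : c ≤ c3 := (min_le_right _ _).trans (min_le_right _ _)
  refine ⟨C1 + C2 + C3, c, by positivity, by positivity, fun t ht j u hu x₃ hx₃ => ?_⟩
  have hm1 : AEStronglyMeasurable (dyadicMul χ j (heatSymbol t) (u k.castSucc x₃)) volume :=
    (continuous_symbolFun ((isAnnular_dyadicSymbol hχ j).mul
      (contDiff_heatSymbol t).contDiffOn).toIsTestSymbol _).aestronglyMeasurable
  have hm2 : AEStronglyMeasurable (dyadicMul χ j (fun ξ => heatSymbol t ξ * rieszSymbol k ξ)
      (u 2 x₃)) volume :=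
    (continuous_symbolFun ((isAnnular_dyadicSymbol hχ j).mul
      ((contDiff_heatSymbol t).contDiffOn.mul (contDiffOn_rieszSymbol k))).toIsTestSymbol
      _).aestronglyMeasurable
  have e := ((h1 t ht j u k.castSucc x₃).add (h2 t ht j u 2 x₃) hm1).add (h3 t ht j u hu x₃ hx₃).neg
    (hm1.add hm2)
  have e4 : stokesHorizontalBlock χ t u k j x₃ = _ := funext fun x => sub_eq_add_neg _ _
  rw [e4]
  refine e.mono ?_
  set F := blockL1 χ j u x₃
  set E := Real.exp (-c * (t * 4 ^ j))
  have hE : ∀ {C' c' : ℝ}, 0 < C' → c ≤ c' →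
      ENNReal.ofReal (C' * Real.exp (-c' * (t * 4 ^ j))) ≤ ENNReal.ofReal (C' * E) :=
    fun h h' => by simp only [E]; gcongr
  calc _ ≤ ENNReal.ofReal (C1 * E) * F + ENNReal.ofReal (C2 * E) * F + ENNReal.ofReal (C3 * E) *
        halfLineConv (poissonKernel c j) (blockL1 χ j u) x₃ := by
        exact add_le_add (add_le_add (mul_le_mul' (hE hC1 hca) le_rfl)
          (mul_le_mul' (hE hC2 hcb) le_rfl)) (mul_le_mul' (hE hC3 hcd)
            (halfLineConv_mono (poissonKernel_anti hcd j) _ _))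
    _ ≤ ENNReal.ofReal ((C1 + C2) * E) * F + ENNReal.ofReal ((C1 + C2 + C3) * E) *
        halfLineConv (poissonKernel c j) (blockL1 χ j u) x₃ := by
        rw [← add_mul, ← ENNReal.ofReal_add (by positivity) (by positivity), ← add_mul]
        exact add_le_add le_rfl (mul_le_mul' (ENNReal.ofReal_le_ofReal
          (mul_le_mul_of_nonneg_right (by linarith) (Real.exp_nonneg _))) le_rfl)
    _ ≤ _ := by
        rw [mul_add]
        exact add_le_add (mul_le_mul' (ENNReal.ofReal_le_ofReal
          (mul_le_mul_of_nonneg_right (by linarith) (Real.exp_nonneg _))) le_rfl) le_rfl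

lemma stronglyMeasurable_stokesHorizontalBlock (hχ : IsCutoff χ) {t : ℝ}
    {u : VectorField (Fin 3)} (hu : BlockMeasurable χ u) (k : Fin 2) (j : ℤ) :
    StronglyMeasurable fun p : ℝ × Plane => stokesHorizontalBlock χ t u k j p.1 p.2 := by
  have key : ∀ (i : Fin 3) {m : Plane → ℂ}, ContDiffOn ℝ ∞ m {0}ᶜ →
      StronglyMeasurable fun p : ℝ × Plane => dyadicMul χ j m (u i p.1) p.2 := by
    intro i m hm
    simp only [dyadicMul_eq_symbolAct hχ j hm]
    have hc : Continuous (Function.uncurry fun (_ : ℝ) (ξ : Plane) => fatSymbol χ j ξ * m ξ) :=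
      ((isAnnular_fatSymbol hχ j).mul hm).smooth.continuous.comp continuous_snd
    have h : StronglyMeasurable fun p : ℝ × ℝ × Plane =>
        symbolAct (fun ξ => fatSymbol χ j ξ * m ξ) (dyadicBlock χ j (u i p.2.1)) p.2.2 :=
      stronglyMeasurable_symbolAct (g := fun _ ξ => fatSymbol χ j ξ * m ξ)
        (G := fun p : ℝ × Plane => dyadicBlock χ j (u i p.1) p.2)
        (fun _ => ((isAnnular_fatSymbol hχ j).mul hm).toIsTestSymbol) hc (hu i j)
    have h' := h.comp_measurable
      (by fun_prop : Measurable fun q : ℝ × Plane => ((0 : ℝ), q.1, q.2))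
    exact h'
  have h1 := key k.castSucc (contDiff_heatSymbol t).contDiffOn
  have h2 := key 2 ((contDiff_heatSymbol t).contDiffOn.mul (contDiffOn_rieszSymbol k))
  have h3 := stronglyMeasurable_dyadicU hχ j (isHomogeneousSymbol_rieszSymbol k) t hu
  have h4 := (h1.add h2).sub h3
  exact h4

/-! ### Fields with prescribed dyadic blocks -/

lemma L1SupBound.comp_neg {f : Plane → ℂ} {a μ : ℝ≥0∞} (h : L1SupBound f a μ) :
    L1SupBound (fun x => f (-x)) a μ :=
  ⟨(lintegral_neg_eq_self (μ := volume) fun x => ‖f x‖ₑ).trans_le h.lintegral_le,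
    fun x => h.enorm_le (-x)⟩

lemma isTestSymbol_cutoff (hχ : IsCutoff χ) : IsTestSymbol fun ξ => (χ ξ : ℂ) where
  smooth := Complex.ofRealCLM.contDiff.comp hχ.smooth
  compact := by
    have h : HasCompactSupport χ := HasCompactSupport.of_support_subset_isCompact
      (isCompact_closedBall (0 : Plane) (4 / 3))
      ((subset_tsupport χ).trans (hχ.support.trans Metric.ball_subset_closedBall))
    exact h.comp_left (g := fun r : ℝ => (r : ℂ)) Complex.ofReal_zero

lemma exists_l1SupBound_lowFrequency (hχ : IsCutoff χ) :
    ∃ C : ℝ, 0 ≤ C ∧ ∀ j : ℤ, L1SupBound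
      (symbolKernel fun ξ => (χ ((2 : ℝ) ^ (-j) • ξ) : ℂ)) (ENNReal.ofReal C)
        (ENNReal.ofReal (4 ^ j)) := by
  obtain ⟨C, hC, h⟩ := exists_l1SupBound_symbolKernel (4 / 3)
  have ht := isTestSymbol_cutoff hχ
  have hb : ∀ i : ℕ, ∃ b, ∀ ξ, ‖iteratedFDeriv ℝ i (fun ξ => (χ ξ : ℂ)) ξ‖ ≤ b := fun i =>
    (ht.compact.iteratedFDeriv i).exists_bound_of_continuous
      (ht.smooth.continuous_iteratedFDeriv (by exact_mod_cast le_top))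
  choose b hb using hb
  have hb0 : ∀ i, 0 ≤ b i := fun i => (norm_nonneg _).trans (hb i 0)
  refine ⟨C * ∑ i ∈ Finset.range 4, b i, mul_nonneg hC (Finset.sum_nonneg fun i _ => hb0 i),
    h (fun ξ => (χ ξ : ℂ)) _ ht ?_ fun i hi ξ => (hb i ξ).trans ?_⟩
  · refine (tsupport_comp_subset (g := fun r : ℝ => (r : ℂ)) Complex.ofReal_zero χ).trans ?_
    exact hχ.support.trans Metric.ball_subset_closedBall
  · exact Finset.single_le_sum (f := b) (fun i _ => hb0 i) (Finset.mem_range.2 (by omega))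

lemma lowFrequency_apply (hχ : IsCutoff χ) (j : ℤ) (f : 𝓢'(Plane, ℂ)) (ψ : 𝓢(Plane, ℂ)) :
    lowFrequency χ j f ψ = f (SchwartzMap.convolution (ContinuousLinearMap.mul ℂ ℂ)
      (symbolKernel fun ξ => (χ ((2 : ℝ) ^ (-j) • ξ) : ℂ)) ψ) := by
  have hg : IsTestSymbol fun ξ => (χ ((2 : ℝ) ^ (-j) • ξ) : ℂ) :=
    (isTestSymbol_cutoff hχ).comp_smul (by positivity)
  have hg2 : IsTestSymbol fun η : Plane => (χ ((2 : ℝ) ^ (-j) • ((2 * Real.pi) • η)) : ℂ) :=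
    hg.comp_smul (by positivity)
  rw [lowFrequency, TemperedDistribution.fourierMultiplierCLM_apply_apply]
  congr 1
  apply (FourierTransform.fourierCLE ℂ 𝓢(Plane, ℂ)).injective
  ext x
  simp only [FourierTransform.fourierCLE_apply]
  rw [fourier_mul_convolution, fourier_fourier_apply, symbolKernel, fourier_fourier_apply,
    toSchwartz_apply hg2, SchwartzMap.smulLeftCLM_apply_apply
      (hg2.compact.hasTemperateGrowth hg2.smooth), smul_eq_mul]
  congr 1
  rw [SchwartzMap.fourierInv_coe, SchwartzMap.fourier_coe, Real.fourierInv_eq_fourier_neg, neg_neg]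

/-- `symbolAct` uses the reflected kernel, so the convolution at y is `symbolAct` of the reflected ψ
at -y. -/
lemma l1SupBound_convolution {h : Plane → ℂ} {a μ : ℝ≥0∞} (hh : L1SupBound (symbolKernel h) a μ)
    (ψ : 𝓢(Plane, ℂ)) :
    L1SupBound (SchwartzMap.convolution (ContinuousLinearMap.mul ℂ ℂ) (symbolKernel h) ψ)
      (a * ∫⁻ x, ‖ψ x‖ₑ) μ := by
  have h1 := (hh.symbolAct (G := fun z => ψ (-z))
    (by fun_prop : Continuous fun z => ψ (-z)).stronglyMeasurable).comp_neg
  rw [lintegral_neg_eq_self (μ := volume) fun x => ‖ψ x‖ₑ] at h1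
  convert h1 using 1
  ext y
  rw [convolution_apply_eq_integral, symbolAct]
  rw [← integral_add_right_eq_self (μ := volume) (fun z => symbolKernel h z * ψ (y - z)) y]
  congr 1
  ext z
  congr 2 <;> abel_nf

/-- A family of functions that satisfies the relations between the dyadic blocks of a tempered
distribution. -/
structure IsBlockFamily (χ : Plane → ℝ) (g : ℤ → Plane → ℂ) : Prop where
  integrable : ∀ h, IsTestSymbol h → ∀ j x, Integrable fun z => symbolKernel h (z - x) * g j z
  symm : ∀ j k x, symbolAct (fun ξ => dyadicSymbol χ j ξ) (g k) x =
    symbolAct (fun ξ => dyadicSymbol χ k ξ) (g j) x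
  eq_zero : ∀ j k x, j + 2 ≤ k → symbolAct (fun ξ => dyadicSymbol χ j ξ) (g k) x = 0
  fat : ∀ j x, symbolAct (fun ξ => fatSymbol χ j ξ) (g j) x = g j x

/-- If the blocks are A(φⱼ) with h(D)A(φⱼ) = A(hφⱼ), the relations become identities between
symbols: commutativity, disjoint shells, and the fattened cut-off being 1 on the support of φⱼ. -/
lemma isBlockFamily_of_symbolAct (hχ : IsCutoff χ) {A : (Plane → ℂ) → Plane → ℂ}
    (hA0 : ∀ x, A (fun _ => 0) x = 0)
    (hi : ∀ j h, IsTestSymbol h → ∀ x,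
      Integrable fun z => symbolKernel h (z - x) * A (fun ξ => dyadicSymbol χ j ξ) z)
    (hA : ∀ j h, IsTestSymbol h → ∀ x, symbolAct h (A fun ξ => dyadicSymbol χ j ξ) x =
      A (fun ξ => h ξ * dyadicSymbol χ j ξ) x) :
    IsBlockFamily χ fun j => A fun ξ => dyadicSymbol χ j ξ where
  integrable h hh j x := hi j h hh x
  symm j k x := by
    rw [hA k _ (isAnnular_dyadicSymbol hχ j).toIsTestSymbol,
      hA j _ (isAnnular_dyadicSymbol hχ k).toIsTestSymbol]
    simp only [mul_comm]
  eq_zero j k x hjk := by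
    rw [hA k _ (isAnnular_dyadicSymbol hχ j).toIsTestSymbol]
    simp only [← Complex.ofReal_mul, dyadicSymbol_mul_dyadicSymbol hχ hjk, Complex.ofReal_zero, hA0]
  fat j x := by
    rw [hA j _ (isAnnular_fatSymbol hχ j).toIsTestSymbol]
    simp only [← Complex.ofReal_mul, fatSymbol_mul_dyadicSymbol hχ]

lemma symbolAct_add {h G H : Plane → ℂ} {x : Plane}
    (hG : Integrable fun z => symbolKernel h (z - x) * G z)
    (hH : Integrable fun z => symbolKernel h (z - x) * H z) :
    symbolAct h (fun z => G z + H z) x = symbolAct h G x + symbolAct h H x := by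
  simp only [symbolAct, mul_add]
  exact integral_add hG hH

lemma symbolAct_neg (h G : Plane → ℂ) (x : Plane) :
    symbolAct h (fun z => -G z) x = -symbolAct h G x := by
  simp only [symbolAct, mul_neg]
  exact integral_neg _

lemma IsBlockFamily.neg {g : ℤ → Plane → ℂ} (hg : IsBlockFamily χ g) :
    IsBlockFamily χ fun j x => -g j x where
  integrable h hh j x := by
    simp only [mul_neg]
    exact (hg.integrable h hh j x).neg
  symm j k x := by rw [symbolAct_neg, symbolAct_neg, hg.symm]
  eq_zero j k x hjk := by rw [symbolAct_neg, hg.eq_zero j k x hjk, neg_zero]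
  fat j x := by rw [symbolAct_neg, hg.fat]

lemma IsBlockFamily.add (hχ : IsCutoff χ) {f g : ℤ → Plane → ℂ} (hf : IsBlockFamily χ f)
    (hg : IsBlockFamily χ g) : IsBlockFamily χ fun j x => f j x + g j x := by
  have hd := fun j => (isAnnular_dyadicSymbol hχ j).toIsTestSymbol
  have hF := fun j => (isAnnular_fatSymbol hχ j).toIsTestSymbol
  refine ⟨fun h hh j x => ?_, fun j k x => ?_, fun j k x hjk => ?_, fun j x => ?_⟩
  · simp only [mul_add]
    exact (hf.integrable h hh j x).add (hg.integrable h hh j x)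
  · rw [symbolAct_add (hf.integrable _ (hd j) _ x) (hg.integrable _ (hd j) _ x),
      symbolAct_add (hf.integrable _ (hd k) _ x) (hg.integrable _ (hd k) _ x), hf.symm, hg.symm]
  · rw [symbolAct_add (hf.integrable _ (hd j) _ x) (hg.integrable _ (hd j) _ x),
      hf.eq_zero j k x hjk, hg.eq_zero j k x hjk, add_zero]
  · rw [symbolAct_add (hf.integrable _ (hF j) _ x) (hg.integrable _ (hF j) _ x), hf.fat, hg.fat]

/-- The series of the blocks `φ_j(D) g_k`, summed over `k`. -/
lemma IsBlockFamily.hasSum (hχ : IsCutoff χ) {g : ℤ → Plane → ℂ} (hg : IsBlockFamily χ g)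
    (j : ℤ) (x : Plane) :
    HasSum (fun k => symbolAct (fun ξ => dyadicSymbol χ j ξ) (g k) x) (g j x) := by
  have hd := fun j => (isAnnular_dyadicSymbol hχ j).toIsTestSymbol
  -- Only neighbouring shells meet. By symmetry the three remaining terms are φₖ(D)gⱼ, and their sum
  -- is the fattened cut-off applied to gⱼ, that is gⱼ.
  have h0 : ∀ k ∉ ({j - 1, j, j + 1} : Finset ℤ),
      symbolAct (fun ξ => dyadicSymbol χ j ξ) (g k) x = 0 := fun k hk => by
    simp only [Finset.mem_insert, Finset.mem_singleton, not_or] at hk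
    rcases lt_or_ge k j with h | h
    · rw [hg.symm, hg.eq_zero k j x (by omega)]
    · exact hg.eq_zero j k x (by omega)
  have hs := hasSum_sum_of_ne_finset_zero (L := .unconditional ℤ) h0
  rw [Finset.sum_insert (by simp; omega), Finset.sum_insert (by simp), Finset.sum_singleton,
    hg.symm j (j - 1), hg.symm j (j + 1)] at hs
  convert hs using 1
  rw [← hg.fat j x]
  have hi := fun k => hg.integrable _ (hd k) j x
  have hk : symbolKernel (fun ξ => (fatSymbol χ j ξ : ℂ)) =
      symbolKernel (fun ξ => (dyadicSymbol χ (j - 1) ξ : ℂ)) +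
        (symbolKernel (fun ξ => (dyadicSymbol χ j ξ : ℂ)) +
          symbolKernel (fun ξ => (dyadicSymbol χ (j + 1) ξ : ℂ))) := by
    rw [← symbolKernel_add (hd j) (hd (j + 1)),
      ← symbolKernel_add (hd (j - 1)) ((hd j).add (hd (j + 1)))]
    congr 1
    ext ξ
    simp only [fatSymbol, Complex.ofReal_add]
    ring
  simp only [symbolAct, hk, add_apply, add_mul]
  rw [← integral_add (hi _) (hi _)]
  exact integral_add (hi _) ((hi _).add (hi _))

/-- A tempered distribution with given dyadic blocks. -/
lemma exists_isHomogeneous (hχ : IsCutoff χ) {g : ℤ → Plane → ℂ} (hg : IsBlockFamily χ g)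
    (hgm : ∀ j, StronglyMeasurable (g j)) {W : ℤ → ℝ≥0∞}
    (hW : ∀ j, L1SupBound (g j) (W j) (ENNReal.ofReal (4 ^ j)))
    (hs : ∑' j, W j * ENNReal.ofReal (4 ^ j) ≠ ⊤) :
    ∃ T : 𝓢'(Plane, ℂ), (∀ ψ : 𝓢(Plane, ℂ), HasSum (fun j => ∫ x, ψ x * g j x) (T ψ)) ∧
      (∀ ψ : 𝓢(Plane, ℂ), ‖T ψ‖ₑ ≤ (∫⁻ x, ‖ψ x‖ₑ) * ∑' j, W j * ENNReal.ofReal (4 ^ j)) ∧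
      IsHomogeneous χ T ∧ ∀ j x, dyadicBlock χ j T x = g j x := by
  -- The distribution is a bounded function: the series of blocks converges absolutely and
  -- uniformly, as ‖gⱼ‖_∞ ≤ Wⱼ4ʲ.
  set G : Plane → ℂ := fun x => ∑' j, g j x with hG
  have hsum : ∀ x, Summable fun j => g j x := fun x => by
    refine Summable.of_enorm ?_
    exact ne_top_of_le_ne_top hs (ENNReal.tsum_le_tsum fun j => (hW j).enorm_le x)
  have hGm : StronglyMeasurable G := by
    refine stronglyMeasurable_of_tendsto atTop (f := fun (s : Finset ℤ) x => ∑ j ∈ s, g j x)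
      (fun s => Finset.stronglyMeasurable_fun_sum s fun j _ => hgm j) ?_
    rw [tendsto_pi_nhds]
    exact fun x => (hsum x).hasSum
  have hGb : ∀ x, ‖G x‖ₑ ≤ ∑' j, W j * ENNReal.ofReal (4 ^ j) := fun x =>
    (enorm_tsum_le_tsum_enorm).trans (ENNReal.tsum_le_tsum fun j => (hW j).enorm_le x)
  have hGL : MemLp G ⊤ volume := memLp_top_of_bound hGm.aestronglyMeasurable
    (∑' j, W j * ENNReal.ofReal (4 ^ j)).toReal (Eventually.of_forall fun x => by
      rw [← toReal_enorm]
      exact ENNReal.toReal_mono hs (hGb x))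
  have hlt : ∀ (ψ : 𝓢(Plane, ℂ)) j, ∫⁻ x, ‖ψ x * g j x‖ₑ ≤
      (∫⁻ x, ‖ψ x‖ₑ) * (W j * ENNReal.ofReal (4 ^ j)) := fun ψ j => by
    have hc : Measurable fun x => ‖ψ x‖ₑ := ψ.continuous.enorm.measurable
    rw [← lintegral_mul_const _ hc]
    refine lintegral_mono fun x => ?_
    rw [enorm_mul]
    gcongr
    exact (hW j).enorm_le x
  have hψ : ∀ ψ : 𝓢(Plane, ℂ), ∫⁻ x, ‖ψ x‖ₑ ≠ ⊤ := fun ψ => ψ.integrable.2.ne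
  have hT : ∀ ψ : 𝓢(Plane, ℂ), HasSum (fun j => ∫ x, ψ x * g j x) (∫ x, ψ x * G x) := fun ψ => by
    have hle : ∑' j, ∫⁻ x, ‖ψ x * g j x‖ₑ ≠ ⊤ := by
      refine ne_top_of_le_ne_top (ENNReal.mul_ne_top (hψ ψ) hs) ?_
      rw [← ENNReal.tsum_mul_left]
      exact ENNReal.tsum_le_tsum fun j => hlt ψ j
    have h1 := integral_tsum (f := fun j x => ψ x * g j x)
      (fun j => ψ.continuous.aestronglyMeasurable.mul (hgm j).aestronglyMeasurable) hle
    simp only [tsum_mul_left] at h1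
    rw [h1]
    refine Summable.hasSum (Summable.of_enorm (ne_top_of_le_ne_top hle ?_))
    exact ENNReal.tsum_le_tsum fun j => enorm_integral_le_lintegral_enorm _
  have hTG : ∀ ψ : 𝓢(Plane, ℂ), Lp.toTemperedDistribution (hGL.toLp G) ψ = ∫ x, ψ x * G x :=
    fun ψ => by
      rw [Lp.toTemperedDistribution_apply]
      refine integral_congr_ae ?_
      filter_upwards [hGL.coeFn_toLp] with x hx
      rw [hx, smul_eq_mul]
  refine ⟨Lp.toTemperedDistribution (hGL.toLp G), fun ψ => by rw [hTG]; exact hT ψ, fun ψ => ?_,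
    ?_, fun j x => ?_⟩
  · rw [hTG]
    refine (enorm_integral_le_lintegral_enorm _).trans ?_
    have hc : Measurable fun x => ‖ψ x‖ₑ := ψ.continuous.enorm.measurable
    rw [← lintegral_mul_const _ hc]
    refine lintegral_mono fun x => ?_
    rw [enorm_mul]
    gcongr
    exact hGb x
  · rw [IsHomogeneous, PointwiseConvergenceCLM.tendsto_iff_forall_tendsto]
    intro ψ
    obtain ⟨C, hC, hk⟩ := exists_l1SupBound_lowFrequency hχ
    set θ : ℤ → 𝓢(Plane, ℂ) := fun J => SchwartzMap.convolution (ContinuousLinearMap.mul ℂ ℂ)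
      (symbolKernel fun ξ => (χ ((2 : ℝ) ^ (-J) • ξ) : ℂ)) ψ with hθ
    set D : ℝ≥0∞ := ENNReal.ofReal C * ∫⁻ x, ‖ψ x‖ₑ with hD
    have hDt : D ≠ ⊤ := ENNReal.mul_ne_top ENNReal.ofReal_ne_top (hψ ψ)
    have hb : ∀ J, L1SupBound (θ J) D (ENNReal.ofReal (4 ^ J)) := fun J =>
      l1SupBound_convolution (hk J) ψ
    have hWt : ∀ k, W k * ENNReal.ofReal (4 ^ k) ≠ ⊤ := ENNReal.ne_top_of_tsum_ne_top hs
    have hWk : ∀ k, W k ≠ ⊤ := fun k hk => hWt k (by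
      rw [hk, ENNReal.top_mul (ENNReal.ofReal_pos.2 (by positivity)).ne'])
    -- Domination for the limit J → -∞: pairing ‖θ_J‖₁ with ‖g_k‖_∞ gives a summable bound
    -- independent of J.
    have hbd : ∀ J k, ‖∫ x, θ J x * g k x‖ ≤ (D * (W k * ENNReal.ofReal (4 ^ k))).toReal :=
      fun J k => by
        rw [← toReal_enorm]
        refine ENNReal.toReal_mono (ENNReal.mul_ne_top hDt (hWt k)) ?_
        refine (enorm_integral_le_lintegral_enorm _).trans ((hlt (θ J) k).trans ?_)
        gcongr
        exact (hb J).lintegral_le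
    -- Pairing instead ‖θ_J‖_∞ ≲ 4ᴶ with ‖g_k‖₁ makes each term tend to 0.
    have hbd2 : ∀ J k, ‖∫ x, θ J x * g k x‖ ≤ (D * W k).toReal * 4 ^ J := fun J k => by
      have h4 : (4 : ℝ) ^ J = (ENNReal.ofReal (4 ^ J)).toReal :=
        (ENNReal.toReal_ofReal (by positivity)).symm
      rw [← toReal_enorm, h4, ← ENNReal.toReal_mul]
      refine ENNReal.toReal_mono (ENNReal.mul_ne_top (ENNReal.mul_ne_top hDt (hWk k))
        ENNReal.ofReal_ne_top) ?_
      refine (enorm_integral_le_lintegral_enorm _).trans ?_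
      calc _ ≤ ∫⁻ x, D * ENNReal.ofReal (4 ^ J) * ‖g k x‖ₑ := lintegral_mono fun x => by
            rw [enorm_mul]
            gcongr
            exact (hb J).enorm_le x
        _ = D * ENNReal.ofReal (4 ^ J) * ∫⁻ x, ‖g k x‖ₑ :=
            lintegral_const_mul _ (hgm k).enorm
        _ ≤ D * ENNReal.ofReal (4 ^ J) * W k := by
            gcongr
            exact (hW k).lintegral_le
        _ = _ := by ring
    have h4 : Tendsto (fun J : ℤ => (4 : ℝ) ^ J) atBot (𝓝 0) := by
      have h := (Real.tendsto_exp_atBot).comp ((tendsto_intCast_atBot_iff (R := ℝ).2 tendsto_id).atBot_mul_const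
        (Real.log_pos (by norm_num : (1 : ℝ) < 4)))
      refine h.congr fun J => ?_
      change Real.exp ((J : ℝ) * Real.log 4) = _
      rw [mul_comm, ← Real.rpow_def_of_pos (by norm_num), Real.rpow_intCast]
    have hk0 : ∀ k, Tendsto (fun J : ℤ => ∫ x, θ J x * g k x) atBot (𝓝 0) := fun k =>
      squeeze_zero_norm (fun J => hbd2 J k) (by simpa using h4.const_mul (D * W k).toReal)
    have hlim := tendsto_tsum_of_dominated_convergence (ENNReal.summable_toReal (by
        rw [ENNReal.tsum_mul_left]
        exact ENNReal.mul_ne_top hDt hs)) hk0 (Eventually.of_forall hbd)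
    rw [tsum_zero] at hlim
    refine hlim.congr fun J => ?_
    rw [(hT (θ J)).tsum_eq, lowFrequency_apply hχ, hTG]
  · rw [dyadicBlock_eq, symbolFun_eq (isAnnular_dyadicSymbol hχ j).toIsTestSymbol, hTG]
    exact (hT _).unique (hg.hasSum hχ j x)

/-- A scalar field with given dyadic blocks. -/
lemma exists_isScalarField (hχ : IsCutoff χ) {g : ℤ → ℝ → Plane → ℂ} {V : ℤ → ℝ → ℝ≥0∞}
    (hgm : ∀ j, StronglyMeasurable fun p : ℝ × Plane => g j p.1 p.2)
    (hVm : ∀ j, Measurable (V j))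
    (hV : ∀ j, ∀ y, 0 < y → L1SupBound (g j y) (V j y) (ENNReal.ofReal (4 ^ j)))
    (hs : ∀ R : ℝ, ∫⁻ y in Ioc 0 R, ∑' j, V j y * ENNReal.ofReal (4 ^ j) ≠ ⊤)
    (hg : ∀ y, 0 < y → IsBlockFamily χ fun j => g j y) :
    ∃ v : ScalarField, IsScalarField χ v ∧
      ∀ᵐ y ∂(volume.restrict (Ioi (0 : ℝ))), ∀ j x, dyadicBlock χ j (v y) x = g j y x := by
  classical
  set W : ℝ → ℝ≥0∞ := fun y => ∑' j, V j y * ENNReal.ofReal (4 ^ j) with hW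
  have hWm : Measurable W := Measurable.tsum fun j => (hVm j).mul_const _
  have hgy : ∀ y j, StronglyMeasurable (g j y) := fun y j =>
    (hgm j).comp_measurable measurable_prodMk_left
  -- The heights at which the series of blocks converges. The field is built slice by slice there
  -- and is 0 elsewhere, so that it is measurable as a limit of finite sums.
  set s : Set ℝ := {y | 0 < y ∧ W y ≠ ⊤} with hsd
  have hsm : MeasurableSet s :=
    measurableSet_Ioi.inter (hWm (measurableSet_singleton ⊤).compl)
  have hsae : ∀ᵐ y ∂(volume.restrict (Ioi (0 : ℝ))), y ∈ s := by
    have h1 : ∀ n : ℕ, ∀ᵐ y ∂(volume : Measure ℝ), y ∈ Ioc (0 : ℝ) n → W y < ⊤ := fun n => by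
      rw [← ae_restrict_iff' measurableSet_Ioc]
      exact ae_lt_top hWm (hs n)
    rw [ae_restrict_iff' measurableSet_Ioi]
    filter_upwards [ae_all_iff.2 h1] with y hy hy0
    obtain ⟨n, hn⟩ := exists_nat_ge y
    exact ⟨hy0, (hy n ⟨hy0, hn⟩).ne⟩
  have hex : ∀ y, ∃ T : 𝓢'(Plane, ℂ), (y ∈ s → (∀ ψ : 𝓢(Plane, ℂ),
      HasSum (fun j => ∫ x, ψ x * g j y x) (T ψ)) ∧
      (∀ ψ : 𝓢(Plane, ℂ), ‖T ψ‖ₑ ≤ (∫⁻ x, ‖ψ x‖ₑ) * W y) ∧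
      IsHomogeneous χ T ∧ ∀ j x, dyadicBlock χ j T x = g j y x) ∧ (y ∉ s → T = 0) := fun y => by
    by_cases hy : y ∈ s
    · obtain ⟨T, hT⟩ := exists_isHomogeneous hχ (hg y hy.1) (hgy y) (fun j => hV j y hy.1) hy.2
      exact ⟨T, fun _ => hT, fun h => absurd hy h⟩
    · exact ⟨0, fun h => absurd h hy, fun _ => rfl⟩
  choose v hv hv0 using hex
  refine ⟨v, ⟨fun ψ => ?_, ?_⟩, ?_⟩
  · have hm : StronglyMeasurable fun y => v y ψ := by
      refine stronglyMeasurable_of_tendsto (atTop : Filter (Finset ℤ))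
        (f := fun F => s.indicator fun y => ∑ j ∈ F, ∫ x, ψ x * g j y x) (fun F => ?_) ?_
      · refine StronglyMeasurable.indicator (Finset.stronglyMeasurable_fun_sum F fun j _ => ?_) hsm
        exact StronglyMeasurable.integral_prod_right'
          (f := fun p : ℝ × Plane => ψ p.2 * g j p.1 p.2)
          ((ψ.continuous.stronglyMeasurable.comp_measurable measurable_snd).mul (hgm j))
      · rw [tendsto_pi_nhds]
        intro y
        by_cases hy : y ∈ s
        · simp only [indicator_of_mem hy]
          exact (hv y hy).1 ψ
        · simp only [indicator_of_notMem hy, hv0 y hy]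
          exact tendsto_const_nhds
    intro y hy
    refine ⟨Ioc 0 (y + 1), ?_, hm.aestronglyMeasurable, ?_⟩
    · rw [mem_nhdsWithin]
      exact ⟨Iio (y + 1), isOpen_Iio, by simp, fun z hz => ⟨hz.2, hz.1.le⟩⟩
    · have hle : ∀ z, ‖v z ψ‖ₑ ≤ (∫⁻ x, ‖ψ x‖ₑ) * W z := fun z => by
        by_cases hz : z ∈ s
        · exact (hv z hz).2.1 ψ
        · rw [hv0 z hz]
          simp
      refine lt_of_le_of_lt (lintegral_mono hle) ?_
      rw [lintegral_const_mul _ hWm]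
      exact ENNReal.mul_lt_top ψ.integrable.2 (hs (y + 1)).lt_top
  · filter_upwards [hsae] with y hy
    exact (hv y hy).2.2.1
  · filter_upwards [hsae] with y hy
    exact (hv y hy).2.2.2

/-! ### The blocks of the semigroup form block families -/

lemma isBlockFamily_dyadicMul (hχ : IsCutoff χ) {m : Plane → ℂ} (hm : ContDiffOn ℝ ∞ m {0}ᶜ)
    (f : 𝓢'(Plane, ℂ)) : IsBlockFamily χ fun j => dyadicMul χ j m f := by
  have ht := fun j => ((isAnnular_dyadicSymbol hχ j).mul hm).toIsTestSymbol
  refine isBlockFamily_of_symbolAct hχ (A := fun h => symbolFun (fun ξ => h ξ * m ξ) f)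
    (fun x => ?_) (fun j h _ x => integrable_symbolKernel_mul_symbolFun (ht j) h f x)
    (fun j h hh x => ?_)
  · simp only [zero_mul, symbolFun_zero]
  · simp only [mul_assoc]
    exact (symbolFun_mul (ht j) hh f x).symm

lemma isBlockFamily_dyadicU (hχ : IsCutoff χ) {m : Plane → ℂ} (hm : IsHomogeneousSymbol m) {t : ℝ}
    (ht : 0 ≤ t) {u : VectorField (Fin 3)} (hu : BlockMeasurable χ u) {x₃ : ℝ} (hx₃ : 0 < x₃)
    (hL : ∀ j, ∫⁻ y in Ioc 0 x₃, blockL1 χ j u y ≠ ⊤) :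
    IsBlockFamily χ fun j => dyadicU χ j m t u x₃ := by
  obtain ⟨C, c, hC, hc, hb⟩ := exists_l1SupBound_uIntegrand hχ hm
  have hmeas : ∀ j, StronglyMeasurable fun q : ℝ × Plane =>
      uIntegrand (fun ξ => dyadicSymbol χ j ξ) m t u (x₃ - q.1) q.1 q.2 := fun j => by
    have h0 := (stronglyMeasurable_uIntegrand hχ j hm t hu).comp_measurable
      (by fun_prop : Measurable fun q : ℝ × Plane => (x₃ - q.1, q.1, q.2))
    exact h0
  -- Absolute integrability over (0, x₃) × ℝ², which justifies exchanging the y₃-integral with the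
  -- action of h(D).
  have hint : ∀ j, Integrable (fun q : ℝ × Plane =>
      uIntegrand (fun ξ => dyadicSymbol χ j ξ) m t u (x₃ - q.1) q.1 q.2)
      ((volume.restrict (Ioc 0 x₃)).prod volume) := fun j => by
    refine ⟨(hmeas j).aestronglyMeasurable, ?_⟩
    rw [hasFiniteIntegral_iff_enorm, lintegral_prod _ (hmeas j).enorm.aemeasurable]
    refine lt_of_le_of_lt (setLIntegral_mono' (g := fun y =>
      ENNReal.ofReal (C * 2 ^ j) * blockL1 χ j u y) measurableSet_Ioc fun y hy => ?_) ?_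
    · refine ((hb t (x₃ - y) ht (by linarith [hy.2]) j u y).lintegral_le).trans ?_
      refine mul_le_mul' (ENNReal.ofReal_le_ofReal ?_) le_rfl
      have h1 : Real.exp (-c * ((x₃ - y) * 2 ^ j)) ≤ 1 := Real.exp_le_one_iff.2 (by
        have : 0 ≤ c * ((x₃ - y) * 2 ^ j) := mul_nonneg hc.le (mul_nonneg (by linarith [hy.2])
          (by positivity))
        linarith)
      have h2 : Real.exp (-c * (t * 4 ^ j)) ≤ 1 := Real.exp_le_one_iff.2 (by
        have : 0 ≤ c * (t * 4 ^ j) := by positivity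
        linarith)
      rw [mul_assoc]
      exact mul_le_of_le_one_right (by positivity) (mul_le_one₀ h1 (Real.exp_nonneg _) h2)
    · rw [lintegral_const_mul _ (measurable_blockL1 hu j)]
      exact ENNReal.mul_lt_top ENNReal.ofReal_lt_top (hL j).lt_top
  have hprod : ∀ j h, IsTestSymbol h → ∀ x, Integrable (fun q : ℝ × Plane =>
      symbolKernel h (q.2 - x) *
        uIntegrand (fun ξ => dyadicSymbol χ j ξ) m t u (x₃ - q.1) q.1 q.2)
      ((volume.restrict (Ioc 0 x₃)).prod volume) := fun j h hh x => by
    obtain ⟨B, hB⟩ : ∃ B, ∀ y, ‖symbolKernel h y‖ ≤ B := by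
      obtain ⟨B, hB⟩ := (symbolKernel h).decay 0 0
      exact ⟨B, fun y => by simpa using hB.2 y⟩
    refine (hint j).bdd_mul (c := B) ?_ (Eventually.of_forall fun q => hB _)
    exact ((symbolKernel h).continuous.comp (by fun_prop)).aestronglyMeasurable
  have hU : ∀ j, dyadicU χ j m t u x₃ = fun x => ∫ y in Ioc 0 x₃,
      uIntegrand (fun ξ => dyadicSymbol χ j ξ) m t u (x₃ - y) y x := fun j => by
    ext x
    rw [dyadicU_eq, intervalIntegral.integral_of_le hx₃.le]
  simp only [hU]
  refine isBlockFamily_of_symbolAct hχ (A := fun h x => ∫ y in Ioc 0 x₃,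
      uIntegrand h m t u (x₃ - y) y x) (fun x => ?_) (fun j h hh x => ?_) (fun j h hh x => ?_)
  · simp only [uIntegrand, zero_mul, symbolFun_zero, Finset.sum_const_zero, sub_zero,
      integral_zero]
  · have := (hprod j h hh x).integral_prod_right
    simpa only [integral_const_mul] using this
  · simp only [uIntegrand_mul (isAnnular_dyadicSymbol hχ j) hh hm, symbolAct]
    simp only [← integral_const_mul]
    exact (integral_integral_swap (hprod j h hh x)).symm

/-! ### Existence of the semigroup -/

lemma one_sub_toReal_inv_nonneg {q : ℝ≥0∞} (hq : 1 ≤ q) : 0 ≤ 1 - (q⁻¹).toReal := by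
  have h := ENNReal.toReal_mono ENNReal.one_ne_top (ENNReal.inv_le_one.2 hq)
  rw [ENNReal.toReal_one] at h
  linarith

lemma one_sub_toReal_inv_pos {q : ℝ≥0∞} (hq : 1 < q) : 0 < 1 - (q⁻¹).toReal := by
  have h := ENNReal.toReal_strict_mono ENNReal.one_ne_top (ENNReal.inv_lt_one.2 hq)
  rw [ENNReal.toReal_one] at h
  linarith

lemma eLpNorm_const_mul_le (C : ℝ) (F : ℝ → ℝ≥0∞) (q : ℝ≥0∞) (μ : Measure ℝ) :
    eLpNorm (fun y => ENNReal.ofReal C * F y) q μ ≤ ENNReal.ofReal C * eLpNorm F q μ :=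
  eLpNorm_le_mul_eLpNorm_of_ae_le_mul' (c := C.toNNReal) (Eventually.of_forall fun _ => le_rfl) q

lemma lintegral_Ioc_le_eLpNorm {F : ℝ → ℝ≥0∞} (hF : Measurable F) {q : ℝ≥0∞} (hq : 1 ≤ q) (R : ℝ) :
    ∫⁻ y in Ioc 0 R, F y ≤ eLpNorm F q (volume.restrict (Ioi (0 : ℝ))) *
      ENNReal.ofReal R ^ (1 - (q⁻¹).toReal) := by
  have h := eLpNorm_le_eLpNorm_mul_rpow_measure_univ (f := F) hq
    (hF.aestronglyMeasurable (μ := volume.restrict (Ioc 0 R)))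
  rw [eLpNorm_one_eq_lintegral_enorm, Measure.restrict_apply_univ, Real.volume_Ioc, sub_zero,
    ENNReal.toReal_one, div_one, one_div, ← ENNReal.toReal_inv] at h
  refine h.trans ?_
  gcongr
  exact Ioc_subset_Ioi_self

/-- The bound for the `L¹` norm of the `j`-th dyadic block of `e^{-tA} u`. -/
def stokesMajorant (χ : Plane → ℝ) (C c t : ℝ) (u : VectorField (Fin 3)) (j : ℤ) (y : ℝ) : ℝ≥0∞ :=
  ENNReal.ofReal (C * Real.exp (-c * (t * 4 ^ j))) *
    (blockL1 χ j u y + halfLineConv (poissonKernel c j) (blockL1 χ j u) y)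

lemma measurable_stokesMajorant {u : VectorField (Fin 3)} (hu : BlockMeasurable χ u) (C c t : ℝ)
    (j : ℤ) : Measurable (stokesMajorant χ C c t u j) :=
  ((measurable_blockL1 hu j).add (measurable_halfLineConv (measurable_poissonKernel c j)
    (measurable_blockL1 hu j))).const_mul _

/-- Young's inequality for the convolution term, whose kernel has mass 1/c for every j; this
produces the factor 1 + 1/c. -/
lemma eLpNorm_stokesMajorant_le {u : VectorField (Fin 3)} (hu : BlockMeasurable χ u) {C c : ℝ}
    (hC : 0 < C) (hc : 0 < c) (t : ℝ) (j : ℤ) {q : ℝ≥0∞} (hq : 1 ≤ q) :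
    eLpNorm (stokesMajorant χ C c t u j) q (volume.restrict (Ioi (0 : ℝ))) ≤
      ENNReal.ofReal (C * (1 + c⁻¹) * Real.exp (-c * (t * 4 ^ j))) *
        eLpNorm (blockL1 χ j u) q (volume.restrict (Ioi (0 : ℝ))) := by
  have hb := measurable_blockL1 hu j
  have hk := measurable_poissonKernel c j
  have hm := measurable_halfLineConv hk hb
  set E := ENNReal.ofReal (C * Real.exp (-c * (t * 4 ^ j))) with hE
  set N := eLpNorm (blockL1 χ j u) q (volume.restrict (Ioi (0 : ℝ)))
  have h1 : eLpNorm (stokesMajorant χ C c t u j) q (volume.restrict (Ioi (0 : ℝ))) ≤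
      E * eLpNorm (blockL1 χ j u + halfLineConv (poissonKernel c j) (blockL1 χ j u)) q
        (volume.restrict (Ioi (0 : ℝ))) := eLpNorm_const_mul_le _ _ _ _
  have h2 := eLpNorm_halfLineConv_le hk hb hq
  rw [lintegral_poissonKernel hc] at h2
  calc _ ≤ E * (N + ENNReal.ofReal c⁻¹ * N) := h1.trans (by
        gcongr
        exact (eLpNorm_add_le hb.aestronglyMeasurable hm.aestronglyMeasurable hq).trans
          (by gcongr))
    _ = E * ENNReal.ofReal (1 + c⁻¹) * N := by
        rw [ENNReal.ofReal_add zero_le_one (by positivity), ENNReal.ofReal_one]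
        ring
    _ = _ := by
        rw [hE, ← ENNReal.ofReal_mul (by positivity)]
        congr 2
        ring

lemma eLpNorm_blockL1_le_clNorm (u : VectorField (Fin 3)) (j : ℤ) (q : ℝ≥0∞) :
    eLpNorm (blockL1 χ j u) q (volume.restrict (Ioi (0 : ℝ))) ≤ clNorm χ 1 q ⊤ u := by
  rw [← mixedNorm_one_eq]
  exact le_seqNorm_top _ j

/-- Hölder on (0, R) passes from L^q to L¹ in height, and heat decay sums the weights 4ʲ; only an
ℓ^∞ bound on the blocks of u is required. -/
lemma lintegral_tsum_stokesMajorant_ne_top {u : VectorField (Fin 3)} (hu : BlockMeasurable χ u)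
    {C c t : ℝ} (hC : 0 < C) (hc : 0 < c) (ht : 0 < t) {q : ℝ≥0∞} (hq : 1 ≤ q)
    (hN : clNorm χ 1 q ⊤ u ≠ ⊤) (R : ℝ) :
    ∫⁻ y in Ioc 0 R, ∑' j, stokesMajorant χ C c t u j y * ENNReal.ofReal (4 ^ j) ≠ ⊤ := by
  have hm := measurable_stokesMajorant hu C c t
  obtain ⟨D, hD, hsum⟩ := exists_dyadic_sum_le (a := 2) two_pos hc
  set A : ℝ≥0∞ := ENNReal.ofReal (C * (1 + c⁻¹)) * clNorm χ 1 q ⊤ u *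
    ENNReal.ofReal R ^ (1 - (q⁻¹).toReal) with hA
  have hAt : A ≠ ⊤ := ENNReal.mul_ne_top (ENNReal.mul_ne_top ENNReal.ofReal_ne_top hN)
    (ENNReal.rpow_ne_top_of_nonneg (one_sub_toReal_inv_nonneg hq) ENNReal.ofReal_ne_top)
  rw [lintegral_tsum fun j => ((hm j).mul_const _).aemeasurable]
  refine ne_top_of_le_ne_top (ENNReal.mul_ne_top hAt (ENNReal.ofReal_ne_top
    (r := D * t ^ (-((2 : ℝ) / 2))))) ?_
  refine le_trans ?_ (mul_le_mul_right (hsum t ht) A)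
  rw [← ENNReal.tsum_mul_left]
  refine ENNReal.tsum_le_tsum fun j => ?_
  rw [lintegral_mul_const _ (hm j)]
  have h4 : ((2 : ℝ) ^ j) ^ (2 : ℝ) = 4 ^ j := by
    rw [Real.rpow_two, ← zpow_natCast, ← zpow_mul, mul_comm, zpow_mul]
    norm_num
  calc _ ≤ (ENNReal.ofReal (C * (1 + c⁻¹) * Real.exp (-c * (t * 4 ^ j))) * clNorm χ 1 q ⊤ u) *
        ENNReal.ofReal R ^ (1 - (q⁻¹).toReal) * ENNReal.ofReal (4 ^ j) := by
        refine mul_le_mul' ((lintegral_Ioc_le_eLpNorm (hm j) hq R).trans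
          (mul_le_mul' ((eLpNorm_stokesMajorant_le hu hC hc t j hq).trans
            (mul_le_mul' le_rfl (eLpNorm_blockL1_le_clNorm u j q))) le_rfl)) le_rfl
    _ = A * ENNReal.ofReal (((2 : ℝ) ^ j) ^ (2 : ℝ) * Real.exp (-c * (t * 4 ^ j))) := by
        rw [h4, hA, ENNReal.ofReal_mul (p := C * (1 + c⁻¹)) (by positivity),
          ENNReal.ofReal_mul (p := 4 ^ j) (by positivity)]
        ring
    _ = _ := rfl

lemma dyadicU_congr (j : ℤ) (m : Plane → ℂ) (t : ℝ) {u v : VectorField (Fin 3)}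
    (h : ∀ᵐ y ∂(volume.restrict (Ioi (0 : ℝ))), ∀ i, v i y = u i y) {x₃ : ℝ} (hx₃ : 0 < x₃)
    (x : Plane) : dyadicU χ j m t v x₃ x = dyadicU χ j m t u x₃ x := by
  rw [dyadicU, dyadicU, intervalIntegral.integral_of_le hx₃.le,
    intervalIntegral.integral_of_le hx₃.le]
  have hR : Ioc 0 x₃ ⊆ Ioi (0 : ℝ) := Ioc_subset_Ioi_self
  refine integral_congr_ae ?_
  filter_upwards [ae_restrict_of_ae_restrict_of_subset hR h] with y hy
  simp only [horizontal, hy]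

lemma mixedNorm_dyadicBlock_congr (j : ℤ) (p q : ℝ≥0∞) {u v : VectorField (Fin 3)}
    (h : ∀ᵐ y ∂(volume.restrict (Ioi (0 : ℝ))), ∀ i, v i y = u i y) :
    mixedNorm p q (fun x₃ x => WithLp.toLp 2 fun i => dyadicBlock χ j (v i x₃) x) =
      mixedNorm p q (fun x₃ x => WithLp.toLp 2 fun i => dyadicBlock χ j (u i x₃) x) := by
  refine eLpNorm_congr_ae ?_
  filter_upwards [h] with y hy
  simp only [hy]

/-- The right-hand sides are block families with summable majorants, so each component is realized
by a field. The work is done for a measurable modification w, and the formulas return to u because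
heights in a null set are irrelevant. -/
lemma exists_isStokesEvolution (hχ : IsCutoff χ) {t : ℝ} (ht : 0 < t) {u : VectorField (Fin 3)}
    (hu : ∀ i, IsScalarField χ (u i)) {q : ℝ≥0∞} (hq : 1 ≤ q) (hN : clNorm χ 1 q ⊤ u ≠ ⊤) :
    ∃ v, IsStokesEvolution χ t u v := by
  obtain ⟨w, hwu, hw⟩ := exists_blockMeasurable hχ hu
  have hNw : clNorm χ 1 q ⊤ w ≠ ⊤ := by
    simpa only [clNorm, mixedNorm_dyadicBlock_congr _ 1 q hwu] using hN
  have hL : ∀ x₃ j, ∫⁻ y in Ioc 0 x₃, blockL1 χ j w y ≠ ⊤ := fun x₃ j => by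
    exact ne_top_of_le_ne_top (ENNReal.mul_ne_top hNw
      (ENNReal.rpow_ne_top_of_nonneg (one_sub_toReal_inv_nonneg hq) ENNReal.ofReal_ne_top))
      ((lintegral_Ioc_le_eLpNorm (measurable_blockL1 hw j) hq x₃).trans
        (mul_le_mul' (eLpNorm_blockL1_le_clNorm w j q) le_rfl))
  have hV : ∃ v : ScalarField, IsScalarField χ v ∧ ∀ᵐ y ∂(volume.restrict (Ioi (0 : ℝ))), ∀ j x,
      dyadicBlock χ j (v y) x = dyadicU χ j (fun _ => 1) t w y x := by
    obtain ⟨C, c, hC, hc, hb⟩ := exists_l1SupBound_dyadicU hχ isHomogeneousSymbol_one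
    refine exists_isScalarField hχ (V := stokesMajorant χ C c t w)
      (fun j => stronglyMeasurable_dyadicU hχ j isHomogeneousSymbol_one t hw)
      (measurable_stokesMajorant hw C c t) (fun j y hy => (hb t ht.le j w hw y hy).mono ?_)
      (lintegral_tsum_stokesMajorant_ne_top hw hC hc ht hq hNw)
      (fun y hy => isBlockFamily_dyadicU hχ isHomogeneousSymbol_one ht.le hw hy (hL y))
    exact mul_le_mul' le_rfl le_add_self
  have hH : ∀ k : Fin 2, ∃ v : ScalarField, IsScalarField χ v ∧
      ∀ᵐ y ∂(volume.restrict (Ioi (0 : ℝ))), ∀ j x,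
        dyadicBlock χ j (v y) x = stokesHorizontalBlock χ t w k j y x := fun k => by
    obtain ⟨C, c, hC, hc, hb⟩ := exists_l1SupBound_stokesHorizontalBlock hχ k
    refine exists_isScalarField hχ (V := stokesMajorant χ C c t w)
      (fun j => stronglyMeasurable_stokesHorizontalBlock hχ hw k j)
      (measurable_stokesMajorant hw C c t) (fun j y hy => hb t ht.le j w hw y hy)
      (lintegral_tsum_stokesMajorant_ne_top hw hC hc ht hq hNw) (fun y hy => ?_)
    have h1 := isBlockFamily_dyadicMul hχ (contDiff_heatSymbol t).contDiffOn (w k.castSucc y)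
    have h2 := isBlockFamily_dyadicMul hχ ((contDiff_heatSymbol t).contDiffOn.mul
      (contDiffOn_rieszSymbol k)) (w 2 y)
    have h3 := isBlockFamily_dyadicU hχ (isHomogeneousSymbol_rieszSymbol k) ht.le hw hy (hL y)
    have h4 := (h1.add hχ h2).add hχ h3.neg
    simp only [← sub_eq_add_neg] at h4
    exact h4
  obtain ⟨v3, hv3, hb3⟩ := hV
  choose vh hvh hbh using hH
  refine ⟨Fin.snoc vh v3, fun i => ?_, ?_, ?_⟩
  · refine Fin.lastCases ?_ (fun k => ?_) i
    · simpa only [Fin.snoc_last] using hv3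
    · simpa only [Fin.snoc_castSucc] using hvh k
  · filter_upwards [hb3, ae_restrict_mem measurableSet_Ioi] with y hy hy0 j x
    rw [← dyadicU_congr j _ t hwu hy0]
    exact hy j x
  · filter_upwards [ae_all_iff.2 hbh, ae_restrict_mem measurableSet_Ioi, hwu] with y hy hy0 hwy k j x
    rw [← dyadicU_congr j _ t hwu hy0, horizontal, horizontal, ← hwy, ← hwy, Fin.snoc_castSucc]
    exact hy k j x

/-! ### Estimates for the semigroup -/

/-- The `j`-th dyadic blocks of the components of a field, as a vector-valued function. -/
def blockVector {ι : Type} [Fintype ι] (χ : Plane → ℝ) (j : ℤ) (u : VectorField ι) (x₃ : ℝ)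
    (x : Plane) : PiLp 2 fun _ : ι => ℂ :=
  WithLp.toLp 2 fun i => dyadicBlock χ j (u i x₃) x

lemma clNorm_eq {ι : Type} [Fintype ι] (χ : Plane → ℝ) (p q σ : ℝ≥0∞) (u : VectorField ι) :
    clNorm χ p q σ u = seqNorm σ fun j => mixedNorm p q (blockVector χ j u) := rfl

lemma continuous_blockVector {ι : Type} [Fintype ι] (hχ : IsCutoff χ) (j : ℤ) (u : VectorField ι)
    (x₃ : ℝ) : Continuous (blockVector χ j u x₃) :=
  (PiLp.continuous_toLp 2 fun _ : ι => ℂ).comp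
    (continuous_pi fun i => continuous_dyadicBlock hχ j (u i x₃))

lemma clNorm_zero {ι : Type} [Fintype ι] (hχ : IsCutoff χ) (p q : ℝ≥0∞) {σ : ℝ≥0∞} (hσ : 1 ≤ σ) :
    clNorm χ p q σ (0 : VectorField ι) = 0 := by
  have h : ∀ j, mixedNorm p q (blockVector χ j (0 : VectorField ι)) = 0 * 0 := fun j => by
    have h0 : ∀ y, blockVector χ j (0 : VectorField ι) y = 0 := fun y => by
      ext x i
      exact dyadicBlock_zero hχ j x
    simp only [mixedNorm, h0, eLpNorm_zero, mul_zero]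
    exact eLpNorm_zero
  rw [clNorm_eq]
  simp only [h]
  rw [seqNorm_const_mul hσ 0 fun _ => 0, zero_mul]

/-- Bernstein's inequality at each height, followed by the L^q norm in x₃. -/
lemma mixedNorm_le {ι : Type} [Fintype ι] (hχ : IsCutoff χ) {j : ℤ} {u : VectorField ι}
    {F : ℝ → ℝ≥0∞} (h : ∀ᵐ y ∂(volume.restrict (Ioi (0 : ℝ))),
      L1SupBound (blockVector χ j u y) (F y) (ENNReal.ofReal (4 ^ j))) {p : ℝ≥0∞} (hp : 1 ≤ p)
    (q : ℝ≥0∞) : mixedNorm p q (blockVector χ j u) ≤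
      ENNReal.ofReal (((4 : ℝ) ^ j) ^ (1 - (p⁻¹).toReal)) *
        eLpNorm F q (volume.restrict (Ioi (0 : ℝ))) := by
  refine le_trans (eLpNorm_mono_enorm_ae ?_) (eLpNorm_const_mul_le _ F q _)
  filter_upwards [h] with y hy
  rw [enorm_eq_self, enorm_eq_self, ← ENNReal.ofReal_rpow_of_pos (by positivity), mul_comm]
  exact hy.eLpNorm_le (continuous_blockVector hχ j u y).aestronglyMeasurable hp

/-- Bounds for the dyadic blocks of the Stokes evolution. -/
lemma exists_stokes_block_bounds (hχ : IsCutoff χ) :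
    ∃ C c : ℝ, 0 < C ∧ 0 < c ∧ ∀ t : ℝ, 0 < t → ∀ u v : VectorField (Fin 3),
      (∀ i, IsScalarField χ (u i)) → IsStokesEvolution χ t u v →
      ∃ w : VectorField (Fin 3), BlockMeasurable χ w ∧
        (∀ j q, mixedNorm 1 q (blockVector χ j w) = mixedNorm 1 q (blockVector χ j u)) ∧
        ∀ᵐ y ∂(volume.restrict (Ioi (0 : ℝ))), ∀ j,
          L1SupBound (blockVector χ j (horizontal v) y) (stokesMajorant χ C c t w j y)
            (ENNReal.ofReal (4 ^ j)) ∧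
          L1SupBound (blockVector χ j (vertical v) y)
            (ENNReal.ofReal (C * Real.exp (-c * (t * 4 ^ j))) *
              halfLineConv (poissonKernel c j) (blockL1 χ j w) y) (ENNReal.ofReal (4 ^ j)) ∧
          L1SupBound (blockVector χ j v y) (stokesMajorant χ C c t w j y)
            (ENNReal.ofReal (4 ^ j)) := by
  obtain ⟨C0, c0, hC0, hc0, h0⟩ := exists_l1SupBound_dyadicU hχ isHomogeneousSymbol_one
  choose C1 c1 hC1 hc1 h1 using fun k => exists_l1SupBound_stokesHorizontalBlock hχ k
  set c := min c0 (min (c1 0) (c1 1)) with hc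
  have hcc : ∀ k, c ≤ c1 k := fun k => by
    fin_cases k
    · exact (min_le_right _ _).trans (min_le_left _ _)
    · exact (min_le_right _ _).trans (min_le_right _ _)
  have hC1' : 0 < ∑ k, C1 k := Finset.sum_pos (fun k _ => hC1 k) Finset.univ_nonempty
  refine ⟨C0 + ∑ k, C1 k, c, by positivity, lt_min hc0 (lt_min (hc1 0) (hc1 1)),
    fun t ht u v hu hv => ?_⟩
  obtain ⟨w, hwu, hw⟩ := exists_blockMeasurable hχ hu
  refine ⟨w, hw, fun j q => mixedNorm_dyadicBlock_congr j 1 q hwu, ?_⟩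
  filter_upwards [hv.vertical_eq, hv.horizontal_eq, hwu, ae_restrict_mem measurableSet_Ioi] with
    y hy3 hyh hyw hy0 j
  have hd := fun i => (continuous_dyadicBlock hχ j (v i y)).aestronglyMeasurable
    (μ := (volume : Measure Plane))
  have hexp : ∀ {c' : ℝ}, c ≤ c' → Real.exp (-c' * (t * 4 ^ j)) ≤ Real.exp (-c * (t * 4 ^ j)) :=
    fun h => by gcongr
  set E := Real.exp (-c * (t * 4 ^ j)) with hE
  set F := blockL1 χ j w y
  set H := halfLineConv (poissonKernel c j) (blockL1 χ j w) y
  have hH : ∀ {c' : ℝ}, c ≤ c' → halfLineConv (poissonKernel c' j) (blockL1 χ j w) y ≤ H :=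
    fun h => halfLineConv_mono (poissonKernel_anti h j) _ _
  have b3 : L1SupBound (dyadicBlock χ j (v 2 y)) (ENNReal.ofReal (C0 * E) * H)
      (ENNReal.ofReal (4 ^ j)) := by
    have e : dyadicBlock χ j (v 2 y) = dyadicU χ j (fun _ => 1) t w y := funext fun x => by
      rw [hy3 j x, dyadicU_congr j _ t hwu hy0]
    rw [e]
    refine (h0 t ht.le j w hw y hy0).mono (mul_le_mul' (ENNReal.ofReal_le_ofReal ?_)
      (hH (min_le_left _ _)))
    exact mul_le_mul_of_nonneg_left (hexp (min_le_left _ _)) hC0.le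
  have bh : ∀ k : Fin 2, L1SupBound (dyadicBlock χ j (v k.castSucc y))
      (ENNReal.ofReal (C1 k * E) * (F + H)) (ENNReal.ofReal (4 ^ j)) := fun k => by
    have e : dyadicBlock χ j (v k.castSucc y) = stokesHorizontalBlock χ t w k j y :=
      funext fun x => by
        rw [stokesHorizontalBlock, dyadicU_congr j _ t hwu hy0, horizontal, hyw, hyw]
        exact hyh k j x
    rw [e]
    refine (h1 k t ht.le j w hw y hy0).mono (mul_le_mul' (ENNReal.ofReal_le_ofReal ?_)
      (add_le_add le_rfl (hH (hcc k))))
    exact mul_le_mul_of_nonneg_left (hexp (hcc k)) (hC1 k).le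
  have hsum : ∑ k, ENNReal.ofReal (C1 k * E) * (F + H) =
      ENNReal.ofReal ((∑ k, C1 k) * E) * (F + H) := by
    rw [← Finset.sum_mul, Finset.sum_mul (f := C1),
      ENNReal.ofReal_sum_of_nonneg fun k _ => mul_nonneg (hC1 k).le (Real.exp_nonneg _)]
  refine ⟨(L1SupBound.toLp bh fun k => hd _).mono ?_,
    (L1SupBound.toLp (fun _ : Fin 1 => b3) fun _ => hd _).mono ?_, ?_⟩
  · rw [hsum, stokesMajorant]
    refine mul_le_mul' (ENNReal.ofReal_le_ofReal ?_) le_rfl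
    exact mul_le_mul_of_nonneg_right (by linarith) (Real.exp_nonneg _)
  · rw [Fin.sum_univ_one]
    refine mul_le_mul' (ENNReal.ofReal_le_ofReal ?_) le_rfl
    exact mul_le_mul_of_nonneg_right (by linarith) (Real.exp_nonneg _)
  · have ball : ∀ i : Fin 3, L1SupBound (dyadicBlock χ j (v i y))
        ((Fin.snoc (fun k => ENNReal.ofReal (C1 k * E) * (F + H))
          (ENNReal.ofReal (C0 * E) * H) : Fin 3 → ℝ≥0∞) i) (ENNReal.ofReal (4 ^ j)) := fun i => by
      refine Fin.lastCases ?_ (fun k => ?_) i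
      · simp only [Fin.snoc_last]
        exact b3
      · simpa only [Fin.snoc_castSucc] using bh k
    refine (L1SupBound.toLp ball fun i => hd i).mono ?_
    rw [Fin.sum_univ_castSucc]
    simp only [Fin.snoc_last, Fin.snoc_castSucc]
    rw [hsum, stokesMajorant, add_mul C0, add_comm (C0 * _), ENNReal.ofReal_add (by positivity)
      (by positivity), add_mul]
    gcongr
    exact le_add_self

lemma rpow_four_zpow (j : ℤ) (a : ℝ) : ((4 : ℝ) ^ j) ^ a = ((2 : ℝ) ^ j) ^ (2 * a) := by
  rw [Real.rpow_mul (by positivity), Real.rpow_two, ← zpow_natCast, ← zpow_mul, mul_comm j,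
    zpow_mul]
  norm_num

/-- The passage from ℓ^∞ to ℓ¹: the blocks of the data are bounded uniformly in j, and the
heat-weighted dyadic sum supplies the power of t. -/
lemma tsum_dyadic_mul_le {C D a c t B : ℝ} {N : ℤ → ℝ≥0∞} {M : ℝ≥0∞} (hC : 0 ≤ C)
    (hN : ∀ j, N j ≤ M) (hD : ∑' j : ℤ, ENNReal.ofReal (((2 : ℝ) ^ j) ^ a *
      Real.exp (-c * (t * 4 ^ j))) ≤ ENNReal.ofReal (D * B)) {f : ℤ → ℝ≥0∞}
    (hf : ∀ j, f j ≤ ENNReal.ofReal (C * (((2 : ℝ) ^ j) ^ a * Real.exp (-c * (t * 4 ^ j)))) * N j) :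
    ∑' j, f j ≤ ENNReal.ofReal (C * D * B) * M := by
  calc ∑' j, f j ≤ ∑' j : ℤ, ENNReal.ofReal C * ENNReal.ofReal (((2 : ℝ) ^ j) ^ a *
        Real.exp (-c * (t * 4 ^ j))) * M := ENNReal.tsum_le_tsum fun j => by
          rw [← ENNReal.ofReal_mul hC]
          exact (hf j).trans (mul_le_mul' le_rfl (hN j))
    _ ≤ ENNReal.ofReal C * ENNReal.ofReal (D * B) * M := by
        rw [ENNReal.tsum_mul_right, ENNReal.tsum_mul_left]
        gcongr
    _ = _ := by rw [← ENNReal.ofReal_mul hC, mul_assoc]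

lemma exists_horizontal_le (hχ : IsCutoff χ) {r : ℝ≥0∞} (hr : 1 < r) :
    ∃ C : ℝ, 0 < C ∧ ∀ q : ℝ≥0∞, 1 ≤ q → ∀ t : ℝ, 0 < t → ∀ u v : VectorField (Fin 3),
      (∀ i, IsScalarField χ (u i)) → IsStokesEvolution χ t u v →
        clNorm χ r q 1 (horizontal v) ≤
          ENNReal.ofReal (C * t ^ (-(1 - (r⁻¹).toReal))) * clNorm χ 1 q ⊤ u := by
  obtain ⟨C, c, hC, hc, h⟩ := exists_stokes_block_bounds hχ
  obtain ⟨D, hD, hsum⟩ := exists_dyadic_sum_le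
    (mul_pos two_pos (one_sub_toReal_inv_pos hr)) hc
  refine ⟨C * (1 + c⁻¹) * D, by positivity, fun q hq t ht u v hu hv => ?_⟩
  obtain ⟨w, hw, hwu, hb⟩ := h t ht u v hu hv
  rw [clNorm_eq, seqNorm_one]
  have hs := hsum t ht
  rw [mul_div_cancel_left₀ _ two_ne_zero] at hs
  refine tsum_dyadic_mul_le (by positivity) (N := fun j => mixedNorm 1 q (blockVector χ j u))
    (fun j => le_seqNorm_top _ j) hs fun j => ?_
  refine (mixedNorm_le hχ (hb.mono fun y hy => (hy j).1) hr.le q).trans ?_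
  refine (mul_le_mul' le_rfl (eLpNorm_stokesMajorant_le hw hC hc t j hq)).trans (le_of_eq ?_)
  rw [← mixedNorm_one_eq, ← mul_assoc, ← ENNReal.ofReal_mul (by positivity), rpow_four_zpow,
    ← hwu j q]
  congr 2
  ring

lemma exists_vertical_le (hχ : IsCutoff χ) {p q : ℝ≥0∞} (hp : 1 ≤ p) (hq : 1 ≤ q)
    (hpq : (p, q) ≠ (1, 1)) :
    ∃ C : ℝ, 0 < C ∧ ∀ t : ℝ, 0 < t → ∀ u v : VectorField (Fin 3),
      (∀ i, IsScalarField χ (u i)) → IsStokesEvolution χ t u v →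
        clNorm χ p q 1 (vertical v) ≤
          ENNReal.ofReal (C * t ^ (-(1 - (p⁻¹).toReal) - 1 / 2 * (1 - (q⁻¹).toReal))) *
            clNorm χ 1 1 ⊤ u := by
  obtain ⟨C, c, hC, hc, h⟩ := exists_stokes_block_bounds hχ
  -- The dyadic exponent is positive exactly when (p, q) ≠ (1, 1); otherwise the low frequencies
  -- would not be summable.
  have ha : 0 < 2 * (1 - (p⁻¹).toReal) + (1 - (q⁻¹).toReal) := by
    have hp0 := one_sub_toReal_inv_nonneg hp
    have hq0 := one_sub_toReal_inv_nonneg hq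
    rcases hp.eq_or_lt with rfl | hp1
    · rcases hq.eq_or_lt with rfl | hq1
      · exact absurd rfl hpq
      · linarith [one_sub_toReal_inv_pos hq1]
    · linarith [one_sub_toReal_inv_pos hp1]
  obtain ⟨D, hD, hsum⟩ := exists_dyadic_sum_le ha hc
  refine ⟨C * (1 + c⁻¹) * D, by positivity, fun t ht u v hu hv => ?_⟩
  obtain ⟨w, hw, hwu, hb⟩ := h t ht u v hu hv
  rw [clNorm_eq, seqNorm_one]
  have hs := hsum t ht
  rw [show -((2 * (1 - (p⁻¹).toReal) + (1 - (q⁻¹).toReal)) / 2) =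
    -(1 - (p⁻¹).toReal) - 1 / 2 * (1 - (q⁻¹).toReal) by ring] at hs
  refine tsum_dyadic_mul_le (by positivity) (N := fun j => mixedNorm 1 1 (blockVector χ j u))
    (fun j => le_seqNorm_top _ j) hs fun j => ?_
  refine (mixedNorm_le hχ (hb.mono fun y hy => (hy j).2.1) hp q).trans ?_
  -- One constant 1 + 1/c serves both requirements on the kernel: mass 1/c, and sup norm at most 2ʲ.
  have hk := eLpNorm_halfLineConv_le_lintegral (measurable_poissonKernel c j)
    (measurable_blockL1 hw j) (A := ENNReal.ofReal (1 + c⁻¹)) (μ := ENNReal.ofReal (2 ^ j))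
    (by rw [lintegral_poissonKernel hc]; exact ENNReal.ofReal_le_ofReal (by linarith))
    (fun s => (poissonKernel_le hc j s).trans (by
      rw [← ENNReal.ofReal_mul (by positivity)]
      refine ENNReal.ofReal_le_ofReal (le_mul_of_one_le_left (by positivity) ?_)
      have : 0 < c⁻¹ := by positivity
      linarith)) hq
  refine (mul_le_mul' le_rfl ((eLpNorm_const_mul_le _ _ _ _).trans
    (mul_le_mul' le_rfl hk))).trans (le_of_eq ?_)
  have h1 : mixedNorm 1 1 (blockVector χ j w) = ∫⁻ y in Ioi (0 : ℝ), blockL1 χ j w y := by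
    rw [show mixedNorm 1 1 (blockVector χ j w) = _ from mixedNorm_one_eq χ j w 1,
      eLpNorm_one_eq_lintegral_enorm]
    rfl
  rw [← h1, hwu, ENNReal.ofReal_rpow_of_pos (by positivity), rpow_four_zpow,
    Real.rpow_add (by positivity)]
  rw [ENNReal.ofReal_mul (p := C * (1 + c⁻¹)) (by positivity),
    ENNReal.ofReal_mul (p := C) (by positivity), ENNReal.ofReal_mul (p := C) (by positivity),
    ENNReal.ofReal_mul (by positivity), ENNReal.ofReal_mul (by positivity)]
  ring

/-- Block by block with the heat factor bounded by 1. The constant depends on neither q nor σ, so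
one bound serves both 𝓛^{1,q}_σ and 𝓛^1_σ. -/
lemma exists_clNorm_le (hχ : IsCutoff χ) :
    ∃ C : ℝ, 0 < C ∧ ∀ q : ℝ≥0∞, 1 ≤ q → ∀ σ : ℝ≥0∞, 1 ≤ σ → ∀ t : ℝ, 0 < t →
      ∀ u v : VectorField (Fin 3), (∀ i, IsScalarField χ (u i)) → IsStokesEvolution χ t u v →
        clNorm χ 1 q σ v ≤ ENNReal.ofReal C * clNorm χ 1 q σ u := by
  obtain ⟨C, c, hC, hc, h⟩ := exists_stokes_block_bounds hχ
  refine ⟨C * (1 + c⁻¹), by positivity, fun q hq σ hσ t ht u v hu hv => ?_⟩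
  obtain ⟨w, hw, hwu, hb⟩ := h t ht u v hu hv
  rw [clNorm_eq, clNorm_eq, ← seqNorm_const_mul hσ]
  refine seqNorm_mono fun j => ?_
  refine (mixedNorm_le hχ (hb.mono fun y hy => (hy j).2.2) le_rfl q).trans ?_
  rw [inv_one, ENNReal.toReal_one, sub_self, Real.rpow_zero, ENNReal.ofReal_one, one_mul, ← hwu,
    show mixedNorm 1 q (blockVector χ j w) = _ from mixedNorm_one_eq χ j w q]
  refine (eLpNorm_stokesMajorant_le hw hC hc t j hq).trans (mul_le_mul' ?_ le_rfl)
  refine ENNReal.ofReal_le_ofReal (mul_le_of_le_one_right (by positivity)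
    (Real.exp_le_one_iff.2 ?_))
  have : 0 ≤ c * (t * 4 ^ j) := by positivity
  linarith

lemma isStokesEvolution_stokesSemigroup {t : ℝ} {u : VectorField (Fin 3)}
    (h : ∃ v, IsStokesEvolution χ t u v) :
    IsStokesEvolution χ t u (stokesSemigroup χ t u) := by
  rw [stokesSemigroup, dif_pos h]
  exact h.choose_spec

/-- The estimates concern all fields, including those without an evolution; there the semigroup
takes the default value 0 and its norms vanish. -/
lemma isStokesEvolution_or_eq_zero (χ : Plane → ℝ) (t : ℝ) (u : VectorField (Fin 3)) :
    IsStokesEvolution χ t u (stokesSemigroup χ t u) ∨ stokesSemigroup χ t u = 0 := by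
  by_cases h : ∃ v, IsStokesEvolution χ t u v
  · exact Or.inl (isStokesEvolution_stokesSemigroup h)
  · exact Or.inr (dif_neg h)

end AnisotropicStokes

end

/-! ### The lemma. -/

open AnisotropicStokes in
theorem lemma2p5 (χ : Plane → ℝ) (hχ : IsCutoff χ) :
    -- `e^{-tA} u₀` is well defined for `u₀` in any of the spaces `𝓛^{1,q}_∞`
    (∀ q : ℝ≥0∞, 1 ≤ q → ∀ t : ℝ, 0 < t → ∀ u₀ : VectorField (Fin 3),
      (∀ i, IsScalarField χ (u₀ i)) → IsDivFree u₀ → clNorm χ 1 q ⊤ u₀ < ⊤ →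
        IsStokesEvolution χ t u₀ (stokesSemigroup χ t u₀)) ∧
    -- the enhanced dissipation estimates
    (∀ p q r : ℝ≥0∞, 1 ≤ p → 1 ≤ q → (p, q) ≠ (1, 1) → 1 < r →
      ∃ C : ℝ, 0 < C ∧ ∀ t : ℝ, 0 < t → ∀ u₀ : VectorField (Fin 3),
        (∀ i, IsScalarField χ (u₀ i)) → IsDivFree u₀ →
          clNorm χ r q 1 (horizontal (stokesSemigroup χ t u₀)) ≤
              ENNReal.ofReal (C * t ^ (-(1 - (r⁻¹).toReal))) * clNorm χ 1 q ⊤ u₀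
              + ENNReal.ofReal (C * t ^ (-(1 - (r⁻¹).toReal) - 1 / 2 * (1 - (q⁻¹).toReal)))
                * clNorm χ 1 1 ⊤ u₀ ∧
          clNorm χ p q 1 (vertical (stokesSemigroup χ t u₀)) ≤
              ENNReal.ofReal (C * t ^ (-(1 - (p⁻¹).toReal) - 1 / 2 * (1 - (q⁻¹).toReal)))
                * clNorm χ 1 1 ⊤ u₀) ∧
    -- the estimates in `𝓛^{1,q}_σ`
    (∀ q : ℝ≥0∞, 1 < q → ∃ C : ℝ, 0 < C ∧ ∀ σ : ℝ≥0∞, 1 ≤ σ → ∀ t : ℝ, 0 < t →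
      ∀ u₀ : VectorField (Fin 3), (∀ i, IsScalarField χ (u₀ i)) → IsDivFree u₀ →
        clNorm χ 1 q σ (stokesSemigroup χ t u₀) ≤
          ENNReal.ofReal C * clNorm χ 1 q σ u₀
          + ENNReal.ofReal (C * t ^ (-(1 / 2 * (1 - (q⁻¹).toReal)))) * clNorm χ 1 1 ⊤ u₀) ∧
    -- the uniform bound in `𝓛^1_σ`
    (∃ C : ℝ, 0 < C ∧ ∀ σ : ℝ≥0∞, 1 ≤ σ → ∀ t : ℝ, 0 < t →
      ∀ u₀ : VectorField (Fin 3), (∀ i, IsScalarField χ (u₀ i)) → IsDivFree u₀ →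
        clNorm χ 1 1 σ (stokesSemigroup χ t u₀) ≤ ENNReal.ofReal C * clNorm χ 1 1 σ u₀) := by
  obtain ⟨K, hK, hb⟩ := exists_clNorm_le hχ
  refine ⟨fun q hq t ht u hu _ hN => isStokesEvolution_stokesSemigroup
    (exists_isStokesEvolution hχ ht hu hq hN.ne), fun p q r hp hq hpq hr => ?_,
    fun q hq => ⟨K, hK, fun σ hσ t ht u hu _ => ?_⟩, ⟨K, hK, fun σ hσ t ht u hu _ => ?_⟩⟩
  · obtain ⟨C1, hC1, h1⟩ := exists_horizontal_le hχ hr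
    obtain ⟨C2, hC2, h2⟩ := exists_vertical_le hχ hp hq hpq
    -- One constant must serve both estimates, and the sum dominates each of the two.
    refine ⟨C1 + C2, by positivity, fun t ht u hu _ => ?_⟩
    rcases isStokesEvolution_or_eq_zero χ t u with hv | hv
    · refine ⟨((h1 q hq t ht u _ hu hv).trans (mul_le_mul' (ENNReal.ofReal_le_ofReal ?_)
        le_rfl)).trans le_self_add, (h2 t ht u _ hu hv).trans
        (mul_le_mul' (ENNReal.ofReal_le_ofReal ?_) le_rfl)⟩
      · exact mul_le_mul_of_nonneg_right (by linarith) (by positivity)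
      · exact mul_le_mul_of_nonneg_right (by linarith) (by positivity)
    · rw [hv]
      exact ⟨(clNorm_zero (ι := Fin 2) hχ r q le_rfl).trans_le zero_le,
        (clNorm_zero (ι := Fin 1) hχ p q le_rfl).trans_le zero_le⟩
  · rcases isStokesEvolution_or_eq_zero χ t u with hv | hv
    · exact (hb q hq.le σ hσ t ht u _ hu hv).trans le_self_add
    · rw [hv, clNorm_zero hχ 1 q hσ]
      exact zero_le
  · rcases isStokesEvolution_or_eq_zero χ t u with hv | hv
    · exact hb 1 le_rfl σ hσ t ht u _ hu hv
    · rw [hv, clNorm_zero hχ 1 1 hσ]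
      exact zero_le
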